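/- Let $\mathcal X$ be a complex Banach space and let $-\mathcal A$ be the generator of a bounded analytic semigroup $\mathcal T$ on $\mathcal X$; that is, $\mathcal T$ is holomorphic and bounded on a sector around $(0,\infty)$, satisfies $\mathcal T(z+w)=\mathcal T(z)\mathcal T(w)$ there, has the property that $x=0$ whenever $\mathcal T(t)x=0$ for all $t>0$, and $(\mu+\mathcal A)^{-1}x=\int_0^\infty e^{-\mu t}\mathcal T(t)x\,dt$ for all $\mu>0$, $x\in\mathcal X$ (strong continuity at $0$, i.e. density of $D(\mathcal A)$, is not assumed). Let $\omega_{\mathcal A}$ be the sectoriality angle of $\mathcal A$, let $\omega\in(\omega_{\mathcal A},\frac{\pi}{2})$, $S_\omega=\{z\in\mathbb C: z\neq 0,\ |\arg z|<\omega\}$, and let $0\neq\psi\in H^\infty_0(S_\omega)$, i.e. $\psi$ is holomorphic on $S_\omega$, not identically zero, and $|\psi(z)|\le C\min(|z|^{\alpha},|z|^{-\alpha})$ on $S_\omega$ for some $C,\alpha>0$. For $t>0$ let \[ \psi(t\mathcal A)=\frac1{2\pi i}\int_{\partial S_\nu}\psi(z)\,(z-t\mathcal A)^{-1}\,dz ,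 \] where $\omega_{\mathcal A}<\nu<\omega$ and $\partial S_\nu$ is positively oriented. Let \[ X:=\Big\{x\in\mathcal X:\int_0^\infty\|t^{-1}\psi(t\mathcal A)x\|_{\mathcal X}\,dt<\infty\Big\},\qquad \|x\|_X:=\|x\|_{\mathcal X}+\int_0^\infty\|t^{-1}\psi(t\mathcal A)x\|_{\mathcal X}\,dt . \] Then $(X,\|\cdot\|_X)$ is a Banach space, the part $A$ of $\mathcal A$ in $X$, given by $D(A)=\{x\in X\cap D(\mathcal A):\mathcal Ax\in X\}$ and $Ax=\mathcal Ax$, is a closed operator, and $A$ has $L^1$-maximal regularity on $\mathbb R_+=(0,\infty)$: there is a constant $C$ such that for every $f\in L^1(\mathbb R_+;X)$ there is a unique strong solution $u$ of \[ u'(t)+Au(t)=f(t)\ \text{ for a.e. } t>0,\qquad u(0)=0 \] (that is, $u\in W^{1,1}_{loc}([0,\infty);X)$, $u(0)=0$, and for a.e. $t>0$ one has $u(t)\in D(A)$ and the equation), and this $u$ satisfies $u',Au\in L^1(\mathbb R_+;X)$ and \[ \|u'\|_{L^1(\mathbb R_+;X)}+\|Au\|_{L^1(\mathbb R_+;X)}\le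 C\,\|f\|_{L^1(\mathbb R_+;X)} . \] Moreover, $D(\mathcal A)\cap R(\mathcal A)\subset X$, where $R(\mathcal A)$ is the range of $\mathcal A$. In particular, if $D(\mathcal A)$ and $R(\mathcal A)$ are dense in $\mathcal X$, then $X$ is dense in $\mathcal X$. -/

import Mathlib

open MeasureTheory Set

noncomputable section

namespace L1MR

variable {E : Type*} [NormedAddCommGroup E] [NormedSpace ℂ E]

/-! ### Sectors, resolvents, sectorial operators -/

/-- The open sector `S_ω = {z ≠ 0 : |arg z| < ω}`. -/
def sector (ω : ℝ) : Set ℂ := {z | z ≠ 0 ∧ |z.arg| < ω}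

/-- `R` is the bounded, everywhere defined, two-sided inverse of `z - A`. -/
def IsResolventAt (A : E →ₗ.[ℂ] E) (z : ℂ) (R : E →L[ℂ] E) : Prop :=
  (∀ x : E, ∃ h : R x ∈ A.domain, z • R x - A ⟨R x, h⟩ = x) ∧
    ∀ y : A.domain, R (z • (y : E) - A y) = y

/-- The resolvent set `ρ(A)`. -/
def resolventSet (A : E →ₗ.[ℂ] E) : Set ℂ := {z | ∃ R : E →L[ℂ] E, IsResolventAt A z R}

open Classical in
/-- The resolvent `R(z, A) = (z - A)⁻¹` for `z ∈ ρ(A)` (and `0` for other `z`). -/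
def resolvent (A : E →ₗ.[ℂ] E) (z : ℂ) : E →L[ℂ] E :=
  if h : ∃ R : E →L[ℂ] E, IsResolventAt A z R then h.choose else 0

/-- `A` is sectorial of angle `θ ∈ [0, π)`: the spectrum lies in the closed sector
`{|arg z| ≤ θ}` (which contains `0`, because `arg 0 = 0` in Mathlib), and `z R(z, A)` is bounded
outside every larger closed sector. -/
def IsSectorial (A : E →ₗ.[ℂ] E) (θ : ℝ) : Prop :=
  0 ≤ θ ∧ θ < Real.pi ∧ (∀ z : ℂ, θ < |z.arg| → z ∈ resolventSet A) ∧
    ∀ θ' : ℝ, θ < θ' → θ' < Real.pi →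
      ∃ M : ℝ, ∀ z : ℂ, θ' < |z.arg| → ‖z • resolvent A z‖ ≤ M

/-- The sectoriality angle `ω_A` of a sectorial operator `A`. -/
def sectorialityAngle (A : E →ₗ.[ℂ] E) : ℝ := sInf {θ | IsSectorial A θ}

/-! ### Bounded analytic semigroups -/

/-- `T` is a bounded analytic semigroup (given on a sector of half-angle `δ ∈ (0, π/2]`), not
necessarily strongly continuous at `0`. -/
structure IsBoundedAnalyticSemigroup (T : ℂ → E →L[ℂ] E) (δ : ℝ) : Prop where
  pos : 0 < δ
  le_half_pi : δ ≤ Real.pi / 2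
  holomorphic : DifferentiableOn ℂ T (sector δ)
  bounded : ∃ M : ℝ, ∀ z ∈ sector δ, ‖T z‖ ≤ M
  map_add : ∀ z ∈ sector δ, ∀ w ∈ sector δ, T (z + w) = (T z).comp (T w)
  nondegenerate : ∀ x : E, (∀ t : ℝ, 0 < t → T (t : ℂ) x = 0) → x = 0

/-- `-A` is the generator of a bounded analytic semigroup `T`: for every `μ > 0` the operator
`μ + A` is invertible with `(μ + A)⁻¹ x = ∫₀^∞ e^{-μ t} T(t) x dt`. -/
def NegGeneratesBoundedAnalyticSemigroup (A : E →ₗ.[ℂ] E) : Prop :=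
  ∃ (T : ℂ → E →L[ℂ] E) (δ : ℝ), IsBoundedAnalyticSemigroup T δ ∧
    ∀ μ : ℝ, 0 < μ → ∃ Q : E →L[ℂ] E,
      (∀ x : E, Q x = ∫ t in Ioi (0 : ℝ), Real.exp (-(μ * t)) • T (t : ℂ) x) ∧
      (∀ x : E, ∃ h : Q x ∈ A.domain, (μ : ℂ) • Q x + A ⟨Q x, h⟩ = x) ∧
      ∀ y : A.domain, Q ((μ : ℂ) • (y : E) + A y) = y

/-! ### The holomorphic functional calculus on `H₀^∞(S_ω)` -/

/-- `ψ ∈ H₀^∞(S_ω)`; the values of `ψ` outside `S_ω` play no role. -/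
def MemHInftyZero (ω : ℝ) (ψ : ℂ → ℂ) : Prop :=
  DifferentiableOn ℂ ψ (sector ω) ∧
    ∃ C α : ℝ, 0 < C ∧ 0 < α ∧ ∀ z ∈ sector ω, ‖ψ z‖ ≤ C * min (‖z‖ ^ α) (‖z‖ ^ (-α))

/-- The part of the Cauchy integral on the ray `{r e^{iν} : r > 0}`, oriented away from `0`:
`∫₀^∞ ψ(r e^{iν}) R(r e^{iν}, A) e^{iν} dr`, as an operator-valued Bochner integral. -/
def rayIntegral (A : E →ₗ.[ℂ] E) (ψ : ℂ → ℂ) (ν : ℝ) : E →L[ℂ] E :=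
  ∫ r in Ioi (0 : ℝ),
    (ψ (r * Complex.exp (ν * Complex.I)) * Complex.exp (ν * Complex.I)) •
      resolvent A (r * Complex.exp (ν * Complex.I))

/-- `ψ(A) = (2πi)⁻¹ ∫_Γ ψ(z) R(z, A) dz`, where `Γ = ∂S_ν` is the positively oriented boundary of
the sector `S_ν`. For `ψ ∈ H₀^∞(S_ω)` this is used with `ω_A < ν < ω`. -/
def calculus (A : E →ₗ.[ℂ] E) (ν : ℝ) (ψ : ℂ → ℂ) : E →L[ℂ] E :=
  (2 * Real.pi * Complex.I)⁻¹ • (rayIntegral A ψ (-ν) - rayIntegral A ψ ν)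

/-! ### The space `X = {x : ∫₀^∞ ‖t⁻¹ ψ(tA) x‖ dt < ∞}` -/

/-- The function `t ↦ t⁻¹ ψ(tA) x`. -/
def orbit (A : E →ₗ.[ℂ] E) (ν : ℝ) (ψ : ℂ → ℂ) (x : E) (t : ℝ) : E :=
  t⁻¹ • calculus ((t : ℂ) • A) ν ψ x

lemma orbit_add (A : E →ₗ.[ℂ] E) (ν : ℝ) (ψ : ℂ → ℂ) (x y : E) :
    orbit A ν ψ (x + y) = orbit A ν ψ x + orbit A ν ψ y := by
  funext t; simp [orbit]

lemma orbit_smul (A : E →ₗ.[ℂ] E) (ν : ℝ) (ψ : ℂ → ℂ) (c : ℂ) (x : E) :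
    orbit A ν ψ (c • x) = c • orbit A ν ψ x := by
  funext t
  change t⁻¹ • calculus ((t : ℂ) • A) ν ψ (c • x) = c • t⁻¹ • calculus ((t : ℂ) • A) ν ψ x
  rw [map_smul]
  exact smul_comm _ _ _

lemma orbit_zero (A : E →ₗ.[ℂ] E) (ν : ℝ) (ψ : ℂ → ℂ) : orbit A ν ψ 0 = 0 := by
  funext t; simp [orbit]

/-- `X` as a linear subspace of the ambient space. -/
def optSubmodule (A : E →ₗ.[ℂ] E) (ν : ℝ) (ψ : ℂ → ℂ) : Submodule ℂ E where
  carrier := {x | IntegrableOn (orbit A ν ψ x) (Ioi 0)}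
  zero_mem' := by
    change IntegrableOn _ (Ioi 0) volume
    rw [orbit_zero]
    exact integrableOn_zero
  add_mem' := by
    intro x y hx hy
    change IntegrableOn _ (Ioi 0) volume
    rw [orbit_add]
    exact Integrable.add hx hy
  smul_mem' := by
    intro c x hx
    change IntegrableOn _ (Ioi 0) volume
    rw [orbit_smul]
    exact Integrable.smul c hx

/-- `X` as a type of its own, to carry its own norm (not the norm of the ambient space). -/
def OptSpace (A : E →ₗ.[ℂ] E) (ν : ℝ) (ψ : ℂ → ℂ) : Type _ := ↥(optSubmodule A ν ψ)

section OptSpace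

variable (A : E →ₗ.[ℂ] E) (ν : ℝ) (ψ : ℂ → ℂ)

instance : AddCommGroup (OptSpace A ν ψ) := inferInstanceAs (AddCommGroup ↥(optSubmodule A ν ψ))

instance : Module ℂ (OptSpace A ν ψ) := inferInstanceAs (Module ℂ ↥(optSubmodule A ν ψ))

/-- The norm `‖x‖_X = ‖x‖ + ∫₀^∞ ‖t⁻¹ ψ(tA) x‖ dt`. -/
instance : Norm (OptSpace A ν ψ) where
  norm x := ‖x.1‖ + ∫ t in Ioi (0 : ℝ), ‖orbit A ν ψ x.1 t‖

lemma optSpace_core : NormedSpace.Core ℂ (OptSpace A ν ψ) where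
  norm_nonneg x := add_nonneg (norm_nonneg _) (integral_nonneg fun _ => norm_nonneg _)
  norm_smul c x := by
    change ‖c • x.1‖ + ∫ t in Ioi (0 : ℝ), ‖orbit A ν ψ (c • x.1) t‖
      = ‖c‖ * (‖x.1‖ + ∫ t in Ioi (0 : ℝ), ‖orbit A ν ψ x.1 t‖)
    simp only [orbit_smul, Pi.smul_apply, norm_smul, integral_const_mul, mul_add]
  norm_triangle x y := by
    change ‖x.1 + y.1‖ + ∫ t in Ioi (0 : ℝ), ‖orbit A ν ψ (x.1 + y.1) t‖
      ≤ (‖x.1‖ + ∫ t in Ioi (0 : ℝ), ‖orbit A ν ψ x.1 t‖)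
        + (‖y.1‖ + ∫ t in Ioi (0 : ℝ), ‖orbit A ν ψ y.1 t‖)
    have hx : IntegrableOn (orbit A ν ψ x.1) (Ioi 0) := x.2
    have hy : IntegrableOn (orbit A ν ψ y.1) (Ioi 0) := y.2
    have h1 := norm_add_le x.1 y.1
    have h2 : ∫ t in Ioi (0 : ℝ), ‖orbit A ν ψ (x.1 + y.1) t‖
        ≤ ∫ t in Ioi (0 : ℝ), (‖orbit A ν ψ x.1 t‖ + ‖orbit A ν ψ y.1 t‖) := by
      rw [orbit_add]
      exact integral_mono (Integrable.norm (Integrable.add hx hy))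
        (Integrable.add hx.norm hy.norm) fun t => norm_add_le _ _
    rw [integral_add hx.norm hy.norm] at h2
    linarith
  norm_eq_zero_iff x := by
    change ‖x.1‖ + ∫ t in Ioi (0 : ℝ), ‖orbit A ν ψ x.1 t‖ = 0 ↔ x = 0
    constructor
    · intro h
      have h1 : 0 ≤ ∫ t in Ioi (0 : ℝ), ‖orbit A ν ψ x.1 t‖ :=
        integral_nonneg fun _ => norm_nonneg _
      have h2 : ‖x.1‖ = 0 := le_antisymm (by linarith) (norm_nonneg _)
      exact Subtype.ext (norm_eq_zero.1 h2)
    · intro h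
      have h1 : x.1 = 0 := congrArg Subtype.val h
      simp [h1, orbit_zero]

instance : NormedAddCommGroup (OptSpace A ν ψ) := NormedAddCommGroup.ofCore (optSpace_core A ν ψ)

instance : NormedSpace ℂ (OptSpace A ν ψ) := NormedSpace.ofCore (optSpace_core A ν ψ)

end OptSpace

/-! ### The part of an operator -/

/-- The part of `A` in the subspace `S`: its domain is `{x ∈ S ∩ D(A) : A x ∈ S}`, and it acts
as `A`. -/
def partOn (A : E →ₗ.[ℂ] E) (S : Submodule ℂ E) : ↥S →ₗ.[ℂ] ↥S where
  domain :=
    { carrier := {x | ∃ h : (x : E) ∈ A.domain, A ⟨x, h⟩ ∈ S}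
      zero_mem' := by
        refine ⟨A.domain.zero_mem, ?_⟩
        have h : A (0 : A.domain) ∈ S := by rw [A.map_zero]; exact S.zero_mem
        exact h
      add_mem' := by
        rintro x y ⟨hx, hx'⟩ ⟨hy, hy'⟩
        refine ⟨A.domain.add_mem hx hy, ?_⟩
        have h : A (⟨x, hx⟩ + ⟨y, hy⟩) ∈ S := by rw [A.map_add]; exact S.add_mem hx' hy'
        exact h
      smul_mem' := by
        rintro c x ⟨hx, hx'⟩
        refine ⟨A.domain.smul_mem c hx, ?_⟩
        have h : A (c • ⟨x, hx⟩) ∈ S := by rw [A.map_smul]; exact S.smul_mem c hx'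
        exact h }
  toFun :=
    { toFun := fun x => ⟨A ⟨x.1.1, x.2.choose⟩, x.2.choose_spec⟩
      map_add' := fun x y =>
        Subtype.ext (A.map_add ⟨x.1.1, x.2.choose⟩ ⟨y.1.1, y.2.choose⟩)
      map_smul' := fun c x => Subtype.ext (A.map_smul c ⟨x.1.1, x.2.choose⟩) }

/-- The part of `A` in `X`, as an operator on the normed space `X`. -/
def optPart (A : E →ₗ.[ℂ] E) (ν : ℝ) (ψ : ℂ → ℂ) : OptSpace A ν ψ →ₗ.[ℂ] OptSpace A ν ψ :=
  partOn A (optSubmodule A ν ψ)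

/-! ### Maximal regularity -/

/-- `u` is a strong solution on `(0, ∞)` of `u' + B u = f`, `u(0) = x`, with derivative
`u' = v` and with `B u = g` almost everywhere. The first two fields say that
`u ∈ W^{1,1}_loc([0, ∞); Y)` (continuous representative) with weak derivative `v` and
`u(0) = x`. -/
structure IsStrongSolution {Y : Type*} [NormedAddCommGroup Y] [NormedSpace ℂ Y]
    (B : Y →ₗ.[ℂ] Y) (f : ℝ → Y) (x : Y) (u v g : ℝ → Y) : Prop where
  locallyIntegrable : ∀ τ : ℝ, 0 < τ → IntegrableOn v (Ioc 0 τ)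
  eq_integral : ∀ t : ℝ, 0 ≤ t → u t = x + ∫ s in (0 : ℝ)..t, v s
  equation : ∀ᵐ t ∂(volume.restrict (Ioi (0 : ℝ))),
    (∃ h : u t ∈ B.domain, B ⟨u t, h⟩ = g t) ∧ v t + g t = f t

/-- `B` has `L¹`-maximal regularity on `ℝ₊ = (0, ∞)`: for every `f ∈ L¹(ℝ₊; Y)` the problem
`u' + B u = f`, `u(0) = 0` has a unique strong solution, for it `u'` and `B u` are in `L¹(ℝ₊; Y)`,
and `‖u'‖₁ + ‖B u‖₁ ≤ C ‖f‖₁` with `C` independent of `f`. It is not required that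
`u ∈ L¹(ℝ₊; Y)`. -/
def HasL1MaximalRegularity {Y : Type*} [NormedAddCommGroup Y] [NormedSpace ℂ Y]
    (B : Y →ₗ.[ℂ] Y) : Prop :=
  ∃ C : ℝ, ∀ f : ℝ → Y, IntegrableOn f (Ioi 0) →
    ∃ u v g : ℝ → Y, IsStrongSolution B f 0 u v g ∧
      IntegrableOn v (Ioi 0) ∧ IntegrableOn g (Ioi 0) ∧
      (∫ t in Ioi (0 : ℝ), ‖v t‖) + (∫ t in Ioi (0 : ℝ), ‖g t‖)
        ≤ C * ∫ t in Ioi (0 : ℝ), ‖f t‖ ∧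
      ∀ u₁ v₁ g₁ : ℝ → Y, IsStrongSolution B f 0 u₁ v₁ g₁ → ∀ t : ℝ, 0 ≤ t → u₁ t = u t

end L1MR

end

noncomputable section

namespace L1MR

section

/-! ### Contour integrals over the boundary of a sector -/

/-! Everything rests on one estimate, `SemigroupData.lintegral_genExp_le`: ∫₀^∞ ‖A T(t) x‖_X dt ≤ K
∫₀^∞ ‖t⁻¹ ψ(tA) x‖ dt. Granted it, Tonelli's theorem makes convolution with A T(·) bounded on L¹(ℝ₊;
X); in L¹ it is enough that the orbits of the kernel are integrable, and no singular integral theory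
is needed.

The estimate comes from the reproducing formula `SemigroupData.reproducing`, κ A e^{-tA} = ∫₀^∞ A²
e^{-(t+cs)A} ψ(sA) ds with κ = ∫₀^∞ ψ(s) e^{-cs} ds. For a scalar z it is a dilation and a rotation
of the path of integration; Fubini transfers it to A. Since ψ ≠ 0 and the Laplace transform is
injective, some c > 0 gives κ ≠ 0. The operator A² e^{-τA} maps the ambient space into X with norm
O(τ⁻²), by `CalcSetup.enorm_genSqExp_le` and the embedding estimate
`CalcSetup.lintegral_enorm_calculus_scale_le`. Finally ∫₀^∞ (t + cs)⁻² dt = (cs)⁻¹ produces exactly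
the weight in the norm of X.

As D(A) need not be dense, T(t)x need not converge to x at 0. Statements about A are therefore
tested after applying Q = (1 + A)⁻¹, which is injective and encodes the graph: A x = y iff Q(x + y)
= x (`CalcSetup.mem_graph_iff`). Full multiplicativity of the calculus is not needed; only products
with Q, T(t), A T(t) and A² T(t) occur. Calculus and semigroup are linked by T(t) φ(A) = (e^{-tz}
φ)(A) (`SemigroupData.mul_calculus`) and by the normalisation (z(1+z)⁻²)(A) = Q - Q²
(`CalcSetup.calculus_id_mul_inv_sq`), obtained by moving the contour through the complement of the
sector.

The rest is softer. Completeness of X is Fatou's lemma, closedness of its operator is the graph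
criterion, and D(A) ∩ R(A) ⊂ X because A(1 + A)⁻² maps the ambient space into X. For uniqueness, T(τ
- s) applied to Q times the difference of two solutions is constant in s; nondegeneracy of T
concludes. -/

open Filter Topology Complex in
/-- Horizontal line integrals of an exponentially decaying holomorphic function on a closed strip
agree. -/
theorem integral_strip_eq {G : Type*} [NormedAddCommGroup G] [NormedSpace ℂ G] [CompleteSpace G]
    (H : ℂ → G) {b₁ b₂ C a R₀ : ℝ} (hb : b₁ ≤ b₂) (ha : 0 < a)
    (hd : DifferentiableOn ℂ H {ζ | b₁ ≤ ζ.im ∧ ζ.im ≤ b₂})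
    (hbd : ∀ ζ : ℂ, b₁ ≤ ζ.im → ζ.im ≤ b₂ → R₀ ≤ |ζ.re| → ‖H ζ‖ ≤ C * Real.exp (-a * |ζ.re|)) :
    (∀ b ∈ Icc b₁ b₂, Integrable fun x : ℝ => H (x + b * I)) ∧
      ∫ x : ℝ, H (x + b₁ * I) = ∫ x : ℝ, H (x + b₂ * I) := by
  have hint : ∀ b ∈ Icc b₁ b₂, Integrable fun x : ℝ => H (x + b * I) := by
    intro b hb'
    have hc : Continuous fun x : ℝ => H (x + b * I) := by
      rw [← continuousOn_univ]
      refine hd.continuousOn.comp (by fun_prop) fun x _ => ?_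
      simpa using hb'
    have hloc := hc.locallyIntegrable (μ := volume)
    have hexp1 : IntegrableAtFilter (fun x : ℝ => Real.exp (-a * |x|)) atTop := by
      refine ⟨Ioi 0, Ioi_mem_atTop 0, ?_⟩
      refine (integrableOn_exp_mul_Ioi (neg_lt_zero.2 ha) 0).congr_fun ?_ measurableSet_Ioi
      intro x hx
      simp only [abs_of_pos (mem_Ioi.1 hx)]
    have hexp2 : IntegrableAtFilter (fun x : ℝ => Real.exp (-a * |x|)) atBot := by
      refine ⟨Iic 0, Iic_mem_atBot 0, ?_⟩
      refine (integrableOn_exp_mul_Iic ha 0).congr_fun ?_ measurableSet_Iic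
      intro x hx
      simp only [abs_of_nonpos (mem_Iic.1 hx)]
      congr 1; ring
    refine hloc.integrable_of_isBigO_atBot_atTop (g := fun x => Real.exp (-a * |x|))
      (g' := fun x => Real.exp (-a * |x|)) ?_ hexp2 ?_ hexp1
    · refine Asymptotics.IsBigO.of_bound C ?_
      filter_upwards [eventually_le_atBot (-|R₀|)] with x hx
      rw [Real.norm_of_nonneg (Real.exp_pos _).le]
      have := hbd (x + b * I) (by simpa using hb'.1) (by simpa using hb'.2)
        (by simpa using by linarith [neg_le_abs x, le_abs_self R₀])
      simpa using this
    · refine Asymptotics.IsBigO.of_bound C ?_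
      filter_upwards [eventually_ge_atTop (|R₀|)] with x hx
      rw [Real.norm_of_nonneg (Real.exp_pos _).le]
      have := hbd (x + b * I) (by simpa using hb'.1) (by simpa using hb'.2)
        (by simpa using by linarith [le_abs_self x, le_abs_self R₀])
      simpa using this
  refine ⟨hint, ?_⟩
  have h1 := intervalIntegral_tendsto_integral (hint b₁ ⟨le_rfl, hb⟩) tendsto_neg_atTop_atBot
    tendsto_id
  have h2 := intervalIntegral_tendsto_integral (hint b₂ ⟨hb, le_rfl⟩) tendsto_neg_atTop_atBot
    tendsto_id
  -- Cauchy's theorem on the rectangle [-T, T] × [b₁, b₂]. The two vertical sides, σ = ±1, vanish as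
  -- T → ∞; only the decay at large |Re ζ| enters, so the bound may fail for |Re ζ| < R₀.
  have hvert : ∀ σ : ℝ, |σ| = 1 →
      Tendsto (fun T : ℝ => I • ∫ y in b₁..b₂, H (((σ * T : ℝ) : ℂ) + y * I)) atTop (𝓝 0) := by
    intro σ hσ
    have hlim : Tendsto (fun T : ℝ => C * Real.exp (-a * T) * |b₂ - b₁|) atTop (𝓝 0) := by
      have : Tendsto (fun T : ℝ => Real.exp (-a * T)) atTop (𝓝 0) :=
        Real.tendsto_exp_atBot.comp (tendsto_id.const_mul_atTop_of_neg (neg_lt_zero.2 ha))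
      simpa using (this.const_mul C).mul_const (|b₂ - b₁|)
    refine squeeze_zero_norm' ?_ hlim
    filter_upwards [eventually_ge_atTop (max R₀ 0)] with T hT
    rw [norm_smul, norm_I, one_mul]
    refine intervalIntegral.norm_integral_le_of_norm_le_const fun y hy => ?_
    rw [uIoc_of_le hb] at hy
    have hT0 : |σ * T| = T := by
      rw [abs_mul, hσ, one_mul, abs_of_nonneg (le_trans (le_max_right _ _) hT)]
    have := hbd (((σ * T : ℝ) : ℂ) + y * I) (by simpa using hy.1.le) (by simpa using hy.2)
      (by
        have : (((σ * T : ℝ) : ℂ) + y * I).re = σ * T := by simp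
        rw [this, hT0]; exact le_trans (le_max_left _ _) hT)
    have hre : (((σ * T : ℝ) : ℂ) + y * I).re = σ * T := by simp
    rwa [hre, hT0] at this
  have hz : ∀ T : ℝ, ((∫ x in (-T)..T, H (x + b₁ * I)) - ∫ x in (-T)..T, H (x + b₂ * I))
      = (I • ∫ y in b₁..b₂, H ((((-1) * T : ℝ) : ℂ) + y * I))
        - I • ∫ y in b₁..b₂, H (((1 * T : ℝ) : ℂ) + y * I) := by
    intro T
    have := integral_boundary_rect_eq_zero_of_differentiableOn H (⟨-T, b₁⟩ : ℂ) (⟨T, b₂⟩ : ℂ)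
      (hd.mono fun ζ hζ => by
        have := hζ.2
        simp only [mem_preimage, uIcc_of_le hb] at this
        exact this)
    simp only [neg_one_mul, one_mul] at *
    rw [sub_eq_zero] at this
    rw [← this]
    abel
  have h3 := (h1.sub h2)
  have h4 := (hvert (-1) (by simp)).sub (hvert 1 (by simp))
  rw [sub_zero] at h4
  have h5 := tendsto_nhds_unique (h4.congr fun T => (hz T).symm) h3
  exact (sub_eq_zero.1 h5.symm)

/-! ### Integrals along rays and along the boundary of a sector -/

section Ray

variable {G : Type*} [NormedAddCommGroup G] [NormedSpace ℂ G]

/-- The integral of `f` along the ray of angle `β`, oriented away from `0`. -/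
def rayInt (f : ℂ → G) (β : ℝ) : G :=
  ∫ r in Ioi (0 : ℝ), Complex.exp (β * Complex.I) • f (r * Complex.exp (β * Complex.I))

/-- Integrability along the ray of angle `β`. -/
def RayIntegrable (f : ℂ → G) (β : ℝ) : Prop :=
  IntegrableOn (fun r : ℝ => f (r * Complex.exp (β * Complex.I))) (Ioi 0)

/-- The substitution r = e^x turns rays into horizontal lines and sectors into strips, so the vertex
0 moves to -∞ and needs no separate treatment. -/
lemma rayInt_eq_line (f : ℂ → G) (β : ℝ) :
    rayInt f β = ∫ x : ℝ, Complex.exp (x + β * Complex.I) • f (Complex.exp (x + β * Complex.I)) := by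
  have h := integral_image_eq_integral_abs_deriv_smul (s := univ) (f := Real.exp)
    (f' := Real.exp) MeasurableSet.univ (fun x _ => (Real.hasDerivAt_exp x).hasDerivWithinAt)
    Real.exp_injective.injOn
    (fun r : ℝ => Complex.exp (β * Complex.I) • f (r * Complex.exp (β * Complex.I)))
  rw [image_univ, Real.range_exp] at h
  rw [rayInt, h, setIntegral_univ]
  congr 1
  funext x
  rw [abs_of_pos (Real.exp_pos x), Complex.exp_add, Complex.ofReal_exp, mul_smul,
    ← Complex.coe_smul, Complex.ofReal_exp]

lemma min_rpow_exp {a : ℝ} (ha : 0 < a) (x : ℝ) :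
    min (Real.exp x ^ a) (Real.exp x ^ (-a)) = Real.exp (-a * |x|) := by
  rw [← Real.exp_mul, ← Real.exp_mul]
  rcases le_total 0 x with h | h
  · rw [min_eq_right (Real.exp_le_exp.2 (by nlinarith)), abs_of_nonneg h]
    congr 1; ring
  · rw [min_eq_left (Real.exp_le_exp.2 (by nlinarith)), abs_of_nonpos h]
    congr 1; ring

lemma min_rpow_nonneg {a r : ℝ} (hr : 0 ≤ r) : 0 ≤ min (r ^ a) (r ^ (-a)) :=
  le_min (Real.rpow_nonneg hr _) (Real.rpow_nonneg hr _)

lemma integrableOn_min_rpow {a : ℝ} (ha : 0 < a) :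
    IntegrableOn (fun r : ℝ => r⁻¹ * min (r ^ a) (r ^ (-a))) (Ioi 0) := by
  rw [← Ioc_union_Ioi_eq_Ioi (zero_le_one' ℝ), integrableOn_union]
  constructor
  · have h : IntegrableOn (fun r : ℝ => r ^ (a - 1)) (Ioc 0 1) := by
      have := intervalIntegral.intervalIntegrable_rpow' (a := 0) (b := 1) (r := a - 1) (by linarith)
      rwa [intervalIntegrable_iff_integrableOn_Ioc_of_le zero_le_one] at this
    refine h.congr_fun ?_ measurableSet_Ioc
    intro r hr
    simp only
    rw [min_eq_left (Real.rpow_le_rpow_of_exponent_ge hr.1 hr.2 (by linarith)),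
      Real.rpow_sub hr.1, Real.rpow_one]
    field_simp
  · refine (integrableOn_Ioi_rpow_of_lt (a := -a - 1) (by linarith) one_pos).congr_fun ?_
      measurableSet_Ioi
    intro r hr
    have h0 : (0 : ℝ) < r := lt_trans one_pos hr
    simp only
    rw [min_eq_right (Real.rpow_le_rpow_of_exponent_le (le_of_lt hr) (by linarith)),
      Real.rpow_sub h0, Real.rpow_one]
    field_simp

lemma norm_ray_point {r : ℝ} (hr : 0 < r) (β : ℝ) : ‖(r : ℂ) * Complex.exp (β * Complex.I)‖ = r := by
  rw [norm_mul, Complex.norm_exp_ofReal_mul_I, mul_one, Complex.norm_of_nonneg hr.le]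

lemma arg_exp_line {x b : ℝ} (h1 : -Real.pi < b) (h2 : b ≤ Real.pi) :
    (Complex.exp (x + b * Complex.I)).arg = b := by
  rw [Complex.exp_add, ← Complex.ofReal_exp, Complex.arg_real_mul _ (Real.exp_pos x),
    Complex.arg_exp_mul_I, (toIocMod_eq_self Real.two_pi_pos).2]
  constructor <;> linarith [Real.pi_pos]

lemma arg_ray_point {r b : ℝ} (hr : 0 < r) (h1 : -Real.pi < b) (h2 : b ≤ Real.pi) :
    ((r : ℂ) * Complex.exp (b * Complex.I)).arg = b := by
  have := arg_exp_line (x := Real.log r) h1 h2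
  rwa [Complex.exp_add, ← Complex.ofReal_exp, Real.exp_log hr] at this

lemma ray_point_mem_sector {ω r b : ℝ} (hω : ω ≤ Real.pi) (hr : 0 < r) (hb : |b| < ω) :
    (r : ℂ) * Complex.exp (b * Complex.I) ∈ sector ω := by
  have := abs_lt.1 hb
  refine ⟨mul_ne_zero (by exact_mod_cast hr.ne') (Complex.exp_ne_zero _), ?_⟩
  rw [arg_ray_point hr (by linarith) (by linarith)]
  exact hb

lemma continuous_ray (β : ℝ) : Continuous fun r : ℝ => (r : ℂ) * Complex.exp (β * Complex.I) := by
  fun_prop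

omit [NormedSpace ℂ G] in
lemma rayIntegrable_of_bound {f : ℂ → G} {β C a : ℝ} (ha : 0 < a)
    (hc : ContinuousOn (fun r : ℝ => f (r * Complex.exp (β * Complex.I))) (Ioi 0))
    (hb : ∀ r : ℝ, 0 < r → r * ‖f (r * Complex.exp (β * Complex.I))‖
      ≤ C * min (r ^ a) (r ^ (-a))) : RayIntegrable f β := by
  refine ((integrableOn_min_rpow ha).const_mul C).mono'
    (hc.aestronglyMeasurable measurableSet_Ioi) ?_
  filter_upwards [ae_restrict_mem measurableSet_Ioi] with r hr
  have hr' : 0 < r := hr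
  have := hb r hr
  rw [← mul_assoc, mul_comm C, mul_assoc, inv_mul_eq_div, le_div_iff₀ hr', mul_comm]
  exact this

/-- Holomorphic on the sector `S_ω` and `O(|z|^{-1} min(|z|^a, |z|^{-a}))` there. -/
def SectorDecay (ω : ℝ) (f : ℂ → G) : Prop :=
  DifferentiableOn ℂ f (sector ω) ∧ ∃ C a : ℝ, 0 < a ∧
    ∀ z ∈ sector ω, ‖z‖ * ‖f z‖ ≤ C * min (‖z‖ ^ a) (‖z‖ ^ (-a))

lemma SectorDecay.rayIntegrable {ω : ℝ} {f : ℂ → G} (hf : SectorDecay ω f) (hω : ω ≤ Real.pi)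
    {β : ℝ} (hβ : |β| < ω) : RayIntegrable f β := by
  obtain ⟨hd, C, a, ha, hb⟩ := hf
  refine rayIntegrable_of_bound ha (hd.continuousOn.comp (continuous_ray β).continuousOn
    fun r hr => ray_point_mem_sector hω hr hβ) (C := C) fun r hr => ?_
  have := hb _ (ray_point_mem_sector hω hr hβ)
  rwa [norm_ray_point hr] at this

/-- In the variable ζ = log z this is `integral_strip_eq`: the factor e^ζ from dz absorbs |z|⁻¹, and
min(|z|^a, |z|^{-a}) becomes e^{-a|Re ζ|}. -/
lemma SectorDecay.rayInt_eq [CompleteSpace G] {ω : ℝ} {f : ℂ → G} (hf : SectorDecay ω f)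
    (hω : ω ≤ Real.pi) {β₁ β₂ : ℝ} (h₁ : |β₁| < ω) (h₂ : |β₂| < ω) :
    rayInt f β₁ = rayInt f β₂ := by
  wlog h : β₁ ≤ β₂ generalizing β₁ β₂
  · exact (this h₂ h₁ (le_of_not_ge h)).symm
  obtain ⟨hd, C, a, ha, hb⟩ := hf
  rw [rayInt_eq_line, rayInt_eq_line]
  rw [abs_lt] at h₁ h₂
  have hmem : ∀ ζ : ℂ, β₁ ≤ ζ.im → ζ.im ≤ β₂ → Complex.exp ζ ∈ sector ω := by
    intro ζ h3 h4
    refine ⟨Complex.exp_ne_zero _, ?_⟩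
    have := arg_exp_line (x := ζ.re) (b := ζ.im) (by linarith) (by linarith)
    rw [Complex.re_add_im] at this
    rw [this, abs_lt]
    constructor <;> linarith
  refine (integral_strip_eq (fun ζ => Complex.exp ζ • f (Complex.exp ζ)) (C := C) (R₀ := 0) h ha
    ?_ ?_).2
  · exact Complex.differentiable_exp.differentiableOn.smul
      (hd.comp Complex.differentiable_exp.differentiableOn fun ζ hζ => hmem ζ hζ.1 hζ.2)
  · intro ζ h3 h4 _
    have := hb _ (hmem ζ h3 h4)
    rw [Complex.norm_exp, min_rpow_exp ha] at this
    rwa [norm_smul, Complex.norm_exp]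

/-- The integral along the positively oriented boundary of the sector `S_ν`. -/
def contour (ν : ℝ) (f : ℂ → G) : G := rayInt f (-ν) - rayInt f ν

/-- The device by which error terms disappear: after a resolvent identity, every term that is
holomorphic in the whole sector, and so does not see the spectrum, integrates to zero. -/
lemma SectorDecay.contour_eq_zero [CompleteSpace G] {ω ν : ℝ} {f : ℂ → G} (hf : SectorDecay ω f)
    (hω : ω ≤ Real.pi) (hν : |ν| < ω) : contour ν f = 0 :=
  sub_eq_zero.2 (hf.rayInt_eq hω (by rwa [abs_neg]) hν)

/-- Integrability along both rays of `∂S_ν`. -/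
def ContourIntegrable (ν : ℝ) (f : ℂ → G) : Prop := RayIntegrable f (-ν) ∧ RayIntegrable f ν

lemma SectorDecay.contourIntegrable {ω ν : ℝ} {f : ℂ → G} (hf : SectorDecay ω f)
    (hω : ω ≤ Real.pi) (hν : |ν| < ω) : ContourIntegrable ν f :=
  ⟨hf.rayIntegrable hω (by rwa [abs_neg]), hf.rayIntegrable hω hν⟩

lemma rayInt_add {f g : ℂ → G} {β : ℝ} (hf : RayIntegrable f β) (hg : RayIntegrable g β) :
    rayInt (fun z => f z + g z) β = rayInt f β + rayInt g β := by
  simp only [rayInt, smul_add]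
  exact integral_add (hf.smul _) (hg.smul _)

lemma ContourIntegrable.contour_add {f g : ℂ → G} {ν : ℝ} (hf : ContourIntegrable ν f)
    (hg : ContourIntegrable ν g) :
    contour ν (fun z => f z + g z) = contour ν f + contour ν g := by
  rw [contour, rayInt_add hf.1 hg.1, rayInt_add hf.2 hg.2, contour, contour]
  abel

omit [NormedSpace ℂ G] in
lemma ContourIntegrable.add {f g : ℂ → G} {ν : ℝ} (hf : ContourIntegrable ν f)
    (hg : ContourIntegrable ν g) : ContourIntegrable ν (fun z => f z + g z) :=
  ⟨Integrable.add hf.1 hg.1, Integrable.add hf.2 hg.2⟩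

lemma ContourIntegrable.clm {G' : Type*} [NormedAddCommGroup G'] [NormedSpace ℂ G']
    {f : ℂ → G} {ν : ℝ} (hf : ContourIntegrable ν f) (B : G →L[ℂ] G') :
    ContourIntegrable ν (fun z => B (f z)) :=
  ⟨B.integrable_comp hf.1, B.integrable_comp hf.2⟩

lemma RayIntegrable.clm_rayInt {G' : Type*} [NormedAddCommGroup G'] [NormedSpace ℂ G']
    [CompleteSpace G] [CompleteSpace G']
    {f : ℂ → G} {β : ℝ} (hf : RayIntegrable f β) (B : G →L[ℂ] G') :
    B (rayInt f β) = rayInt (fun z => B (f z)) β := by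
  have := ContinuousLinearMap.integral_comp_comm B (hf.smul (Complex.exp (β * Complex.I)))
  simp only [Pi.smul_apply, map_smul] at this
  exact this.symm

lemma ContourIntegrable.clm_contour {G' : Type*} [NormedAddCommGroup G'] [NormedSpace ℂ G']
    [CompleteSpace G] [CompleteSpace G']
    {f : ℂ → G} {ν : ℝ} (hf : ContourIntegrable ν f) (B : G →L[ℂ] G') :
    B (contour ν f) = contour ν (fun z => B (f z)) := by
  rw [contour, map_sub, hf.1.clm_rayInt, hf.2.clm_rayInt, contour]

/-- Two functions agreeing on the rays of angles `±ν` have the same contour integral. -/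
lemma contour_congr {f g : ℂ → G} {ν : ℝ}
    (h : ∀ r : ℝ, 0 < r → ∀ β : ℝ, |β| = |ν| → f (r * Complex.exp (β * Complex.I))
      = g (r * Complex.exp (β * Complex.I))) : contour ν f = contour ν g := by
  have : ∀ β : ℝ, |β| = |ν| → rayInt f β = rayInt g β := fun β hβ =>
    setIntegral_congr_fun measurableSet_Ioi fun r hr => by
      simp only [h r hr β hβ]
  rw [contour, this _ (abs_neg ν), this _ rfl, contour]

end Ray

end

section

/-! ### Resolvents and semigroups -/

section Resolvent

variable {E : Type*} [NormedAddCommGroup E] [NormedSpace ℂ E] {A : E →ₗ.[ℂ] E}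

lemma IsResolventAt.apply_eq {z w : ℂ} {R S : E →L[ℂ] E} (hR : IsResolventAt A z R)
    (hS : IsResolventAt A w S) (x : E) : R x - S x = (w - z) • R (S x) := by
  obtain ⟨h, hx⟩ := hS.1 x
  have h1 := hR.2 ⟨S x, h⟩
  simp only at h1
  have h2 : z • S x - A ⟨S x, h⟩ = x - (w - z) • S x := by
    nth_rewrite 3 [← hx]
    rw [sub_smul]; abel
  rw [h2, map_sub, map_smul] at h1
  rw [sub_eq_iff_eq_add.1 h1, add_sub_cancel_left]

/-- The resolvent identity. -/
lemma IsResolventAt.sub_eq {z w : ℂ} {R S : E →L[ℂ] E} (hR : IsResolventAt A z R)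
    (hS : IsResolventAt A w S) : R - S = (w - z) • (R * S) := by
  ext x; simpa using hR.apply_eq hS x

lemma IsResolventAt.unique {z : ℂ} {R S : E →L[ℂ] E} (hR : IsResolventAt A z R)
    (hS : IsResolventAt A z S) : R = S := by
  have := hR.sub_eq hS
  rwa [sub_self, zero_smul, sub_eq_zero] at this

lemma IsResolventAt.commute {z w : ℂ} {R S : E →L[ℂ] E} (hR : IsResolventAt A z R)
    (hS : IsResolventAt A w S) : R * S = S * R := by
  rcases eq_or_ne z w with rfl | h
  · rw [hR.unique hS]
  · have h1 := hR.sub_eq hS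
    have h2 := hS.sub_eq hR
    have h3 : (w - z) • (R * S) = (w - z) • (S * R) := by
      rw [← h1, ← neg_sub S R, h2, ← neg_smul, neg_sub]
    exact smul_right_injective _ (sub_ne_zero.2 h.symm) h3

lemma isResolventAt_resolvent {z : ℂ} (h : z ∈ resolventSet A) :
    IsResolventAt A z (resolvent A z) := by
  have h' : ∃ R : E →L[ℂ] E, IsResolventAt A z R := h
  rw [resolvent, dif_pos h']
  exact h'.choose_spec

lemma IsResolventAt.resolvent_eq {z : ℂ} {R : E →L[ℂ] E} (h : IsResolventAt A z R) :
    resolvent A z = R :=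
  (isResolventAt_resolvent ⟨R, h⟩).unique h

lemma IsResolventAt.smul {z : ℂ} {R : E →L[ℂ] E} (h : IsResolventAt A z R) {t : ℂ} (ht : t ≠ 0) :
    IsResolventAt (t • A) (t * z) (t⁻¹ • R) := by
  constructor
  · intro x
    obtain ⟨h1, h2⟩ := h.1 (t⁻¹ • x)
    have h3 : (t⁻¹ • R) x ∈ A.domain := by simpa using h1
    refine ⟨h3, ?_⟩
    have h4 : (t • A) ⟨(t⁻¹ • R) x, h3⟩ = t • A ⟨R (t⁻¹ • x), h1⟩ := by
      rw [LinearPMap.smul_apply]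
      congr 2
      simp
    rw [h4]
    have h5 : (t * z) • (t⁻¹ • R) x = t • z • R (t⁻¹ • x) := by
      simp [mul_smul]
    rw [h5, ← smul_sub, h2, smul_inv_smul₀ ht]
  · intro y
    have := h.2 y
    rw [LinearPMap.smul_apply]
    simp only [smul_apply]
    rw [mul_smul, ← smul_sub, map_smul, inv_smul_smul₀ ht]
    exact this

/-- Invertibility is an open condition: the Neumann series. -/
lemma IsResolventAt.neumann [CompleteSpace E] {z₀ z : ℂ} {R : E →L[ℂ] E} (h : IsResolventAt A z₀ R)
    (hz : ‖z - z₀‖ * ‖R‖ < 1) :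
    IsResolventAt A z (R * Ring.inverse (1 + (z - z₀) • R)) := by
  set U : E →L[ℂ] E := 1 + (z - z₀) • R with hU
  have hunit : IsUnit U := by
    have : U = 1 - (-((z - z₀) • R)) := by rw [hU]; abel
    rw [this]
    refine isUnit_one_sub_of_norm_lt_one ?_
    rw [norm_neg, norm_smul]; exact hz
  constructor
  · intro x
    obtain ⟨h1, h2⟩ := h.1 (Ring.inverse U x)
    refine ⟨h1, ?_⟩
    have h3 : U (Ring.inverse U x) = x := by
      have := Ring.mul_inverse_cancel U hunit
      exact congrArg (fun B : E →L[ℂ] E => B x) this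
    change z • R (Ring.inverse U x) - A ⟨R (Ring.inverse U x), h1⟩ = x
    have h4 : U (Ring.inverse U x) = Ring.inverse U x + (z - z₀) • R (Ring.inverse U x) := by
      simp [hU]
    have h5 : A ⟨R (Ring.inverse U x), h1⟩ = z₀ • R (Ring.inverse U x) - Ring.inverse U x :=
      eq_sub_of_add_eq (sub_eq_iff_eq_add'.1 h2).symm
    refine Eq.trans ?_ h3
    rw [h4, h5, sub_smul]; abel
  · intro y
    have h1 := h.2 y
    have h2 : z • (y : E) - A y = U (z₀ • (y : E) - A y) := by
      simp only [hU, add_apply, one_apply_eq_self,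
        smul_apply]
      rw [h1, sub_smul]; abel
    rw [h2]
    have h3 := congrArg (fun B : E →L[ℂ] E => B (z₀ • (y : E) - A y))
      (Ring.inverse_mul_cancel U hunit)
    simp only [mul_apply_eq_comp, one_apply_eq_self] at h3 ⊢
    rw [h3, h1]

lemma differentiableAt_resolvent [CompleteSpace E] {z : ℂ} (h : z ∈ resolventSet A) :
    DifferentiableAt ℂ (resolvent A) z := by
  have hR := isResolventAt_resolvent h
  set R := resolvent A z with hRdef
  have hd : DifferentiableAt ℂ (fun w : ℂ => R * Ring.inverse (1 + (w - z) • R)) z := by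
    refine (differentiableAt_const _).mul ?_
    have h1 : DifferentiableAt ℂ (Ring.inverse : (E →L[ℂ] E) → E →L[ℂ] E)
        (1 + (z - z) • R) := by
      simpa using differentiableAt_inverse (𝕜 := ℂ) (1 : (E →L[ℂ] E)ˣ).isUnit
    exact h1.comp z (f := fun w : ℂ => 1 + (w - z) • R) (by fun_prop)
  refine hd.congr_of_eventuallyEq ?_
  have : ∀ᶠ w in nhds z, ‖w - z‖ * ‖R‖ < 1 := by
    have hc : ContinuousAt (fun w : ℂ => ‖w - z‖ * ‖R‖) z := by fun_prop
    exact hc.eventually (gt_mem_nhds (by simp))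
  filter_upwards [this] with w hw
  exact (hR.neumann hw).resolvent_eq

/-- By the resolvent identity S = R + (z₀ - z) R S, and the last term is at most ‖S‖/2, which is
absorbed. -/
lemma IsResolventAt.norm_le_two [CompleteSpace E] {z₀ z : ℂ} {R S : E →L[ℂ] E}
    (h : IsResolventAt A z₀ R) (hS : IsResolventAt A z S) (hz : ‖z - z₀‖ * ‖R‖ ≤ 1 / 2) :
    ‖S‖ ≤ 2 * ‖R‖ := by
  have h1 := hS.sub_eq h
  rw [hS.commute h] at h1
  have h2 : ‖S‖ ≤ ‖R‖ + ‖z - z₀‖ * ‖R‖ * ‖S‖ := by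
    calc ‖S‖ = ‖R + (z₀ - z) • (R * S)‖ := by rw [← h1]; congr 1; abel
      _ ≤ ‖R‖ + ‖z₀ - z‖ * ‖R * S‖ := by rw [← norm_smul]; exact norm_add_le _ _
      _ ≤ ‖R‖ + ‖z - z₀‖ * (‖R‖ * ‖S‖) := by
          rw [norm_sub_rev]; gcongr; exact norm_mul_le _ _
      _ = _ := by ring
  nlinarith [norm_nonneg S]

/-- Resolvent estimate outside of a sector: `z ∈ ρ(A)` and `‖z R(z, A)‖ ≤ M` for `|arg z| > θ`. -/
structure SectorBound (A : E →ₗ.[ℂ] E) (θ M : ℝ) : Prop where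
  theta_nonneg : 0 ≤ θ
  isResolventAt : ∀ z : ℂ, θ < |z.arg| → IsResolventAt A z (resolvent A z)
  bound : ∀ z : ℂ, θ < |z.arg| → ‖z‖ * ‖resolvent A z‖ ≤ M

/-- The part of a bounded analytic semigroup on `(0, ∞)`, with its generator identified by the
Laplace transform at `1`. -/
structure SemigroupData (A : E →ₗ.[ℂ] E) (T : ℝ → E →L[ℂ] E) (M : ℝ) : Prop where
  differentiableAt : ∀ t, 0 < t → DifferentiableAt ℝ T t
  bound : ∀ t, 0 < t → ‖T t‖ ≤ M
  semigroup : ∀ s t, 0 < s → 0 < t → T (s + t) = T s * T t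
  nondegenerate : ∀ x : E, (∀ t, 0 < t → T t x = 0) → x = 0
  laplace : ∀ x, resolvent A (-1) x = -∫ t in Ioi (0 : ℝ), Real.exp (-t) • T t x

/-- The Neumann series at -|z| carries the bound from the negative axis to a thin sector around it.
The angle is poor, but it shows that the set of admissible angles is nonempty, without which its
infimum would carry no information. -/
lemma isSectorial_of_bound_neg [CompleteSpace E] {M : ℝ} (hM : 0 < M) (Q : ℝ → E →L[ℂ] E)
    (hQ : ∀ μ : ℝ, 0 < μ → IsResolventAt A (-μ : ℂ) (Q μ) ∧ μ * ‖Q μ‖ ≤ M) :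
    ∃ θ, IsSectorial A θ := by
  set ε : ℝ := min (1 / (2 * M)) 1 with hε
  have hε0 : 0 < ε := lt_min (by positivity) one_pos
  have hε1 : ε ≤ 1 := min_le_right _ _
  have hεM : ε * M ≤ 1 / 2 := by
    calc ε * M ≤ 1 / (2 * M) * M := by gcongr; exact min_le_left _ _
      _ = 1 / 2 := by field_simp
  -- Chosen so that |e^{iθ} + 1|² = 2 + 2 cos θ = ε²; hence |z + |z|| ≤ ε|z| whenever |arg z| > θ.
  set θ := Real.arccos (-1 + ε ^ 2 / 2) with hθ
  have hcos : Real.cos θ = -1 + ε ^ 2 / 2 := Real.cos_arccos (by nlinarith) (by nlinarith)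
  have hθ0 : 0 ≤ θ := Real.arccos_nonneg _
  have hθπ : θ < Real.pi := by
    refine lt_of_le_of_ne (Real.arccos_le_pi _) fun h => ?_
    rw [h, Real.cos_pi] at hcos
    nlinarith
  have key : ∀ z : ℂ, θ < |z.arg| → 0 < ‖z‖ ∧ ‖z - (-(‖z‖ : ℝ) : ℂ)‖ ≤ ε * ‖z‖ := by
    intro z hz
    have hz0 : z ≠ 0 := by
      rintro rfl
      simp at hz; linarith
    have hn : 0 < ‖z‖ := norm_pos_iff.2 hz0
    refine ⟨hn, ?_⟩
    have h1 : Real.cos z.arg ≤ -1 + ε ^ 2 / 2 := by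
      rw [← hcos, ← Real.cos_abs z.arg]
      exact Real.cos_le_cos_of_nonneg_of_le_pi hθ0 (Complex.abs_arg_le_pi z) hz.le
    have h2 : z.re = ‖z‖ * Real.cos z.arg := by
      rw [Complex.cos_arg hz0]; field_simp
    have h3 : ‖z‖ ^ 2 = z.re ^ 2 + z.im ^ 2 := by
      rw [← Complex.normSq_eq_norm_sq, Complex.normSq_apply]; ring
    have h4 : ‖z - (-(‖z‖ : ℝ) : ℂ)‖ ^ 2 = (z.re + ‖z‖) ^ 2 + z.im ^ 2 := by
      rw [← Complex.normSq_eq_norm_sq, Complex.normSq_apply]; simp; ring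
    refine abs_le_of_sq_le_sq' ?_ (by positivity) |>.2
    rw [h4]
    have h5 : z.re ≤ ‖z‖ * (-1 + ε ^ 2 / 2) := by rw [h2]; gcongr
    nlinarith
  have hlt : ∀ z : ℂ, θ < |z.arg| → ‖z - (-(‖z‖ : ℝ) : ℂ)‖ * ‖Q ‖z‖‖ ≤ 1 / 2 := by
    intro z hz
    obtain ⟨h1, h2⟩ := key z hz
    calc ‖z - (-(‖z‖ : ℝ) : ℂ)‖ * ‖Q ‖z‖‖ ≤ ε * ‖z‖ * ‖Q ‖z‖‖ := by gcongr
      _ = ε * (‖z‖ * ‖Q ‖z‖‖) := by ring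
      _ ≤ ε * M := by gcongr; exact (hQ _ h1).2
      _ ≤ _ := hεM
  have hres : ∀ z : ℂ, θ < |z.arg| → z ∈ resolventSet A := fun z hz =>
    ⟨_, (hQ _ (key z hz).1).1.neumann (lt_of_le_of_lt (hlt z hz) (by norm_num))⟩
  refine ⟨θ, hθ0, hθπ, hres, fun θ' hθ' _ => ⟨2 * M, fun z hz => ?_⟩⟩
  have hz' := hθ'.trans hz
  have h1 := (hQ _ (key z hz').1).1.norm_le_two (isResolventAt_resolvent (hres z hz')) (hlt z hz')
  rw [norm_smul]
  calc ‖z‖ * ‖resolvent A z‖ ≤ ‖z‖ * (2 * ‖Q ‖z‖‖) := by gcongr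
    _ = 2 * (‖z‖ * ‖Q ‖z‖‖) := by ring
    _ ≤ 2 * M := by gcongr; exact (hQ _ (key z hz').1).2

lemma mem_sector_of_pos {δ t : ℝ} (hδ : 0 < δ) (ht : 0 < t) : (t : ℂ) ∈ sector δ := by
  refine ⟨by exact_mod_cast ht.ne', ?_⟩
  rw [Complex.arg_ofReal_of_nonneg ht.le]; simpa using hδ

lemma isOpen_sector (δ : ℝ) (hδ : δ ≤ Real.pi) : IsOpen (sector δ) := by
  have : sector δ = Complex.slitPlane ∩ {z | |z.arg| < δ} := by
    ext z
    simp only [sector, mem_ofPred_eq, mem_inter_iff, Complex.mem_slitPlane_iff_arg]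
    constructor
    · rintro ⟨h1, h2⟩
      exact ⟨⟨fun h => by rw [h, abs_of_pos Real.pi_pos] at h2; linarith, h1⟩, h2⟩
    · rintro ⟨⟨_, h1⟩, h2⟩
      exact ⟨h1, h2⟩
  rw [this]
  have hc : ContinuousOn (fun z : ℂ => |z.arg|) Complex.slitPlane := fun z hz =>
    (Complex.continuousAt_arg hz).abs.continuousWithinAt
  exact hc.isOpen_inter_preimage Complex.isOpen_slitPlane isOpen_Iio

lemma exists_semigroupData [CompleteSpace E] (hA : NegGeneratesBoundedAnalyticSemigroup A) :
    (∃ T M, SemigroupData A T M) ∧ (∃ θ, IsSectorial A θ) := by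
  obtain ⟨T, δ, hT, hlap⟩ := hA
  obtain ⟨M, hM⟩ := hT.bounded
  have hM0 : 0 ≤ M := le_trans (norm_nonneg _) (hM _ (mem_sector_of_pos hT.pos one_pos))
  choose! Q hQ1 hQ2 hQ3 using hlap
  have hres : ∀ μ : ℝ, 0 < μ → IsResolventAt A (-μ : ℂ) (-Q μ) := by
    intro μ hμ
    constructor
    · intro x
      obtain ⟨h1, h2⟩ := hQ2 μ hμ x
      have h3 : (-Q μ) x ∈ A.domain := A.domain.neg_mem h1
      refine ⟨h3, ?_⟩
      have h4 : A ⟨(-Q μ) x, h3⟩ = -A ⟨Q μ x, h1⟩ := by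
        rw [← LinearPMap.map_neg]; rfl
      rw [h4, neg_apply, sub_neg_eq_add, smul_neg, neg_smul, neg_neg, h2]
    · intro y
      have := hQ3 μ hμ y
      rw [neg_apply, ← map_neg, neg_smul]
      rw [show -(-((μ : ℂ) • (y : E)) - A y) = (μ : ℂ) • (y : E) + A y by abel]
      exact this
  constructor
  · refine ⟨fun t => T t, M, ?_, ?_, ?_, ?_, ?_⟩
    · intro t ht
      have h1 : DifferentiableAt ℂ T t :=
        hT.holomorphic.differentiableAt ((isOpen_sector δ
          (hT.le_half_pi.trans (by linarith [Real.pi_pos]))).mem_nhds (mem_sector_of_pos hT.pos ht))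
      exact (h1.restrictScalars ℝ).comp t Complex.ofRealCLM.differentiableAt
    · exact fun t ht => hM _ (mem_sector_of_pos hT.pos ht)
    · intro s t hs ht
      have := hT.map_add _ (mem_sector_of_pos hT.pos hs) _ (mem_sector_of_pos hT.pos ht)
      rw [← Complex.ofReal_add] at this
      exact this
    · exact hT.nondegenerate
    · intro x
      have h1 := (hres 1 one_pos).resolvent_eq
      rw [Complex.ofReal_one] at h1
      rw [h1, neg_apply, hQ1 1 one_pos]
      simp
  -- Integrating ‖T(t)‖ ≤ M against e^{-μt} gives μ‖(μ + A)⁻¹‖ ≤ M. The added 1 makes the constant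
  -- positive also on the zero space.
  · refine isSectorial_of_bound_neg (M := M + 1) (by linarith) (fun μ => -Q μ) fun μ hμ =>
      ⟨hres μ hμ, ?_⟩
    have hi : IntegrableOn (fun t : ℝ => Real.exp (-(μ * t))) (Ioi 0) := by
      simpa using integrableOn_exp_mul_Ioi (neg_lt_zero.2 hμ) 0
    have hv : ∫ t in Ioi (0 : ℝ), Real.exp (-(μ * t)) = μ⁻¹ := by
      have := integral_exp_mul_Ioi (neg_lt_zero.2 hμ) 0
      simp only [neg_mul] at this
      rw [this]; simp
    have : ‖-Q μ‖ ≤ M * μ⁻¹ := by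
      rw [norm_neg]
      refine ContinuousLinearMap.opNorm_le_bound _ (by positivity) fun x => ?_
      rw [hQ1 μ hμ]
      calc ‖∫ t in Ioi (0 : ℝ), Real.exp (-(μ * t)) • T (t : ℂ) x‖
          ≤ ∫ t in Ioi (0 : ℝ), Real.exp (-(μ * t)) * (M * ‖x‖) := by
            refine norm_integral_le_of_norm_le (hi.mul_const _) ?_
            filter_upwards [ae_restrict_mem measurableSet_Ioi] with t ht
            rw [norm_smul, Real.norm_of_nonneg (Real.exp_pos _).le]
            gcongr
            exact (T t).le_of_opNorm_le (hM _ (mem_sector_of_pos hT.pos ht)) x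
        _ = M * μ⁻¹ * ‖x‖ := by rw [integral_mul_const, hv]; ring
    calc μ * ‖-Q μ‖ ≤ μ * (M * μ⁻¹) := by gcongr
      _ = M := by field_simp
      _ ≤ M + 1 := by linarith

/-- Sectoriality of angle θ bounds z R(z, A) only outside strictly larger sectors, so the midpoint
of θ and ν becomes the new angle. -/
lemma exists_sectorBound {ν : ℝ} (h : ∃ θ, IsSectorial A θ) (hν : sectorialityAngle A < ν)
    (hν' : ν < Real.pi) : ∃ θ M, θ < ν ∧ SectorBound A θ M := by
  obtain ⟨θ, hθ, hθν⟩ := exists_lt_of_csInf_lt (s := {θ | IsSectorial A θ}) h hν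
  obtain ⟨h0, hπ, hres, hb⟩ := hθ
  obtain ⟨M, hM⟩ := hb ((θ + ν) / 2) (by linarith) (by linarith)
  refine ⟨(θ + ν) / 2, M, by linarith, by linarith,
    fun z hz => isResolventAt_resolvent (hres z (by linarith)), fun z hz => ?_⟩
  rw [← norm_smul]; exact hM z hz

end Resolvent

end

section

/-! ### Functions in `H₀^∞` -/

lemma min_rpow_anti {a c r : ℝ} (hr : 0 < r) (hc : 0 ≤ c) (hca : c ≤ a) :
    min (r ^ a) (r ^ (-a)) ≤ min (r ^ c) (r ^ (-c)) := by
  rcases le_total r 1 with h | h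
  · refine le_trans (min_le_left _ _) (le_min (Real.rpow_le_rpow_of_exponent_ge hr h hca) ?_)
    exact Real.rpow_le_rpow_of_exponent_ge hr h (by linarith)
  · refine le_trans (min_le_right _ _) (le_min ?_ ?_)
    · exact Real.rpow_le_rpow_of_exponent_le h (by linarith)
    · exact Real.rpow_le_rpow_of_exponent_le h (by linarith)

lemma min_rpow_le_one {a r : ℝ} (hr : 0 < r) (ha : 0 ≤ a) : min (r ^ a) (r ^ (-a)) ≤ 1 := by
  simpa using min_rpow_anti hr le_rfl ha

lemma MemHInftyZero.bounded {ω : ℝ} {φ : ℂ → ℂ} (h : MemHInftyZero ω φ) :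
    ∃ C, 0 < C ∧ ∀ z ∈ sector ω, ‖φ z‖ ≤ C := by
  obtain ⟨_, C, a, hC, ha, hb⟩ := h
  refine ⟨C, hC, fun z hz => (hb z hz).trans ?_⟩
  exact mul_le_of_le_one_right hC.le (min_rpow_le_one (norm_pos_iff.2 hz.1) ha.le)

lemma MemHInftyZero.mul_bounded {ω : ℝ} {φ h : ℂ → ℂ} (hφ : MemHInftyZero ω φ)
    (hd : DifferentiableOn ℂ h (sector ω)) {K : ℝ} (hK : ∀ z ∈ sector ω, ‖h z‖ ≤ K) :
    MemHInftyZero ω (fun z => φ z * h z) := by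
  obtain ⟨hφd, C, a, hC, ha, hb⟩ := hφ
  refine ⟨hφd.mul hd, C * (|K| + 1), a, by positivity, ha, fun z hz => ?_⟩
  rw [norm_mul]
  have h1 := hb z hz
  have h2 : ‖h z‖ ≤ |K| + 1 := (hK z hz).trans (by linarith [le_abs_self K])
  have h3 : 0 ≤ min (‖z‖ ^ a) (‖z‖ ^ (-a)) := min_rpow_nonneg (norm_nonneg _)
  calc ‖φ z‖ * ‖h z‖ ≤ (C * min (‖z‖ ^ a) (‖z‖ ^ (-a))) * (|K| + 1) := by gcongr
    _ = _ := by ring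

lemma MemHInftyZero.mul {ω : ℝ} {φ h : ℂ → ℂ} (hφ : MemHInftyZero ω φ)
    (hh : MemHInftyZero ω h) : MemHInftyZero ω (fun z => φ z * h z) := by
  obtain ⟨K, _, hK⟩ := hh.bounded
  exact hφ.mul_bounded hh.1 hK

lemma MemHInftyZero.add {ω : ℝ} {φ h : ℂ → ℂ} (hφ : MemHInftyZero ω φ)
    (hh : MemHInftyZero ω h) : MemHInftyZero ω (fun z => φ z + h z) := by
  obtain ⟨hφd, C, a, hC, ha, hb⟩ := hφ
  obtain ⟨hhd, C', a', hC', ha', hb'⟩ := hh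
  refine ⟨hφd.add hhd, C + C', min a a', by positivity, lt_min ha ha', fun z hz => ?_⟩
  have hz0 := norm_pos_iff.2 hz.1
  have h1 := min_rpow_anti hz0 (lt_min ha ha').le (min_le_left a a')
  have h2 := min_rpow_anti hz0 (lt_min ha ha').le (min_le_right a a')
  calc ‖φ z + h z‖ ≤ ‖φ z‖ + ‖h z‖ := norm_add_le _ _
    _ ≤ C * min (‖z‖ ^ a) (‖z‖ ^ (-a)) + C' * min (‖z‖ ^ a') (‖z‖ ^ (-a')) :=
        add_le_add (hb z hz) (hb' z hz)
    _ ≤ _ := by rw [add_mul]; gcongr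

lemma smul_mem_sector {ω r : ℝ} (hr : 0 < r) {z : ℂ} (hz : z ∈ sector ω) :
    (r : ℂ) * z ∈ sector ω :=
  ⟨mul_ne_zero (by exact_mod_cast hr.ne') hz.1, by rw [Complex.arg_real_mul z hr]; exact hz.2⟩

lemma min_rpow_mul_le {a r x : ℝ} (hr : 0 < r) (hx : 0 < x) :
    min ((r * x) ^ a) ((r * x) ^ (-a)) ≤ max (r ^ a) (r ^ (-a)) * min (x ^ a) (x ^ (-a)) := by
  rw [Real.mul_rpow hr.le hx.le, Real.mul_rpow hr.le hx.le]
  have h1 := Real.rpow_pos_of_pos hx a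
  have h2 := Real.rpow_pos_of_pos hx (-a)
  rcases le_total (x ^ a) (x ^ (-a)) with h | h
  · rw [min_eq_left h]
    exact (min_le_left _ _).trans (by gcongr; exact le_max_left _ _)
  · rw [min_eq_right h]
    exact (min_le_right _ _).trans (by gcongr; exact le_max_right _ _)

lemma MemHInftyZero.scale {ω r : ℝ} {ψ : ℂ → ℂ} (hψ : MemHInftyZero ω ψ) (hr : 0 < r) :
    MemHInftyZero ω (fun z => ψ (r * z)) := by
  obtain ⟨hd, C, a, hC, ha, hb⟩ := hψ
  refine ⟨hd.comp (by fun_prop) fun z hz => smul_mem_sector hr hz, C * max (r ^ a) (r ^ (-a)), a,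
    ?_, ha, fun z hz => ?_⟩
  · exact mul_pos hC (lt_max_of_lt_left (Real.rpow_pos_of_pos hr a))
  · have h1 := hb _ (smul_mem_sector hr hz)
    rw [norm_mul, Complex.norm_of_nonneg hr.le] at h1
    refine h1.trans ?_
    rw [mul_assoc]
    gcongr
    exact min_rpow_mul_le hr (norm_pos_iff.2 hz.1)

lemma re_ge_of_mem_sector {ω : ℝ} (hω : ω ≤ Real.pi) {z : ℂ} (hz : z ∈ sector ω) :
    Real.cos ω * ‖z‖ ≤ z.re := by
  have h1 : z.re = ‖z‖ * Real.cos z.arg := by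
    have := norm_ne_zero_iff.2 hz.1
    rw [Complex.cos_arg hz.1]; field_simp
  rw [h1, mul_comm, ← Real.cos_abs z.arg]
  gcongr
  exact Real.cos_le_cos_of_nonneg_of_le_pi (abs_nonneg _) hω hz.2.le

lemma norm_exp_neg_mul_le {ω t : ℝ} (hω : ω ≤ Real.pi) (ht : 0 ≤ t) {z : ℂ} (hz : z ∈ sector ω) :
    ‖Complex.exp (-(t * z))‖ ≤ Real.exp (-(t * Real.cos ω * ‖z‖)) := by
  rw [Complex.norm_exp]
  refine Real.exp_le_exp.2 ?_
  have := re_ge_of_mem_sector hω hz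
  simp only [Complex.neg_re, Complex.mul_re, Complex.ofReal_re, Complex.ofReal_im, zero_mul,
    sub_zero]
  nlinarith

lemma norm_exp_neg_mul_le_one {ω t : ℝ} (hω : ω < Real.pi / 2) (ht : 0 ≤ t) {z : ℂ}
    (hz : z ∈ sector ω) : ‖Complex.exp (-(t * z))‖ ≤ 1 := by
  have h0 : 0 < ω := lt_of_le_of_lt (abs_nonneg _) hz.2
  refine (norm_exp_neg_mul_le (by linarith) ht hz).trans (Real.exp_le_one_iff.2 ?_)
  have := (Real.cos_pos_of_mem_Ioo ⟨by linarith, hω⟩).le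
  have : 0 ≤ t * Real.cos ω * ‖z‖ := by positivity
  linarith

lemma memHInftyZero_mul_exp {ω t : ℝ} (h0 : 0 < ω) (hω : ω < Real.pi / 2) (ht : 0 < t) :
    MemHInftyZero ω (fun z => z * Complex.exp (-(t * z))) := by
  have hk := Real.cos_pos_of_mem_Ioo ⟨by linarith, hω⟩
  set k := t * Real.cos ω with hk'
  have hkp : 0 < k := by positivity
  -- Near 0 the exponential is at most 1; at infinity e^{-k|z|} ≤ 2/(k|z|)² leaves 2/(k²|z|).
  refine ⟨by fun_prop, max 1 (2 / k ^ 2), 1, by positivity, one_pos, fun z hz => ?_⟩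
  have hz0 : 0 < ‖z‖ := norm_pos_iff.2 hz.1
  have h1 := norm_exp_neg_mul_le (by linarith) ht.le hz
  rw [norm_mul, Real.rpow_one, Real.rpow_neg_one, mul_min_of_nonneg _ _ (by positivity)]
  refine le_min ?_ ?_
  · have := norm_exp_neg_mul_le_one hω ht.le hz
    calc ‖z‖ * ‖Complex.exp (-(t * z))‖ ≤ ‖z‖ * 1 := by gcongr
      _ = 1 * ‖z‖ := by ring
      _ ≤ _ := by gcongr; exact le_max_left _ _
  · have h2 : (k * ‖z‖) ^ 2 / 2 ≤ Real.exp (k * ‖z‖) := by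
      have := Real.quadratic_le_exp_of_nonneg (x := k * ‖z‖) (by positivity)
      nlinarith [mul_pos hkp hz0]
    have h3 : Real.exp (-(k * ‖z‖)) ≤ 2 / k ^ 2 * (‖z‖⁻¹ * ‖z‖⁻¹) := by
      rw [Real.exp_neg]
      calc (Real.exp (k * ‖z‖))⁻¹ ≤ ((k * ‖z‖) ^ 2 / 2)⁻¹ := by
            gcongr
        _ = _ := by field_simp
    calc ‖z‖ * ‖Complex.exp (-(t * z))‖ ≤ ‖z‖ * (2 / k ^ 2 * (‖z‖⁻¹ * ‖z‖⁻¹)) := by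
          gcongr; exact h1.trans h3
      _ = 2 / k ^ 2 * ‖z‖⁻¹ := by field_simp
      _ ≤ _ := by gcongr; exact le_max_right _ _

/-- The function is the square of z e^{-(t/2)z}. -/
lemma memHInftyZero_sq_mul_exp {ω t : ℝ} (h0 : 0 < ω) (hω : ω < Real.pi / 2) (ht : 0 < t) :
    MemHInftyZero ω (fun z => z ^ 2 * Complex.exp (-(t * z))) := by
  have := (memHInftyZero_mul_exp h0 hω (half_pos ht)).mul (memHInftyZero_mul_exp h0 hω (half_pos ht))
  convert this using 2 with z
  rw [mul_mul_mul_comm, ← Complex.exp_add, sq]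
  congr 2
  push_cast; ring

lemma one_add_norm_bounds {ω : ℝ} (hω : ω < Real.pi / 2) {z : ℂ} (hz : z ∈ sector ω) :
    1 ≤ ‖1 + z‖ ∧ ‖z‖ ≤ ‖1 + z‖ := by
  have h0 : 0 < ω := lt_of_le_of_lt (abs_nonneg _) hz.2
  have h1 := re_ge_of_mem_sector (by linarith [Real.pi_pos]) hz
  have h2 := (Real.cos_pos_of_mem_Ioo ⟨by linarith, hω⟩).le
  have h3 : 0 ≤ z.re := le_trans (by positivity) h1
  constructor
  · calc (1 : ℝ) ≤ (1 + z).re := by simpa using h3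
      _ ≤ _ := Complex.re_le_norm _
  · rw [← sq_le_sq₀ (norm_nonneg _) (norm_nonneg _), ← Complex.normSq_eq_norm_sq,
      ← Complex.normSq_eq_norm_sq, Complex.normSq_apply, Complex.normSq_apply]
    simp only [Complex.add_re, Complex.one_re, Complex.add_im, Complex.one_im]
    nlinarith

lemma one_add_ne_zero_of_mem_sector {ω : ℝ} (hω : ω < Real.pi / 2) {z : ℂ} (hz : z ∈ sector ω) :
    1 + z ≠ 0 := fun h => by
  have := (one_add_norm_bounds hω hz).1
  rw [h, norm_zero] at this
  linarith

lemma differentiableOn_inv_one_add {ω : ℝ} (hω : ω < Real.pi / 2) :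
    DifferentiableOn ℂ (fun z : ℂ => (1 + z)⁻¹) (sector ω) :=
  (by fun_prop : DifferentiableOn ℂ (fun z : ℂ => 1 + z) (sector ω)).inv
    fun z hz => one_add_ne_zero_of_mem_sector hω hz

lemma MemHInftyZero.mul_inv_one_add {ω : ℝ} (hω : ω < Real.pi / 2) {φ : ℂ → ℂ}
    (hφ : MemHInftyZero ω φ) : MemHInftyZero ω (fun z => φ z * (1 + z)⁻¹) := by
  refine hφ.mul_bounded (differentiableOn_inv_one_add hω) (K := 1) fun z hz => ?_
  rw [norm_inv]
  exact inv_le_one_of_one_le₀ (one_add_norm_bounds hω hz).1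

lemma memHInftyZero_id_mul_inv_sq {ω : ℝ} (hω : ω < Real.pi / 2) :
    MemHInftyZero ω (fun z => z * (1 + z)⁻¹ * (1 + z)⁻¹) := by
  have hd := differentiableOn_inv_one_add hω
  refine ⟨(differentiableOn_id.mul hd).mul hd, 1, 1, one_pos, one_pos, fun z hz => ?_⟩
  obtain ⟨h1, h2⟩ := one_add_norm_bounds hω hz
  have hz0 : 0 < ‖z‖ := norm_pos_iff.2 hz.1
  have h3 : ‖1 + z‖⁻¹ ≤ 1 := inv_le_one_of_one_le₀ h1
  have h4 : ‖1 + z‖⁻¹ ≤ ‖z‖⁻¹ := by gcongr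
  rw [norm_mul, norm_mul, norm_inv, Real.rpow_one, Real.rpow_neg_one, one_mul]
  refine le_min ?_ ?_
  · calc ‖z‖ * ‖1 + z‖⁻¹ * ‖1 + z‖⁻¹ ≤ ‖z‖ * 1 * 1 := by gcongr
      _ = ‖z‖ := by ring
  · calc ‖z‖ * ‖1 + z‖⁻¹ * ‖1 + z‖⁻¹ ≤ ‖z‖ * ‖z‖⁻¹ * ‖z‖⁻¹ := by gcongr
      _ = ‖z‖⁻¹ := by field_simp

/-- Supplies the hypothesis of `SectorDecay.contour_eq_zero`: a factor in H₀^∞ times a holomorphic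
O(|z|⁻¹) remainder. -/
lemma MemHInftyZero.sectorDecay {G : Type*} [NormedAddCommGroup G] [NormedSpace ℂ G] {ω K : ℝ}
    {φ : ℂ → ℂ} (hφ : MemHInftyZero ω φ) {h : ℂ → G} (hd : DifferentiableOn ℂ h (sector ω))
    (hK : ∀ z ∈ sector ω, ‖z‖ * ‖h z‖ ≤ K) : SectorDecay ω (fun z => φ z • h z) := by
  obtain ⟨hφd, C, a, hC, ha, hb⟩ := hφ
  refine ⟨hφd.smul hd, C * K, a, ha, fun z hz => ?_⟩
  rw [norm_smul]
  have h3 : 0 ≤ min (‖z‖ ^ a) (‖z‖ ^ (-a)) := min_rpow_nonneg (norm_nonneg _)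
  have hK' := hK z hz
  calc ‖z‖ * (‖φ z‖ * ‖h z‖) = ‖φ z‖ * (‖z‖ * ‖h z‖) := by ring
    _ ≤ (C * min (‖z‖ ^ a) (‖z‖ ^ (-a))) * K := by
        gcongr
        exact hb z hz
    _ = _ := by ring

/-! ### Elementary properties of the calculus -/

section Calculus

variable {E : Type*} [NormedAddCommGroup E] [NormedSpace ℂ E]
  {A : E →ₗ.[ℂ] E} {θ M ν ω : ℝ}

/-- The resolvent estimate together with angles `θ < ν < ω < π/2`. -/
structure CalcSetup (A : E →ₗ.[ℂ] E) (θ M ν ω : ℝ) : Prop extends SectorBound A θ M where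
  theta_lt : θ < ν
  nu_lt : ν < ω
  lt_half_pi : ω < Real.pi / 2

namespace CalcSetup

lemma nu_pos (h : CalcSetup A θ M ν ω) : 0 < ν := h.theta_nonneg.trans_lt h.theta_lt

lemma omega_pos (h : CalcSetup A θ M ν ω) : 0 < ω := h.nu_pos.trans h.nu_lt

lemma omega_le_pi (h : CalcSetup A θ M ν ω) : ω ≤ Real.pi := by
  linarith [h.lt_half_pi, Real.pi_pos]

lemma abs_nu (h : CalcSetup A θ M ν ω) : |ν| = ν := abs_of_pos h.nu_pos

lemma abs_nu_lt (h : CalcSetup A θ M ν ω) : |ν| < ω := by rw [h.abs_nu]; exact h.nu_lt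

lemma lt_abs_arg (h : CalcSetup A θ M ν ω) {r β : ℝ} (hr : 0 < r) (hβ : |β| = ν) :
    θ < |((r : ℂ) * Complex.exp (β * Complex.I)).arg| := by
  have h1 := abs_lt.1 (hβ.trans_lt h.nu_lt)
  rw [arg_ray_point hr (by linarith [h.omega_le_pi]) (by linarith [h.omega_le_pi]), hβ]
  exact h.theta_lt

lemma ray_mem (h : CalcSetup A θ M ν ω) {r β : ℝ} (hr : 0 < r) (hβ : |β| = ν) :
    (r : ℂ) * Complex.exp (β * Complex.I) ∈ sector ω :=
  ray_point_mem_sector h.omega_le_pi hr (hβ.trans_lt h.nu_lt)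

lemma isResolventAt_ray (h : CalcSetup A θ M ν ω) {r β : ℝ} (hr : 0 < r) (hβ : |β| = ν) :
    IsResolventAt A ((r : ℂ) * Complex.exp (β * Complex.I))
      (resolvent A ((r : ℂ) * Complex.exp (β * Complex.I))) :=
  h.isResolventAt _ (h.lt_abs_arg hr hβ)

lemma norm_resolvent_ray (h : CalcSetup A θ M ν ω) {r β : ℝ} (hr : 0 < r) (hβ : |β| = ν) :
    r * ‖resolvent A ((r : ℂ) * Complex.exp (β * Complex.I))‖ ≤ M := by
  have := h.bound _ (h.lt_abs_arg hr hβ)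
  rwa [norm_ray_point hr] at this

lemma bound_nonneg (h : CalcSetup A θ M ν ω) : 0 ≤ M :=
  le_trans (mul_nonneg zero_le_one (norm_nonneg _)) (h.norm_resolvent_ray one_pos h.abs_nu)

lemma isResolventAt_neg_one (h : CalcSetup A θ M ν ω) :
    IsResolventAt A (-1) (resolvent A (-1)) :=
  h.isResolventAt _ (by
    rw [Complex.arg_neg_one, abs_of_pos Real.pi_pos]
    linarith [h.theta_lt, h.nu_lt, h.lt_half_pi, Real.pi_pos])

end CalcSetup

/-- `(1 + A)⁻¹`. -/
def oneAddInv (A : E →ₗ.[ℂ] E) : E →L[ℂ] E := -resolvent A (-1)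

lemma CalcSetup.oneAddInv_mem (h : CalcSetup A θ M ν ω) (x : E) :
    ∃ hx : oneAddInv A x ∈ A.domain, A ⟨oneAddInv A x, hx⟩ = x - oneAddInv A x := by
  obtain ⟨h1, h2⟩ := h.isResolventAt_neg_one.1 x
  have h3 : oneAddInv A x ∈ A.domain := A.domain.neg_mem h1
  refine ⟨h3, ?_⟩
  have h4 : A ⟨oneAddInv A x, h3⟩ = -A ⟨resolvent A (-1) x, h1⟩ := by
    rw [← LinearPMap.map_neg]; rfl
  rw [h4, oneAddInv, neg_apply]
  nth_rewrite 2 [← h2]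
  rw [neg_one_smul]; abel

lemma CalcSetup.oneAddInv_apply (h : CalcSetup A θ M ν ω) (y : A.domain) :
    oneAddInv A ((y : E) + A y) = y := by
  have := h.isResolventAt_neg_one.2 y
  rw [oneAddInv, neg_apply, ← map_neg]
  rwa [neg_one_smul, ← neg_add'] at this

/-- Since A(1 + A)⁻¹x = x - (1 + A)⁻¹x, the vector x is recovered from (1 + A)⁻¹x. Identities may
thus be checked after applying (1 + A)⁻¹, where everything lies in D(A); this stands in for density.
-/
lemma CalcSetup.oneAddInv_injective (h : CalcSetup A θ M ν ω) :
    Function.Injective (oneAddInv A) := by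
  intro x y hxy
  obtain ⟨hx, hx'⟩ := h.oneAddInv_mem x
  obtain ⟨hy, hy'⟩ := h.oneAddInv_mem y
  have : A ⟨oneAddInv A x, hx⟩ = A ⟨oneAddInv A y, hy⟩ := by congr 2
  rw [hx', hy', hxy] at this
  exact sub_left_injective this

/-- The graph of `A` in terms of `(1 + A)⁻¹`. -/
lemma CalcSetup.mem_graph_iff (h : CalcSetup A θ M ν ω) (x y : E) :
    (∃ hx : x ∈ A.domain, A ⟨x, hx⟩ = y) ↔ oneAddInv A (x + y) = x := by
  constructor
  · rintro ⟨hx, rfl⟩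
    exact h.oneAddInv_apply ⟨x, hx⟩
  · intro hxy
    obtain ⟨h1, h2⟩ := h.oneAddInv_mem (x + y)
    simp only [hxy] at h1 h2
    exact ⟨h1, by rw [h2]; abel⟩

lemma CalcSetup.oneAddInv_mul_ray (h : CalcSetup A θ M ν ω) {r β : ℝ} (hr : 0 < r) (hβ : |β| = ν) :
    oneAddInv A * resolvent A ((r : ℂ) * Complex.exp (β * Complex.I))
      = (1 + (r : ℂ) * Complex.exp (β * Complex.I))⁻¹ •
        (resolvent A ((r : ℂ) * Complex.exp (β * Complex.I)) + oneAddInv A) := by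
  set z := (r : ℂ) * Complex.exp (β * Complex.I)
  have h1 := h.isResolventAt_neg_one.sub_eq (h.isResolventAt_ray hr hβ)
  have hz := one_add_ne_zero_of_mem_sector h.lt_half_pi (h.ray_mem hr hβ)
  rw [eq_inv_smul_iff₀ hz, oneAddInv, ← sub_eq_add_neg, ← neg_sub, h1, neg_mul, smul_neg,
    sub_neg_eq_add, add_comm]

/-- The calculus as a contour integral. -/
lemma calculus_eq_contour (φ : ℂ → ℂ) :
    calculus A ν φ
      = (2 * Real.pi * Complex.I)⁻¹ • contour ν (fun z => φ z • resolvent A z) := by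
  have : ∀ β : ℝ, rayIntegral A φ β = rayInt (fun z => φ z • resolvent A z) β := by
    intro β
    rw [rayIntegral, rayInt]
    congr 1
    funext r
    rw [mul_comm, mul_smul]
  rw [calculus, this, this, contour]

variable [CompleteSpace E]

namespace CalcSetup

lemma continuousOn_resolvent_ray (h : CalcSetup A θ M ν ω) {β : ℝ} (hβ : |β| = ν) :
    ContinuousOn (fun r : ℝ => resolvent A ((r : ℂ) * Complex.exp (β * Complex.I))) (Ioi 0) := by
  intro r hr
  have h1 := (differentiableAt_resolvent ⟨_, h.isResolventAt_ray hr hβ⟩).continuousAt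
  exact (ContinuousAt.comp (f := fun r : ℝ => (r : ℂ) * Complex.exp (β * Complex.I)) h1
    (continuous_ray β).continuousAt).continuousWithinAt

omit [CompleteSpace E] in
lemma continuousOn_ray (h : CalcSetup A θ M ν ω) {φ : ℂ → ℂ}
    (hφ : DifferentiableOn ℂ φ (sector ω)) {β : ℝ} (hβ : |β| = ν) :
    ContinuousOn (fun r : ℝ => φ ((r : ℂ) * Complex.exp (β * Complex.I))) (Ioi 0) :=
  hφ.continuousOn.comp (continuous_ray β).continuousOn fun _ hr => h.ray_mem hr hβ

lemma contourIntegrable (h : CalcSetup A θ M ν ω) {φ : ℂ → ℂ} (hφ : MemHInftyZero ω φ) :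
    ContourIntegrable ν (fun z => φ z • resolvent A z) := by
  have : ∀ β : ℝ, |β| = ν → RayIntegrable (fun z => φ z • resolvent A z) β := by
    intro β hβ
    obtain ⟨hd, C, a, hC, ha, hb⟩ := hφ
    refine rayIntegrable_of_bound ha (C := C * M)
      ((h.continuousOn_ray hd hβ).smul (h.continuousOn_resolvent_ray hβ)) fun r hr => ?_
    have h1 := hb _ (h.ray_mem hr hβ)
    rw [norm_ray_point hr] at h1
    have h3 : 0 ≤ min (r ^ a) (r ^ (-a)) := min_rpow_nonneg hr.le
    rw [norm_smul]
    calc _ = ‖φ (r * Complex.exp (β * Complex.I))‖ *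
          (r * ‖resolvent A (r * Complex.exp (β * Complex.I))‖) := by ring
      _ ≤ (C * min (r ^ a) (r ^ (-a))) * M := by
          gcongr
          exact h.norm_resolvent_ray hr hβ
      _ = _ := by ring
  exact ⟨this _ (by rw [abs_neg, h.abs_nu]), this _ h.abs_nu⟩

lemma clm_calculus (h : CalcSetup A θ M ν ω) {G : Type*} [NormedAddCommGroup G] [NormedSpace ℂ G]
    [CompleteSpace G] (B : (E →L[ℂ] E) →L[ℂ] G) {φ : ℂ → ℂ} (hφ : MemHInftyZero ω φ) :
    B (calculus A ν φ)
      = (2 * Real.pi * Complex.I)⁻¹ • contour ν (fun z => φ z • B (resolvent A z)) := by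
  rw [calculus_eq_contour, map_smul, (h.contourIntegrable hφ).clm_contour]
  simp only [map_smul]

lemma calculus_apply (h : CalcSetup A θ M ν ω) {φ : ℂ → ℂ} (hφ : MemHInftyZero ω φ) (x : E) :
    calculus A ν φ x
      = (2 * Real.pi * Complex.I)⁻¹ • contour ν (fun z => φ z • resolvent A z x) :=
  h.clm_calculus (ContinuousLinearMap.apply ℂ E x) hφ

lemma mul_calculus (h : CalcSetup A θ M ν ω) (B : E →L[ℂ] E) {φ : ℂ → ℂ}
    (hφ : MemHInftyZero ω φ) :
    B * calculus A ν φ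
      = (2 * Real.pi * Complex.I)⁻¹ • contour ν (fun z => φ z • (B * resolvent A z)) :=
  h.clm_calculus (ContinuousLinearMap.mul ℂ (E →L[ℂ] E) B) hφ

lemma calculus_mul (h : CalcSetup A θ M ν ω) (B : E →L[ℂ] E) {φ : ℂ → ℂ}
    (hφ : MemHInftyZero ω φ) :
    calculus A ν φ * B
      = (2 * Real.pi * Complex.I)⁻¹ • contour ν (fun z => φ z • (resolvent A z * B)) :=
  h.clm_calculus ((ContinuousLinearMap.mul ℂ (E →L[ℂ] E)).flip B) hφ

lemma mul_calculus_comm (h : CalcSetup A θ M ν ω) {B : E →L[ℂ] E}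
    (hB : ∀ z S, IsResolventAt A z S → B * S = S * B) {φ : ℂ → ℂ} (hφ : MemHInftyZero ω φ) :
    B * calculus A ν φ = calculus A ν φ * B := by
  rw [h.mul_calculus B hφ, h.calculus_mul B hφ]
  congr 1
  refine contour_congr fun r hr β hβ => ?_
  rw [h.abs_nu] at hβ
  simp only [hB _ _ (h.isResolventAt_ray hr hβ)]

/-- `mul_calculus_comm` used twice: resolvents commute with each other, hence with φ₁(A), which
therefore commutes with φ₂(A). No product formula is needed. -/
lemma calculus_comm (h : CalcSetup A θ M ν ω) {φ₁ φ₂ : ℂ → ℂ}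
    (h₁ : MemHInftyZero ω φ₁) (h₂ : MemHInftyZero ω φ₂) :
    calculus A ν φ₁ * calculus A ν φ₂ = calculus A ν φ₂ * calculus A ν φ₁ := by
  refine h.mul_calculus_comm (fun z S hS => ?_) h₂
  exact (h.mul_calculus_comm (fun w S' hS' => hS.commute hS') h₁).symm

lemma calculus_add (h : CalcSetup A θ M ν ω) {φ₁ φ₂ : ℂ → ℂ}
    (h₁ : MemHInftyZero ω φ₁) (h₂ : MemHInftyZero ω φ₂) :
    calculus A ν (fun z => φ₁ z + φ₂ z) = calculus A ν φ₁ + calculus A ν φ₂ := by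
  simp only [calculus_eq_contour]
  rw [← smul_add, ← (h.contourIntegrable h₁).contour_add (h.contourIntegrable h₂)]
  simp only [add_smul]

omit [CompleteSpace E] in
lemma calculus_congr (h : CalcSetup A θ M ν ω) {φ₁ φ₂ : ℂ → ℂ}
    (he : ∀ z ∈ sector ω, φ₁ z = φ₂ z) : calculus A ν φ₁ = calculus A ν φ₂ := by
  rw [calculus_eq_contour, calculus_eq_contour]
  congr 1
  refine contour_congr fun r hr β hβ => ?_
  rw [h.abs_nu] at hβ
  simp only [he _ (h.ray_mem hr hβ)]

/-- `(1 + A)⁻¹ φ(A) = (φ / (1 + z))(A)`. -/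
lemma oneAddInv_mul_calculus (h : CalcSetup A θ M ν ω) {φ : ℂ → ℂ} (hφ : MemHInftyZero ω φ) :
    oneAddInv A * calculus A ν φ = calculus A ν (fun z => φ z * (1 + z)⁻¹) := by
  have hφ' := hφ.mul_inv_one_add h.lt_half_pi
  rw [h.mul_calculus _ hφ, calculus_eq_contour]
  congr 1
  -- The resolvent identity leaves a remainder free of R(z, A). Its only pole, -1, lies outside the
  -- sector, so its contour integral is zero.
  have hdec : SectorDecay ω (fun z => φ z • ((1 + z)⁻¹ • oneAddInv A)) := by
    refine hφ.sectorDecay (K := ‖oneAddInv A‖)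
      ((differentiableOn_inv_one_add h.lt_half_pi).smul_const _) fun z hz => ?_
    obtain ⟨h1, h2⟩ := one_add_norm_bounds h.lt_half_pi hz
    rw [norm_smul, norm_inv, ← mul_assoc]
    refine mul_le_of_le_one_left (norm_nonneg _) ?_
    rw [← div_eq_mul_inv, div_le_one (by linarith)]
    exact h2
  have h1 : contour ν (fun z => φ z • (oneAddInv A * resolvent A z))
      = contour ν (fun z => (φ z * (1 + z)⁻¹) • resolvent A z
        + φ z • ((1 + z)⁻¹ • oneAddInv A)) := by
    refine contour_congr fun r hr β hβ => ?_
    rw [h.abs_nu] at hβ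
    simp only [h.oneAddInv_mul_ray hr hβ, smul_add, smul_smul]
  rw [h1, (h.contourIntegrable hφ').contour_add (hdec.contourIntegrable h.omega_le_pi h.abs_nu_lt),
    hdec.contour_eq_zero h.omega_le_pi h.abs_nu_lt, add_zero]

/-- `A φ(A) = (z φ)(A)`. -/
lemma generator_calculus (h : CalcSetup A θ M ν ω) {φ : ℂ → ℂ} (hφ : MemHInftyZero ω φ)
    (hφ' : MemHInftyZero ω (fun z => z * φ z)) (x : E) :
    ∃ hx : calculus A ν φ x ∈ A.domain,
      A ⟨calculus A ν φ x, hx⟩ = calculus A ν (fun z => z * φ z) x := by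
  rw [h.mem_graph_iff]
  -- Applied to φ + zφ = (1 + z)φ, so the factor (1 + z)⁻¹ cancels and φ(A)x remains, as the graph
  -- criterion asks.
  have h1 := h.oneAddInv_mul_calculus (hφ.add hφ')
  rw [h.calculus_add hφ hφ'] at h1
  have h2 := congrArg (fun B : E →L[ℂ] E => B x) h1
  simp only [mul_apply_eq_comp, add_apply] at h2
  rw [h2]
  have := h.calculus_congr (φ₁ := fun z => (φ z + z * φ z) * (1 + z)⁻¹) (φ₂ := φ) fun z hz => by
    have := one_add_ne_zero_of_mem_sector h.lt_half_pi hz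
    field_simp
  rw [this]

lemma oneAddInv_comm (h : CalcSetup A θ M ν ω) {φ : ℂ → ℂ} (hφ : MemHInftyZero ω φ) :
    oneAddInv A * calculus A ν φ = calculus A ν φ * oneAddInv A :=
  h.mul_calculus_comm (fun z S hS => by
    rw [oneAddInv, neg_mul, mul_neg, hS.commute h.isResolventAt_neg_one]) hφ

omit [CompleteSpace E] in
/-- Dilation: `ψ(tA)` is the calculus of `A` applied to `ψ(t ·)`. -/
lemma calculus_smul (h : CalcSetup A θ M ν ω) (ψ : ℂ → ℂ) {t : ℝ} (ht : 0 < t) :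
    calculus ((t : ℂ) • A) ν ψ = calculus A ν (fun z => ψ (t * z)) := by
  have hray : ∀ β : ℝ, |β| = ν →
      rayIntegral ((t : ℂ) • A) ψ β = rayIntegral A (fun z => ψ (t * z)) β := by
    intro β hβ
    rw [rayIntegral, rayIntegral]
    have h1 := integral_comp_mul_left_Ioi (fun r : ℝ =>
      (ψ (r * Complex.exp (β * Complex.I)) * Complex.exp (β * Complex.I)) •
        resolvent ((t : ℂ) • A) (r * Complex.exp (β * Complex.I))) 0 ht
    rw [mul_zero] at h1
    rw [eq_inv_smul_iff₀ ht.ne'] at h1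
    rw [← h1, ← integral_smul]
    refine setIntegral_congr_fun measurableSet_Ioi fun r hr => ?_
    have h2 := ((h.isResolventAt_ray hr hβ).smul (t := (t : ℂ))
      (by exact_mod_cast ht.ne')).resolvent_eq
    rw [← mul_assoc] at h2
    rw [Complex.ofReal_mul, h2, ← Complex.coe_smul, smul_smul, smul_smul]
    congr 1
    have : (t : ℂ) ≠ 0 := by exact_mod_cast ht.ne'
    rw [mul_assoc (t : ℂ) r]
    field_simp
  rw [calculus, calculus, hray _ (by rw [abs_neg, h.abs_nu]), hray _ h.abs_nu]

end CalcSetup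

end Calculus

end

section

/-! ### Normalisation of the calculus -/

section Normalisation

open Complex Filter Topology

/-- Both bounds are imaginary parts: that of the number itself gives r sin β, and that after
rotation by -β gives sin β. -/
lemma norm_ray_sub_one_ge {r β : ℝ} (hr : 0 < r) (hβ : 0 < Real.sin β) :
    Real.sin β * max 1 r ≤ ‖(r : ℂ) * exp (β * I) - 1‖ := by
  rw [mul_max_of_nonneg _ _ hβ.le, mul_one]
  refine max_le ?_ ?_
  · have h1 : ‖(r : ℂ) * exp (β * I) - 1‖ = ‖(r : ℂ) - exp (((-β : ℝ) : ℂ) * I)‖ := by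
      have : (r : ℂ) * exp (β * I) - 1 = exp (β * I) * (r - exp (((-β : ℝ) : ℂ) * I)) := by
        rw [mul_sub, ← exp_add]; simp; ring
      rw [this, norm_mul, norm_exp_ofReal_mul_I, one_mul]
    rw [h1]
    refine le_trans (le_of_eq ?_) (abs_im_le_norm _)
    rw [sub_im, ofReal_im, exp_ofReal_mul_I_im, Real.sin_neg, zero_sub, neg_neg, abs_of_pos hβ]
  · refine le_trans (le_of_eq ?_) (abs_im_le_norm _)
    rw [sub_im, one_im, sub_zero, im_ofReal_mul, exp_ofReal_mul_I_im,
      abs_of_pos (by positivity), mul_comm]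

/-- Alone, (z - 1)⁻¹ is not absolutely integrable at infinity. Subtracting (1 + z)⁻¹, whose pole is
outside the sector, leaves 2(z² - 1)⁻¹ without changing the residue at 1. -/
lemma rayIntegrable_cauchy_kernel {ν : ℝ} (h0 : 0 < ν) (hν : ν < Real.pi / 2) :
    RayIntegrable (fun z => (z - 1)⁻¹ - (1 + z)⁻¹) ν := by
  have hs : 0 < Real.sin ν := Real.sin_pos_of_pos_of_lt_pi h0 (by linarith)
  have hne1 : ∀ r : ℝ, 0 < r → (r : ℂ) * exp (ν * I) - 1 ≠ 0 := fun r hr => by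
    rw [← norm_pos_iff]
    exact lt_of_lt_of_le (mul_pos hs (lt_max_of_lt_left one_pos)) (norm_ray_sub_one_ge hr hs)
  have hmem : ∀ r : ℝ, 0 < r → (r : ℂ) * exp (ν * I) ∈ sector ((ν + Real.pi / 2) / 2) :=
    fun r hr => ray_point_mem_sector (by linarith) hr (by rw [abs_of_pos h0]; linarith)
  have hne2 : ∀ r : ℝ, 0 < r → 1 + (r : ℂ) * exp (ν * I) ≠ 0 := fun r hr =>
    one_add_ne_zero_of_mem_sector (by linarith) (hmem r hr)
  refine rayIntegrable_of_bound (C := 2 / Real.sin ν) (a := 1) one_pos ?_ ?_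
  · refine ContinuousOn.sub (ContinuousOn.inv₀ (by fun_prop) hne1)
      (ContinuousOn.inv₀ (by fun_prop) hne2)
  · intro r hr
    set z := (r : ℂ) * exp (ν * I)
    have e : (z - 1)⁻¹ - (1 + z)⁻¹ = 2 * ((z - 1)⁻¹ * (1 + z)⁻¹) := by
      have h1 : z - 1 ≠ 0 := hne1 r hr
      have h2 : 1 + z ≠ 0 := hne2 r hr
      field_simp
      ring
    have h1 := norm_ray_sub_one_ge hr hs
    obtain ⟨h2, h3⟩ := one_add_norm_bounds (by linarith) (hmem r hr)
    rw [norm_ray_point hr] at h3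
    have h4 : max 1 r ≤ ‖1 + z‖ := max_le h2 h3
    have hm : 0 < max 1 r := lt_max_of_lt_left one_pos
    rw [e, norm_mul, norm_mul, norm_inv, norm_inv, Complex.norm_ofNat, Real.rpow_one,
      Real.rpow_neg_one]
    have h5 : r * (2 * (‖z - 1‖⁻¹ * ‖1 + z‖⁻¹))
        ≤ r * (2 * ((Real.sin ν * max 1 r)⁻¹ * (max 1 r)⁻¹)) := by
      gcongr
    refine h5.trans ?_
    have h6 : r * (2 * ((Real.sin ν * max 1 r)⁻¹ * (max 1 r)⁻¹))
      = 2 / Real.sin ν * (r * (max 1 r)⁻¹ * (max 1 r)⁻¹) := by field_simp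
    rw [h6]
    gcongr
    refine le_min ?_ ?_
    · calc r * (max 1 r)⁻¹ * (max 1 r)⁻¹ ≤ r * 1 * 1 := by
            gcongr <;> exact inv_le_one_of_one_le₀ (le_max_left _ _)
        _ = r := by ring
    · calc r * (max 1 r)⁻¹ * (max 1 r)⁻¹ ≤ r * r⁻¹ * r⁻¹ := by
            gcongr <;> exact le_max_right _ _
        _ = r⁻¹ := by field_simp

/-- A primitive is log((z - 1)/(z + 1)). Along the ray its argument stays in the upper half-plane
and runs from -1 to 1, so the logarithm goes from πi to 0. -/
lemma rayInt_cauchy_kernel {ν : ℝ} (h0 : 0 < ν) (hν : ν < Real.pi / 2) :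
    rayInt (fun z => (z - 1)⁻¹ - (1 + z)⁻¹) ν = -(Real.pi * I) := by
  have hs : 0 < Real.sin ν := Real.sin_pos_of_pos_of_lt_pi h0 (by linarith)
  have him : ∀ z : ℂ, ((z - 1) / (z + 1)).im = 2 * z.im / normSq (z + 1) := by
    intro z
    rw [div_im, ← sub_div]
    simp only [sub_im, one_im, add_im, sub_re, one_re, add_re]
    congr 1; ring
  have hzim : ∀ r : ℝ, ((r : ℂ) * exp (ν * I)).im = r * Real.sin ν := fun r => by
    rw [im_ofReal_mul, exp_ofReal_mul_I_im]
  have hz1 : ∀ r : ℝ, 0 < r → (r : ℂ) * exp (ν * I) + 1 ≠ 0 := fun r hr h => by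
    have := congrArg Complex.im h
    rw [add_im, hzim, one_im, zero_im] at this
    have : 0 < r * Real.sin ν := by positivity
    linarith
  have hz2 : ∀ r : ℝ, 0 < r → (r : ℂ) * exp (ν * I) - 1 ≠ 0 := fun r hr h => by
    have := congrArg Complex.im h
    rw [sub_im, hzim, one_im, zero_im] at this
    have : 0 < r * Real.sin ν := by positivity
    linarith
  let F : ℝ → ℂ := fun r => log (((r : ℂ) * exp (ν * I) - 1) / ((r : ℂ) * exp (ν * I) + 1))
  have hF0 : F 0 = Real.pi * I := by
    simp only [F, ofReal_zero, zero_mul, zero_sub, zero_add, div_one, log_neg_one]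
  -- At r = 0 the argument sits on the branch cut at -1. The logarithm is continuous there from the
  -- closed upper half-plane, which contains the whole path.
  have hcont : ContinuousWithinAt F (Ici 0) 0 := by
    have h1 : ContinuousWithinAt log {z : ℂ | 0 ≤ z.im}
        ((((0 : ℝ) : ℂ) * exp (ν * I) - 1) / (((0 : ℝ) : ℂ) * exp (ν * I) + 1)) := by
      simp only [ofReal_zero, zero_mul, zero_sub, zero_add, div_one]
      exact continuousWithinAt_log_of_re_neg_of_im_zero (by simp) (by simp)
    refine ContinuousWithinAt.comp (f := fun r : ℝ =>
      ((r : ℂ) * exp (ν * I) - 1) / ((r : ℂ) * exp (ν * I) + 1)) h1 ?_ ?_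
    · refine ContinuousAt.continuousWithinAt ?_
      exact ContinuousAt.div (by fun_prop) (by fun_prop) (by simp)
    · intro r hr
      change 0 ≤ (((r : ℂ) * exp (ν * I) - 1) / ((r : ℂ) * exp (ν * I) + 1)).im
      rw [him, hzim]
      have : (0 : ℝ) ≤ r := hr
      have := normSq_nonneg ((r : ℂ) * exp (ν * I) + 1)
      positivity
  have hderiv : ∀ r ∈ Ioi (0 : ℝ), HasDerivAt F
      (exp (ν * I) • (((r : ℂ) * exp (ν * I) - 1)⁻¹ - (1 + (r : ℂ) * exp (ν * I))⁻¹)) r := by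
    intro r hr
    have hr' : 0 < r := hr
    have hl : HasDerivAt (fun r : ℝ => (r : ℂ) * exp (ν * I)) (exp (ν * I)) r := by
      simpa using (ofRealCLM.hasDerivAt (x := r)).mul_const (exp (ν * I))
    have hq := (hl.sub_const 1).div (hl.add_const 1) (hz1 r hr)
    have hslit : (((r : ℂ) * exp (ν * I) - 1) / ((r : ℂ) * exp (ν * I) + 1)) ∈ slitPlane := by
      rw [mem_slitPlane_iff]
      right
      rw [him, hzim]
      have := normSq_pos.2 (hz1 r hr)
      positivity
    have hd : HasDerivAt F _ r := hq.clog_real hslit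
    refine hd.congr_deriv ?_
    change _ / _ / (((r : ℂ) * exp (ν * I) - 1) / ((r : ℂ) * exp (ν * I) + 1)) = _
    have h1 := hz1 r hr
    have h2 := hz2 r hr
    rw [add_comm 1, smul_eq_mul]
    generalize exp (ν * I) = e at *
    generalize ((r : ℂ) * e) = z at *
    field_simp
  have hlim : Tendsto F atTop (𝓝 0) := by
    have h1 : Tendsto (fun r : ℝ => ((r : ℂ) * exp (ν * I) - 1) / ((r : ℂ) * exp (ν * I) + 1))
        atTop (𝓝 1) := by
      have hi : Tendsto (fun r : ℝ => ((r⁻¹ : ℝ) : ℂ)) atTop (𝓝 0) := by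
        have := (continuous_ofReal.tendsto 0).comp tendsto_inv_atTop_zero
        rwa [ofReal_zero] at this
      have h2 : Tendsto (fun r : ℝ => (exp (ν * I) - ((r⁻¹ : ℝ) : ℂ)) /
          (exp (ν * I) + ((r⁻¹ : ℝ) : ℂ))) atTop (𝓝 1) := by
        have := (tendsto_const_nhds (x := exp (ν * I)).sub hi).div
          (tendsto_const_nhds (x := exp (ν * I)).add hi) (by simp)
        rwa [sub_zero, add_zero, div_self (exp_ne_zero _)] at this
      refine h2.congr' ?_
      filter_upwards [eventually_gt_atTop 0] with r hr
      have h3 : (r : ℂ) ≠ 0 := by exact_mod_cast hr.ne'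
      rw [← mul_div_mul_left (exp (ν * I) - ((r⁻¹ : ℝ) : ℂ)) _ h3]
      congr 1 <;> push_cast <;> field_simp
    have := (continuousAt_clog one_mem_slitPlane).tendsto.comp h1
    rwa [log_one] at this
  have := integral_Ioi_of_hasDerivAt_of_tendsto hcont hderiv
    ((rayIntegrable_cauchy_kernel h0 hν).smul (exp (ν * I))) hlim
  rw [hF0, zero_sub] at this
  exact this

lemma rayInt_neg_of_conj {f : ℂ → ℂ} (hf : ∀ z, f (starRingEnd ℂ z) = starRingEnd ℂ (f z)) (β : ℝ) :
    rayInt f (-β) = starRingEnd ℂ (rayInt f β) := by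
  rw [rayInt, rayInt, ← integral_conj]
  congr 1
  funext r
  have h1 : exp (((-β : ℝ) : ℂ) * I) = starRingEnd ℂ (exp (β * I)) := by
    rw [← exp_conj]; simp
  have h2 : (r : ℂ) * exp (((-β : ℝ) : ℂ) * I) = starRingEnd ℂ (r * exp (β * I)) := by
    rw [h1, map_mul, conj_ofReal]
  rw [h2, hf, h1]
  simp

lemma cauchy_kernel_conj (z : ℂ) : (starRingEnd ℂ z - 1)⁻¹ - (1 + starRingEnd ℂ z)⁻¹
    = starRingEnd ℂ ((z - 1)⁻¹ - (1 + z)⁻¹) := by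
  simp

lemma contour_cauchy_kernel {ν : ℝ} (h0 : 0 < ν) (hν : ν < Real.pi / 2) :
    contour ν (fun z => (z - 1)⁻¹ - (1 + z)⁻¹) = 2 * Real.pi * I := by
  rw [contour, rayInt_neg_of_conj cauchy_kernel_conj, rayInt_cauchy_kernel h0 hν]
  simp
  ring

lemma contourIntegrable_cauchy_kernel {ν : ℝ} (h0 : 0 < ν) (hν : ν < Real.pi / 2) :
    ContourIntegrable ν (fun z => (z - 1)⁻¹ - (1 + z)⁻¹) := by
  refine ⟨?_, rayIntegrable_cauchy_kernel h0 hν⟩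
  have h1 := rayIntegrable_cauchy_kernel h0 hν
  have h2 : IntegrableOn (fun r : ℝ => starRingEnd ℂ (((r : ℂ) * exp (ν * I) - 1)⁻¹
    - (1 + (r : ℂ) * exp (ν * I))⁻¹)) (Ioi 0) :=
    (conjCLE : ℂ ≃L[ℝ] ℂ).toContinuousLinearMap.integrable_comp h1
  refine IntegrableOn.congr_fun h2 (fun r _ => ?_) measurableSet_Ioi
  simp only
  rw [← cauchy_kernel_conj, map_mul, conj_ofReal, ← exp_conj]
  simp

variable {E : Type*} [NormedAddCommGroup E] [NormedSpace ℂ E] [CompleteSpace E]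
  {A : E →ₗ.[ℂ] E} {θ M ν ω : ℝ}

omit [CompleteSpace E] in
lemma CalcSetup.oneAddInv_mul_resolvent (h : CalcSetup A θ M ν ω) {z : ℂ} (hz : θ < |z.arg|) :
    (1 + z) • (resolvent A z * oneAddInv A) = resolvent A z + oneAddInv A := by
  have h1 := (h.isResolventAt z hz).sub_eq h.isResolventAt_neg_one
  rw [oneAddInv, ← sub_eq_add_neg, h1, mul_neg, smul_neg, ← neg_smul]
  congr 1; ring

omit [CompleteSpace E] in
/-- Partial fraction expansion of `z (1 + z)⁻² R(z, A)`. -/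
lemma CalcSetup.partial_fraction (h : CalcSetup A θ M ν ω) {z : ℂ} (hz : θ < |z.arg|)
    (hz1 : 1 + z ≠ 0) :
    (z * (1 + z)⁻¹ * (1 + z)⁻¹) • resolvent A z
      = resolvent A z * (oneAddInv A - oneAddInv A * oneAddInv A)
        + (-((1 + z)⁻¹ • (oneAddInv A - oneAddInv A * oneAddInv A))
          + ((1 + z)⁻¹ * (1 + z)⁻¹) • oneAddInv A) := by
  have h1 := h.oneAddInv_mul_resolvent hz
  have h2 : resolvent A z * oneAddInv A = (1 + z)⁻¹ • (resolvent A z + oneAddInv A) := by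
    rw [← h1, inv_smul_smul₀ hz1]
  have h3 : resolvent A z * (oneAddInv A * oneAddInv A)
      = (1 + z)⁻¹ • ((1 + z)⁻¹ • (resolvent A z + oneAddInv A) + oneAddInv A * oneAddInv A) := by
    rw [← mul_assoc, h2, smul_mul_assoc, add_mul, h2]
  rw [mul_sub, h2, h3]
  have h4 : z = (1 + z) - 1 := by ring
  have h5 : z * (1 + z)⁻¹ * (1 + z)⁻¹ = (1 + z)⁻¹ - (1 + z)⁻¹ * (1 + z)⁻¹ := by
    field_simp
    ring
  rw [h5]
  module

/-- The contour is swept through the complement of the sector, where R(z, A) is holomorphic. At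
infinity R(z, A)P behaves like P/z, too large by one order; subtracting (z - 1)⁻¹P removes this and
adds only a pole at 1, inside the sector. -/
lemma CalcSetup.outer_closing (h : CalcSetup A θ M ν ω) :
    contour ν (fun z => resolvent A z * (oneAddInv A - oneAddInv A * oneAddInv A)
      - (z - 1)⁻¹ • (oneAddInv A - oneAddInv A * oneAddInv A)) = 0 := by
  set P := oneAddInv A - oneAddInv A * oneAddInv A with hP
  set f : ℂ → E →L[ℂ] E := fun z => resolvent A z * P - (z - 1)⁻¹ • P with hf
  have hν := h.nu_pos
  have hν2 : ν < Real.pi / 2 := h.nu_lt.trans h.lt_half_pi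
  -- The ray of angle -ν is also the ray of angle 2π - ν, the far edge of the strip ν ≤ Im ζ ≤ 2π -
  -- ν that corresponds to the outer region.
  have hper : ∀ x : ℝ, (x : ℂ) + ((2 * Real.pi - ν : ℝ) : ℂ) * I
      = (x + ((-ν : ℝ) : ℂ) * I) + 2 * Real.pi * I := by
    intro x; push_cast; ring
  have harg : ∀ ζ : ℂ, ν ≤ ζ.im → ζ.im ≤ 2 * Real.pi - ν → θ < |(exp ζ).arg| := by
    intro ζ h1 h2
    rcases le_or_gt ζ.im Real.pi with h3 | h3
    · have := arg_exp_line (x := ζ.re) (b := ζ.im) (by linarith) h3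
      rw [re_add_im] at this
      rw [this]
      exact lt_of_lt_of_le (h.theta_lt.trans_le h1) (le_abs_self _)
    · have := arg_exp_line (x := ζ.re) (b := ζ.im - 2 * Real.pi) (by linarith) (by linarith)
      have h4 : (ζ.re : ℂ) + ((ζ.im - 2 * Real.pi : ℝ) : ℂ) * I + 2 * Real.pi * I = ζ := by
        conv_rhs => rw [← re_add_im ζ]
        push_cast; ring
      rw [← exp_periodic, h4] at this
      rw [this]
      refine lt_of_lt_of_le ?_ (neg_le_abs _)
      linarith [h.theta_lt]
  have hne : ∀ z : ℂ, θ < |z.arg| → z - 1 ≠ 0 := by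
    intro z hz h1
    rw [sub_eq_zero.1 h1, arg_one, abs_zero] at hz
    linarith [h.theta_nonneg]
  rw [contour, rayInt_eq_line, rayInt_eq_line, sub_eq_zero]
  -- The decay of f is read off a partial fraction expansion that is singular at z = -1, a point of
  -- the outer region where f itself is regular. With R₀ = 1 the estimate is asked only for |z| ≥ e
  -- or |z| ≤ e⁻¹, away from it.
  have key := (integral_strip_eq (fun ζ => exp ζ • f (exp ζ)) (b₁ := ν) (b₂ := 2 * Real.pi - ν)
    (C := 4 * (M + 2 * ‖P‖ + ‖oneAddInv A‖)) (a := 1) (R₀ := 1) (by linarith) one_pos ?_ ?_).2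
  · rw [key]
    refine integral_congr_ae (Eventually.of_forall fun x => ?_)
    simp only
    rw [hper, exp_periodic]
  · refine differentiable_exp.differentiableOn.smul ?_
    refine DifferentiableOn.sub ?_ ?_
    · refine DifferentiableOn.mul_const ?_ _
      intro ζ hζ
      exact ((differentiableAt_resolvent ⟨_, h.isResolventAt _ (harg ζ hζ.1 hζ.2)⟩).comp ζ
        differentiable_exp.differentiableAt).differentiableWithinAt
    · refine DifferentiableOn.smul_const ?_ _
      refine DifferentiableOn.inv ?_ fun ζ hζ => hne _ (harg ζ hζ.1 hζ.2)
      exact (differentiable_exp.sub_const 1).differentiableOn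
  · intro ζ h1 h2 h3
    have hz := harg ζ h1 h2
    have hn : ‖exp ζ‖ = Real.exp ζ.re := norm_exp ζ
    have hmm := min_rpow_exp one_pos ζ.re
    set z := exp ζ with hzdef
    have hmin := h.bound z hz
    have hb : ∀ w : ℂ, ‖w‖ = 1 → max 1 ‖z‖ / 2 ≤ ‖z + w‖ := by
      intro w hw
      have he : 2 ≤ Real.exp 1 := by linarith [Real.exp_one_gt_d9]
      rcases le_total 0 ζ.re with h4 | h4
      · rw [abs_of_nonneg h4] at h3
        have h5 : 2 ≤ ‖z‖ := by rw [hn]; exact he.trans (Real.exp_le_exp.2 h3)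
        rw [max_eq_right (by linarith)]
        have := norm_sub_norm_le z (-w)
        rw [norm_neg, hw, sub_neg_eq_add] at this
        linarith
      · rw [abs_of_nonpos h4] at h3
        have h5 : ‖z‖ ≤ 1 / 2 := by
          rw [hn]
          calc Real.exp ζ.re ≤ Real.exp (-1) := Real.exp_le_exp.2 (by linarith)
            _ = (Real.exp 1)⁻¹ := Real.exp_neg 1
            _ ≤ 2⁻¹ := by gcongr
            _ = 1 / 2 := by norm_num
        rw [max_eq_left (by linarith)]
        have := norm_sub_norm_le (-w) z
        rw [norm_neg, hw, norm_sub_rev, sub_neg_eq_add] at this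
        linarith
    set m := max 1 ‖z‖ / 2 with hm
    have hm0 : 0 < m := by
      have : 0 < max 1 ‖z‖ := lt_max_of_lt_left one_pos
      positivity
    have hb1 : m ≤ ‖1 + z‖ := by rw [add_comm]; exact hb 1 (by simp)
    have hb2 : m ≤ ‖z - 1‖ := by rw [sub_eq_add_neg]; exact hb (-1) (by simp)
    have h1z : 1 + z ≠ 0 := norm_pos_iff.1 (hm0.trans_le hb1)
    have hz1 := hne z hz
    have hfz : f z = (z * (1 + z)⁻¹ * (1 + z)⁻¹) • resolvent A z
        + ((-2 * ((1 + z)⁻¹ * (z - 1)⁻¹)) • P - ((1 + z)⁻¹ * (1 + z)⁻¹) • oneAddInv A) := by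
      rw [h.partial_fraction hz h1z, hf, ← hP]
      have : -2 * ((1 + z)⁻¹ * (z - 1)⁻¹) = (1 + z)⁻¹ - (z - 1)⁻¹ := by field_simp; ring
      rw [this]
      module
    have hi1 : ‖(1 + z)⁻¹‖ ≤ m⁻¹ := by rw [norm_inv]; gcongr
    have hi2 : ‖(z - 1)⁻¹‖ ≤ m⁻¹ := by rw [norm_inv]; gcongr
    have hM := h.bound_nonneg
    have hfn : ‖f z‖ ≤ m⁻¹ * m⁻¹ * (M + 2 * ‖P‖ + ‖oneAddInv A‖) := by
      rw [hfz]
      calc _ ≤ ‖(z * (1 + z)⁻¹ * (1 + z)⁻¹) • resolvent A z‖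
            + (‖(-2 * ((1 + z)⁻¹ * (z - 1)⁻¹)) • P‖ + ‖((1 + z)⁻¹ * (1 + z)⁻¹) • oneAddInv A‖) :=
            (norm_add_le _ _).trans (by gcongr; exact norm_sub_le _ _)
        _ = ‖(1 + z)⁻¹‖ * ‖(1 + z)⁻¹‖ * (‖z‖ * ‖resolvent A z‖)
            + (2 * (‖(1 + z)⁻¹‖ * ‖(z - 1)⁻¹‖) * ‖P‖
              + ‖(1 + z)⁻¹‖ * ‖(1 + z)⁻¹‖ * ‖oneAddInv A‖) := by
            simp only [norm_smul, norm_mul, norm_neg, Complex.norm_ofNat]; ring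
        _ ≤ m⁻¹ * m⁻¹ * M + (2 * (m⁻¹ * m⁻¹) * ‖P‖ + m⁻¹ * m⁻¹ * ‖oneAddInv A‖) := by
            gcongr
        _ = _ := by ring
    rw [norm_smul]
    have hmin2 : ‖z‖ * (m⁻¹ * m⁻¹) ≤ 4 * Real.exp (-1 * |ζ.re|) := by
      rw [← hmm, ← hn, Real.rpow_one, Real.rpow_neg_one]
      have hzp : 0 < ‖z‖ := by rw [hn]; exact Real.exp_pos _
      rw [mul_min_of_nonneg _ _ (by norm_num)]
      have e1 : m⁻¹ ≤ 2 := by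
        rw [inv_le_comm₀ hm0 two_pos, hm]
        linarith [le_max_left 1 ‖z‖]
      have e2 : m⁻¹ ≤ 2 * ‖z‖⁻¹ := by
        rw [inv_le_comm₀ hm0 (by positivity), mul_inv, inv_inv, hm]
        linarith [le_max_right 1 ‖z‖]
      refine le_min ?_ ?_
      · calc ‖z‖ * (m⁻¹ * m⁻¹) ≤ ‖z‖ * (2 * 2) := by gcongr
          _ = _ := by ring
      · calc ‖z‖ * (m⁻¹ * m⁻¹) ≤ ‖z‖ * ((2 * ‖z‖⁻¹) * (2 * ‖z‖⁻¹)) := by gcongr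
          _ = _ := by field_simp; ring
    calc ‖z‖ * ‖f z‖ ≤ ‖z‖ * (m⁻¹ * m⁻¹ * (M + 2 * ‖P‖ + ‖oneAddInv A‖)) := by gcongr
      _ = (‖z‖ * (m⁻¹ * m⁻¹)) * (M + 2 * ‖P‖ + ‖oneAddInv A‖) := by ring
      _ ≤ (4 * Real.exp (-1 * |ζ.re|)) * (M + 2 * ‖P‖ + ‖oneAddInv A‖) := by gcongr
      _ = _ := by ring

/-- `(z (1 + z)⁻²)(A) = A (1 + A)⁻²`. -/
lemma CalcSetup.calculus_id_mul_inv_sq (h : CalcSetup A θ M ν ω) :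
    calculus A ν (fun z => z * (1 + z)⁻¹ * (1 + z)⁻¹)
      = oneAddInv A - oneAddInv A * oneAddInv A := by
  set P := oneAddInv A - oneAddInv A * oneAddInv A with hP
  have hν2 : ν < Real.pi / 2 := h.nu_lt.trans h.lt_half_pi
  have i0 := h.contourIntegrable (memHInftyZero_id_mul_inv_sq h.lt_half_pi)
  have i2 := (contourIntegrable_cauchy_kernel h.nu_pos hν2).clm
    ((ContinuousLinearMap.id ℂ ℂ).smulRight P)
  -- This is (1 + z)⁻² times (1 + A)⁻¹, factored so that one factor lies in H₀^∞ and the other is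
  -- O(|z|⁻¹).
  have d3 : SectorDecay ω (fun z : ℂ => (z * (1 + z)⁻¹ * (1 + z)⁻¹) • (z⁻¹ • oneAddInv A)) := by
    refine (memHInftyZero_id_mul_inv_sq h.lt_half_pi).sectorDecay (K := ‖oneAddInv A‖) ?_ ?_
    · exact (differentiableOn_id.inv fun z hz => hz.1).smul_const _
    · intro z hz
      have := norm_ne_zero_iff.2 hz.1
      rw [norm_smul, norm_inv]
      field_simp
      exact le_rfl
  have i3 := d3.contourIntegrable h.omega_le_pi h.abs_nu_lt
  have c3 := d3.contour_eq_zero h.omega_le_pi h.abs_nu_lt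
  have c2 : contour ν (fun z => ((ContinuousLinearMap.id ℂ ℂ).smulRight P)
      ((z - 1)⁻¹ - (1 + z)⁻¹)) = (2 * Real.pi * I) • P := by
    rw [← (contourIntegrable_cauchy_kernel h.nu_pos hν2).clm_contour,
      contour_cauchy_kernel h.nu_pos hν2]
    simp
  -- The function integrated to zero in `outer_closing` is the integrand of the calculus minus the
  -- Cauchy kernel times P minus a term with vanishing integral. Comparing integrals leaves 2πi P.
  have hsplit : ∀ r : ℝ, 0 < r → ∀ β : ℝ, |β| = |ν| → ∀ z, z = (r : ℂ) * exp (β * I) →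
      resolvent A z * P - (z - 1)⁻¹ • P
      = (z * (1 + z)⁻¹ * (1 + z)⁻¹) • resolvent A z
        + (-1 : ℂ) • (((ContinuousLinearMap.id ℂ ℂ).smulRight P) ((z - 1)⁻¹ - (1 + z)⁻¹)
        + (z * (1 + z)⁻¹ * (1 + z)⁻¹) • (z⁻¹ • oneAddInv A)) := by
    intro r hr β hβ z hz
    rw [h.abs_nu] at hβ
    have hmem : z ∈ sector ω := hz ▸ h.ray_mem hr hβ
    have h1 := one_add_ne_zero_of_mem_sector h.lt_half_pi hmem
    rw [h.partial_fraction (hz ▸ h.lt_abs_arg hr hβ) h1, ← hP]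
    simp only [ContinuousLinearMap.smulRight_apply, ContinuousLinearMap.id_apply]
    have : z * (1 + z)⁻¹ * (1 + z)⁻¹ * z⁻¹ = (1 + z)⁻¹ * (1 + z)⁻¹ := by
      have := hmem.1
      field_simp
    rw [smul_smul _ z⁻¹, this]
    module
  have hc : contour ν (fun z => resolvent A z * P - (z - 1)⁻¹ • P)
      = contour ν (fun z => (z * (1 + z)⁻¹ * (1 + z)⁻¹) • resolvent A z)
        + (-1 : ℂ) • ((2 * Real.pi * I) • P) := by
    have i4 := i2.add i3
    have i5 : ContourIntegrable ν (fun z => (-1 : ℂ) •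
        (((ContinuousLinearMap.id ℂ ℂ).smulRight P) ((z - 1)⁻¹ - (1 + z)⁻¹)
        + (z * (1 + z)⁻¹ * (1 + z)⁻¹) • (z⁻¹ • oneAddInv A))) :=
      i4.clm ((-1 : ℂ) • ContinuousLinearMap.id ℂ _)
    have c5 := i4.clm_contour ((-1 : ℂ) • ContinuousLinearMap.id ℂ _)
    simp only [smul_apply, ContinuousLinearMap.id_apply] at c5
    rw [i2.contour_add i3, c2, c3, add_zero] at c5
    rw [c5, ← i0.contour_add i5]
    exact contour_congr fun r hr β hβ => hsplit r hr β hβ _ rfl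
  rw [h.outer_closing, eq_comm, neg_one_smul, add_neg_eq_zero] at hc
  rw [calculus_eq_contour, hc, inv_smul_smul₀]
  exact two_pi_I_ne_zero

end Normalisation

end

section

/-! ### The semigroup and the calculus -/

open Filter Topology

lemma integral_Ioi_comp_add {G : Type*} [NormedAddCommGroup G] [NormedSpace ℝ G] (g : ℝ → G)
    (a σ : ℝ) : ∫ s in Ioi a, g (s + σ) = ∫ s in Ioi (a + σ), g s := by
  rw [← integral_indicator measurableSet_Ioi, ← integral_indicator measurableSet_Ioi,
    ← integral_add_right_eq_self ((Ioi (a + σ)).indicator g) σ]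
  congr 1
  funext s
  simp [indicator]

section Semigroup

variable {E : Type*} [NormedAddCommGroup E] [NormedSpace ℂ E]
  {A : E →ₗ.[ℂ] E} {θ M ν ω : ℝ} {T : ℝ → E →L[ℂ] E} {N : ℝ}

namespace SemigroupData

lemma bound_nonneg (hT : SemigroupData A T N) : 0 ≤ N :=
  (norm_nonneg _).trans (hT.bound 1 one_pos)

lemma norm_apply_le (hT : SemigroupData A T N) {t : ℝ} (ht : 0 < t) (x : E) :
    ‖T t x‖ ≤ N * ‖x‖ := (T t).le_of_opNorm_le (hT.bound t ht) x

lemma continuousOn (hT : SemigroupData A T N) : ContinuousOn T (Ioi 0) := fun t ht =>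
  (hT.differentiableAt t ht).continuousAt.continuousWithinAt

lemma continuousOn_apply (hT : SemigroupData A T N) (x : E) :
    ContinuousOn (fun t => T t x) (Ioi 0) :=
  hT.continuousOn.clm_apply continuousOn_const

lemma integrableOn_exp (hT : SemigroupData A T N) (x : E) :
    IntegrableOn (fun s => Real.exp (-s) • T s x) (Ioi 0) := by
  have hi : IntegrableOn (fun s : ℝ => Real.exp (-s) * (N * ‖x‖)) (Ioi 0) := by
    have := integrableOn_exp_mul_Ioi (a := -1) (by norm_num) 0
    simp only [neg_one_mul] at this
    exact this.mul_const _
  refine hi.mono' (ContinuousOn.aestronglyMeasurable ?_ measurableSet_Ioi) ?_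
  · exact (by fun_prop : Continuous fun s : ℝ => Real.exp (-s)).continuousOn.smul
      (hT.continuousOn_apply x)
  · filter_upwards [ae_restrict_mem measurableSet_Ioi] with s hs
    rw [norm_smul, Real.norm_of_nonneg (Real.exp_pos _).le]
    gcongr
    exact hT.norm_apply_le hs x

lemma oneAddInv_eq (hT : SemigroupData A T N) (x : E) :
    oneAddInv A x = ∫ s in Ioi (0 : ℝ), Real.exp (-s) • T s x := by
  rw [oneAddInv, neg_apply, hT.laplace, neg_neg]

variable [CompleteSpace E]

lemma apply_oneAddInv (hT : SemigroupData A T N) {σ : ℝ} (hσ : 0 < σ) (x : E) :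
    T σ (oneAddInv A x) = ∫ s in Ioi (0 : ℝ), Real.exp (-s) • T (s + σ) x := by
  have := ContinuousLinearMap.integral_comp_comm ((T σ).restrictScalars ℝ) (hT.integrableOn_exp x)
  rw [hT.oneAddInv_eq]
  refine this.symm.trans (setIntegral_congr_fun measurableSet_Ioi fun s hs => ?_)
  have h1 : T (s + σ) = T σ * T s := by rw [add_comm, hT.semigroup _ _ hσ hs]
  simp [h1]

lemma comm_oneAddInv (hT : SemigroupData A T N) {σ : ℝ} (hσ : 0 < σ) :
    T σ * oneAddInv A = oneAddInv A * T σ := by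
  ext x
  rw [mul_apply_eq_comp, mul_apply_eq_comp, hT.apply_oneAddInv hσ, hT.oneAddInv_eq]
  refine setIntegral_congr_fun measurableSet_Ioi fun s hs => ?_
  simp only [hT.semigroup _ _ hs hσ, mul_apply_eq_comp]

/-- Shifting the Laplace integral by σ replaces its lower limit 0 by σ. In this form the limit and
the derivative in σ follow from the fundamental theorem of calculus, with no strong continuity of T
at 0. -/
lemma apply_oneAddInv' (hT : SemigroupData A T N) {σ : ℝ} (hσ : 0 < σ) (x : E) :
    T σ (oneAddInv A x)
      = Real.exp σ • (oneAddInv A x - ∫ s in (0 : ℝ)..σ, Real.exp (-s) • T s x) := by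
  have hi := hT.integrableOn_exp x
  have h1 := intervalIntegral.integral_interval_add_Ioi hi (hi.mono_set (Ioi_subset_Ioi hσ.le))
  rw [← hT.oneAddInv_eq] at h1
  rw [← eq_sub_iff_add_eq'] at h1
  rw [← h1, hT.apply_oneAddInv hσ]
  have h2 := integral_Ioi_comp_add (fun s => Real.exp (-s) • T s x) 0 σ
  rw [zero_add] at h2
  rw [← h2, ← integral_smul]
  refine setIntegral_congr_fun measurableSet_Ioi fun s _ => ?_
  simp only [smul_smul, ← Real.exp_add]
  congr 2; ring

lemma tendsto_apply_oneAddInv (hT : SemigroupData A T N) (x : E) :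
    Tendsto (fun σ => T σ (oneAddInv A x)) (𝓝[>] 0) (𝓝 (oneAddInv A x)) := by
  have hi := hT.integrableOn_exp x
  have h1 : Tendsto (fun σ => ∫ s in (0 : ℝ)..σ, Real.exp (-s) • T s x) (𝓝[>] 0) (𝓝 0) := by
    have hint : IntervalIntegrable (fun s => Real.exp (-s) • T s x) volume 0 1 := by
      rw [intervalIntegrable_iff_integrableOn_Ioc_of_le zero_le_one]
      exact hi.mono_set Ioc_subset_Ioi_self
    have hc := intervalIntegral.continuousOn_primitive_interval
      ((intervalIntegrable_iff').1 hint) 0 (by simp)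
    have := hc.tendsto
    rw [intervalIntegral.integral_same, uIcc_of_le zero_le_one] at this
    refine this.mono_left ?_
    rw [nhdsWithin_le_iff]
    exact mem_of_superset (Ioo_mem_nhdsGT one_pos) Ioo_subset_Icc_self
  have h2 : Tendsto (fun σ : ℝ => Real.exp σ) (𝓝[>] 0) (𝓝 1) := by
    have := Real.continuous_exp.tendsto 0
    rw [Real.exp_zero] at this
    exact this.mono_left nhdsWithin_le_nhds
  have h3 := h2.smul ((tendsto_const_nhds (x := oneAddInv A x)).sub h1)
  rw [sub_zero, one_smul] at h3
  refine h3.congr' ?_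
  filter_upwards [self_mem_nhdsWithin] with σ hσ
  exact (hT.apply_oneAddInv' hσ x).symm

lemma hasDerivAt_apply_oneAddInv (hT : SemigroupData A T N) {σ : ℝ} (hσ : 0 < σ) (x : E) :
    HasDerivAt (fun σ => T σ (oneAddInv A x)) (T σ (oneAddInv A x) - T σ x) σ := by
  have hi := hT.integrableOn_exp x
  have hc : ContinuousOn (fun s => Real.exp (-s) • T s x) (Ioi 0) :=
    (by fun_prop : Continuous fun s : ℝ => Real.exp (-s)).continuousOn.smul
      (hT.continuousOn_apply x)
  have h1 : HasDerivAt (fun σ => ∫ s in (0 : ℝ)..σ, Real.exp (-s) • T s x)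
      (Real.exp (-σ) • T σ x) σ := by
    refine intervalIntegral.integral_hasDerivAt_right ?_ ?_ ?_
    · rw [intervalIntegrable_iff_integrableOn_Ioc_of_le hσ.le]
      exact hi.mono_set Ioc_subset_Ioi_self
    · exact hc.stronglyMeasurableAtFilter isOpen_Ioi σ hσ
    · exact hc.continuousAt (Ioi_mem_nhds hσ)
  have h2 := (Real.hasDerivAt_exp σ).fun_smul (h1.const_sub (oneAddInv A x))
  have h3 : (fun σ => T σ (oneAddInv A x)) =ᶠ[𝓝 σ] fun σ =>
      Real.exp σ • (oneAddInv A x - ∫ s in (0 : ℝ)..σ, Real.exp (-s) • T s x) := by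
    filter_upwards [Ioi_mem_nhds hσ] with τ hτ
    exact hT.apply_oneAddInv' hτ x
  refine (h2.congr_of_eventuallyEq h3).congr_deriv ?_
  rw [hT.apply_oneAddInv' hσ x, smul_neg, smul_smul, ← Real.exp_add, add_neg_cancel, Real.exp_zero,
    one_smul]
  abel

lemma tendsto_of_mem_domain (hT : SemigroupData A T N) (h : CalcSetup A θ M ν ω) (y : A.domain) :
    Tendsto (fun σ => T σ y) (𝓝[>] 0) (𝓝 (y : E)) := by
  have := hT.tendsto_apply_oneAddInv ((y : E) + A y)
  rwa [h.oneAddInv_apply] at this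

lemma hasDerivAt_of_mem_domain (hT : SemigroupData A T N) (h : CalcSetup A θ M ν ω) (y : A.domain)
    {σ : ℝ} (hσ : 0 < σ) : HasDerivAt (fun σ => T σ y) (-T σ (A y)) σ := by
  have := hT.hasDerivAt_apply_oneAddInv hσ ((y : E) + A y)
  rw [h.oneAddInv_apply] at this
  refine this.congr_deriv ?_
  rw [map_add]; abel

/-- The truncated convolution `∫₀^τ e^{-(τ-σ)z} T(σ) x dσ`. -/
def expConv (T : ℝ → E →L[ℂ] E) (τ : ℝ) (x : E) (z : ℂ) : E :=
  ∫ σ in (0 : ℝ)..τ, Complex.exp (-(((τ - σ : ℝ) : ℂ) * z)) • T σ x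

omit [CompleteSpace E] in
lemma continuousOn_expConv_integrand (hT : SemigroupData A T N) (τ : ℝ) (x : E) (z : ℂ) :
    ContinuousOn (fun σ : ℝ => Complex.exp (-(((τ - σ : ℝ) : ℂ) * z)) • T σ x) (Ioi 0) :=
  (by fun_prop : Continuous fun σ : ℝ => Complex.exp (-(((τ - σ : ℝ) : ℂ) * z))).continuousOn.smul
    (hT.continuousOn_apply x)

omit [CompleteSpace E] in
lemma norm_expConv_integrand (hT : SemigroupData A T N) {σ : ℝ} (hσ : 0 < σ) (τ : ℝ)
    (x : E) (z : ℂ) : ‖Complex.exp (-(((τ - σ : ℝ) : ℂ) * z)) • T σ x‖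
      ≤ Real.exp (-((τ - σ) * z.re)) * (N * ‖x‖) := by
  rw [norm_smul, Complex.norm_exp]
  have : (-(((τ - σ : ℝ) : ℂ) * z)).re = -((τ - σ) * z.re) := by
    rw [Complex.neg_re, Complex.re_ofReal_mul]
  rw [this]
  gcongr
  exact hT.norm_apply_le hσ x

omit [CompleteSpace E] in
lemma intervalIntegrable_expConv (hT : SemigroupData A T N) {τ : ℝ} (hτ : 0 < τ) (x : E) (z : ℂ) :
    IntervalIntegrable (fun σ : ℝ => Complex.exp (-(((τ - σ : ℝ) : ℂ) * z)) • T σ x) volume 0 τ := by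
  have hb : IntervalIntegrable (fun σ : ℝ => Real.exp (-((τ - σ) * z.re)) * (N * ‖x‖)) volume 0 τ :=
    Continuous.intervalIntegrable (by fun_prop) _ _
  refine hb.mono_fun' ?_ ?_
  · rw [uIoc_of_le hτ.le]
    exact ((hT.continuousOn_expConv_integrand τ x z).aestronglyMeasurable measurableSet_Ioi).mono_set
      Ioc_subset_Ioi_self
  · rw [uIoc_of_le hτ.le]
    filter_upwards [ae_restrict_mem measurableSet_Ioc] with σ hσ
    exact hT.norm_expConv_integrand hσ.1 τ x z

/-- The commutation formula of the semigroup with a resolvent. -/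
lemma apply_resolvent (hT : SemigroupData A T N) (h : CalcSetup A θ M ν ω) {τ : ℝ} (hτ : 0 < τ)
    {z : ℂ} {R : E →L[ℂ] E} (hR : IsResolventAt A z R) (x : E) :
    T τ (R x) = Complex.exp (-(τ * z)) • R x + expConv T τ x z := by
  obtain ⟨h1, h2⟩ := hR.1 x
  -- The function e^{-(τ-σ)z} T(σ)Rx has derivative e^{-(τ-σ)z} T(σ)(z - A)Rx = e^{-(τ-σ)z} T(σ)x.
  -- Its limit at σ = 0 exists because Rx lies in D(A).
  have key := intervalIntegral.integral_eq_sub_of_hasDerivAt_of_tendsto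
    (f := fun σ : ℝ => Complex.exp (-(((τ - σ : ℝ) : ℂ) * z)) • T σ (R x)) hτ
    (f' := fun σ : ℝ => Complex.exp (-(((τ - σ : ℝ) : ℂ) * z)) • T σ x)
    (fa := Complex.exp (-(τ * z)) • R x) (fb := T τ (R x)) ?_
    (hT.intervalIntegrable_expConv hτ x z) ?_ ?_
  · rw [expConv, key]; abel
  · intro σ hσ
    have d1 : HasDerivAt (fun σ : ℝ => -(((τ - σ : ℝ) : ℂ) * z)) z σ := by
      have := (((hasDerivAt_id σ).const_sub τ).ofReal_comp.mul_const z).fun_neg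
      simpa using this
    have d2 := d1.cexp.fun_smul (hT.hasDerivAt_of_mem_domain h ⟨R x, h1⟩ hσ.1)
    refine d2.congr_deriv ?_
    have e : T σ x = z • T σ (R x) - T σ (A ⟨R x, h1⟩) := by rw [← map_smul, ← map_sub, h2]
    rw [e, smul_sub, smul_neg, mul_smul]
    abel
  · have t1 := hT.tendsto_of_mem_domain h ⟨R x, h1⟩
    have t2 : Tendsto (fun σ : ℝ => Complex.exp (-(((τ - σ : ℝ) : ℂ) * z))) (𝓝[>] 0)
        (𝓝 (Complex.exp (-(τ * z)))) := by
      have : Continuous fun σ : ℝ => Complex.exp (-(((τ - σ : ℝ) : ℂ) * z)) := by fun_prop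
      have := this.tendsto 0
      rw [sub_zero] at this
      exact this.mono_left nhdsWithin_le_nhds
    exact t2.smul t1
  · have c := (hT.continuousOn_expConv_integrand τ (R x) z).continuousAt (Ioi_mem_nhds hτ)
    have := c.tendsto
    simp only [sub_self, Complex.ofReal_zero, zero_mul, neg_zero, Complex.exp_zero, one_smul] at this
    exact this.mono_left nhdsWithin_le_nhds

omit [CompleteSpace E] in
-- Integrating e^{-(τ-σ) Re z} gives at most 1/Re z, and Re z ≥ |z| cos ω in the sector.
lemma norm_expConv_le (hT : SemigroupData A T N) (hω : ω < Real.pi / 2) {τ : ℝ} (hτ : 0 < τ)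
    (x : E) {z : ℂ} (hz : z ∈ sector ω) :
    ‖z‖ * ‖expConv T τ x z‖ ≤ N * ‖x‖ / Real.cos ω := by
  have h0 : 0 < ω := lt_of_le_of_lt (abs_nonneg _) hz.2
  have hk := Real.cos_pos_of_mem_Ioo ⟨by linarith, hω⟩
  have hre := re_ge_of_mem_sector (by linarith) hz
  have hz0 := norm_pos_iff.2 hz.1
  have hx : 0 < z.re := lt_of_lt_of_le (by positivity) hre
  have hNx : 0 ≤ N * ‖x‖ := mul_nonneg hT.bound_nonneg (norm_nonneg _)
  have h1 : ‖expConv T τ x z‖ ≤ ∫ σ in (0 : ℝ)..τ, Real.exp (-((τ - σ) * z.re)) * (N * ‖x‖) := by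
    refine intervalIntegral.norm_integral_le_of_norm_le hτ.le ?_
      (Continuous.intervalIntegrable (by fun_prop) _ _)
    exact ae_of_all _ fun σ hσ => hT.norm_expConv_integrand hσ.1 τ x z
  have h2 : ∫ σ in (0 : ℝ)..τ, Real.exp (-((τ - σ) * z.re)) * (N * ‖x‖)
      = (1 - Real.exp (-(τ * z.re))) / z.re * (N * ‖x‖) := by
    rw [intervalIntegral.integral_mul_const]
    congr 1
    have := intervalIntegral.integral_eq_sub_of_hasDerivAt (a := 0) (b := τ)
      (f := fun σ => Real.exp (-((τ - σ) * z.re)) / z.re)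
      (f' := fun σ => Real.exp (-((τ - σ) * z.re))) (fun σ _ => ?_)
      (Continuous.intervalIntegrable (by fun_prop) _ _)
    · rw [this]; simp [sub_div]
    · have d : HasDerivAt (fun σ : ℝ => -((τ - σ) * z.re)) z.re σ := by
        simpa using (((hasDerivAt_id σ).const_sub τ).mul_const z.re).fun_neg
      refine (d.exp.div_const z.re).congr_deriv ?_
      field_simp
  rw [h2] at h1
  have h3 : (1 - Real.exp (-(τ * z.re))) / z.re ≤ 1 / (Real.cos ω * ‖z‖) := by
    gcongr
    linarith [Real.exp_pos (-(τ * z.re))]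
  calc ‖z‖ * ‖expConv T τ x z‖ ≤ ‖z‖ * (1 / (Real.cos ω * ‖z‖) * (N * ‖x‖)) := by
        gcongr
        exact h1.trans (by gcongr)
    _ = _ := by field_simp

omit [CompleteSpace E] in
lemma differentiable_expConv (hT : SemigroupData A T N) {τ : ℝ} (hτ : 0 < τ) (x : E) :
    Differentiable ℂ (expConv T τ x) := by
  intro z₀
  have key := intervalIntegral.hasDerivAt_integral_of_dominated_loc_of_deriv_le (μ := volume)
    (a := 0) (b := τ) (𝕜 := ℂ) (x₀ := z₀) (s := Metric.ball z₀ 1)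
    (F := fun z (σ : ℝ) => Complex.exp (-(((τ - σ : ℝ) : ℂ) * z)) • T σ x)
    (F' := fun z (σ : ℝ) => (-((τ - σ : ℝ) : ℂ)) • Complex.exp (-(((τ - σ : ℝ) : ℂ) * z)) • T σ x)
    (bound := fun _ => τ * (Real.exp (τ * (‖z₀‖ + 1)) * (N * ‖x‖)))
    (Metric.ball_mem_nhds z₀ one_pos) ?_ (hT.intervalIntegrable_expConv hτ x z₀) ?_ ?_
    (by simp) ?_
  · exact key.2.differentiableAt
  · refine Eventually.of_forall fun z => ?_
    rw [uIoc_of_le hτ.le]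
    exact ((hT.continuousOn_expConv_integrand τ x z).aestronglyMeasurable measurableSet_Ioi).mono_set
      Ioc_subset_Ioi_self
  · rw [uIoc_of_le hτ.le]
    have c : ContinuousOn (fun σ : ℝ => (-((τ - σ : ℝ) : ℂ)) •
        Complex.exp (-(((τ - σ : ℝ) : ℂ) * z₀)) • T σ x) (Ioi 0) :=
      (by fun_prop : Continuous fun σ : ℝ => (-((τ - σ : ℝ) : ℂ))).continuousOn.smul
        (hT.continuousOn_expConv_integrand τ x z₀)
    exact (c.aestronglyMeasurable measurableSet_Ioi).mono_set Ioc_subset_Ioi_self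
  · refine ae_of_all _ fun σ hσ z hz => ?_
    rw [uIoc_of_le hτ.le] at hσ
    rw [norm_smul, norm_neg, Complex.norm_real, Real.norm_of_nonneg (by linarith [hσ.2])]
    have hNx : 0 ≤ N * ‖x‖ := mul_nonneg hT.bound_nonneg (norm_nonneg _)
    have h1 := hT.norm_expConv_integrand hσ.1 τ x z
    have h2 : ‖z‖ ≤ ‖z₀‖ + 1 := by
      have := norm_le_norm_add_norm_sub' z z₀
      rw [Metric.mem_ball, dist_eq_norm] at hz
      linarith
    have h3 : -((τ - σ) * z.re) ≤ τ * (‖z₀‖ + 1) := by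
      have h4 := neg_le_of_abs_le (Complex.abs_re_le_norm z)
      have h5 : 0 ≤ τ - σ := by linarith [hσ.2]
      calc -((τ - σ) * z.re) = (τ - σ) * (-z.re) := by ring
        _ ≤ (τ - σ) * ‖z‖ := by gcongr; linarith
        _ ≤ τ * (‖z₀‖ + 1) := by
          gcongr
          linarith [hσ.1]
    refine mul_le_mul (by linarith [hσ.1]) (h1.trans ?_) (norm_nonneg _) hτ.le
    gcongr
  · refine ae_of_all _ fun σ _ z _ => ?_
    have d1 : HasDerivAt (fun z : ℂ => -(((τ - σ : ℝ) : ℂ) * z)) (-((τ - σ : ℝ) : ℂ)) z := by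
      simpa using ((hasDerivAt_id z).const_mul ((τ - σ : ℝ) : ℂ)).fun_neg
    refine (d1.cexp.smul_const (T σ x)).congr_deriv ?_
    rw [mul_comm, mul_smul]

/-- `T(τ) φ(A) = (e^{-τ z} φ)(A)`. -/
lemma mul_calculus (hT : SemigroupData A T N) (h : CalcSetup A θ M ν ω) {τ : ℝ} (hτ : 0 < τ)
    {φ : ℂ → ℂ} (hφ : MemHInftyZero ω φ) :
    T τ * calculus A ν φ = calculus A ν (fun z => φ z * Complex.exp (-(τ * z))) := by
  have hφ' : MemHInftyZero ω (fun z => φ z * Complex.exp (-(τ * z))) :=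
    hφ.mul_bounded (by fun_prop) fun z hz => norm_exp_neg_mul_le_one h.lt_half_pi hτ.le hz
  ext x
  -- The remainder in T(τ)R(z, A)x is entire in z and O(|z|⁻¹) on the sector, so it drops out of the
  -- contour integral.
  have hdec : SectorDecay ω (fun z => φ z • expConv T τ x z) :=
    hφ.sectorDecay (hT.differentiable_expConv hτ x).differentiableOn
      fun z hz => hT.norm_expConv_le h.lt_half_pi hτ x hz
  have h1 : T τ (calculus A ν φ x)
      = (2 * Real.pi * Complex.I)⁻¹ • contour ν (fun z => φ z • T τ (resolvent A z x)) :=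
    h.clm_calculus ((T τ) ∘L ContinuousLinearMap.apply ℂ E x) hφ
  rw [mul_apply_eq_comp, h1, h.calculus_apply hφ']
  congr 1
  have h2 : contour ν (fun z => φ z • T τ (resolvent A z x))
      = contour ν (fun z => (φ z * Complex.exp (-(τ * z))) • resolvent A z x
        + φ z • expConv T τ x z) := by
    refine contour_congr fun r hr β hβ => ?_
    rw [h.abs_nu] at hβ
    simp only [hT.apply_resolvent h hτ (h.isResolventAt_ray hr hβ), smul_add, smul_smul]
  have hi := (h.contourIntegrable hφ').clm (ContinuousLinearMap.apply ℂ E x)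
  simp only [map_smul] at hi
  have h3 := hi.contour_add (hdec.contourIntegrable h.omega_le_pi h.abs_nu_lt)
  simp only [ContinuousLinearMap.apply_apply] at h3
  rw [h2, h3, hdec.contour_eq_zero h.omega_le_pi h.abs_nu_lt, add_zero]

end SemigroupData

end Semigroup

end

section

/-! ### The operators `A T(t)` and `A² T(t)` -/

open Filter Topology ENNReal

section Operators

variable {E : Type*} [NormedAddCommGroup E] [NormedSpace ℂ E] [CompleteSpace E]
  {A : E →ₗ.[ℂ] E} {θ M ν ω : ℝ} {T : ℝ → E →L[ℂ] E} {N : ℝ}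

/-- The operator `A e^{-tA}`. -/
def genExp (A : E →ₗ.[ℂ] E) (ν t : ℝ) : E →L[ℂ] E :=
  calculus A ν (fun z => z * Complex.exp (-(t * z)))

/-- The operator `A² e^{-tA}`. -/
def genSqExp (A : E →ₗ.[ℂ] E) (ν t : ℝ) : E →L[ℂ] E :=
  calculus A ν (fun z => z ^ 2 * Complex.exp (-(t * z)))

lemma CalcSetup.oneAddInv_mul_calculus_id_mul (h : CalcSetup A θ M ν ω) {φ : ℂ → ℂ}
    (hφ : MemHInftyZero ω φ) (hφ' : MemHInftyZero ω (fun z => z * φ z)) :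
    oneAddInv A * calculus A ν (fun z => z * φ z)
      = calculus A ν φ - oneAddInv A * calculus A ν φ := by
  ext x
  have := (h.mem_graph_iff _ _).1 (h.generator_calculus hφ hφ' x)
  rw [map_add] at this
  simp only [mul_apply_eq_comp, sub_apply]
  exact eq_sub_of_add_eq' this

omit [CompleteSpace E] in
lemma CalcSetup.mul_left_cancel (h : CalcSetup A θ M ν ω) {B C : E →L[ℂ] E}
    (hBC : oneAddInv A * B = oneAddInv A * C) : B = C := by
  ext x
  exact h.oneAddInv_injective (congrArg (fun D : E →L[ℂ] E => D x) hBC)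

/-- `A T(t) = genExp`, in terms of `(1 + A)⁻¹`. -/
lemma SemigroupData.oneAddInv_mul_genExp (hT : SemigroupData A T N) (h : CalcSetup A θ M ν ω)
    {t : ℝ} (ht : 0 < t) : oneAddInv A * genExp A ν t = T t - oneAddInv A * T t := by
  have h1 := memHInftyZero_mul_exp h.omega_pos h.lt_half_pi ht
  -- A second factor (1 + A)⁻¹ is inserted because the calculus reaches T(t) only through the
  -- normalised function: T(t)A(1 + A)⁻² = (z(1 + z)⁻² e^{-tz})(A).
  apply h.mul_left_cancel
  have e1 : oneAddInv A * (oneAddInv A * genExp A ν t)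
      = calculus A ν (fun z => z * Complex.exp (-(t * z)) * (1 + z)⁻¹ * (1 + z)⁻¹) := by
    rw [genExp, h.oneAddInv_mul_calculus h1,
      h.oneAddInv_mul_calculus (h1.mul_inv_one_add h.lt_half_pi)]
  have e2 := hT.mul_calculus h ht (memHInftyZero_id_mul_inv_sq h.lt_half_pi)
  rw [h.calculus_id_mul_inv_sq] at e2
  rw [e1, mul_sub, ← mul_assoc, ← hT.comm_oneAddInv ht, mul_assoc, ← hT.comm_oneAddInv ht,
    ← mul_assoc, ← hT.comm_oneAddInv ht, mul_assoc, ← mul_sub, e2]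
  congr 1
  funext z
  ring

lemma CalcSetup.oneAddInv_mul_genSqExp (h : CalcSetup A θ M ν ω) {t : ℝ} (ht : 0 < t) :
    oneAddInv A * genSqExp A ν t = genExp A ν t - oneAddInv A * genExp A ν t := by
  have e : ∀ z : ℂ, z ^ 2 * Complex.exp (-(t * z)) = z * (z * Complex.exp (-(t * z))) :=
    fun z => by ring
  have h2 := memHInftyZero_sq_mul_exp h.omega_pos h.lt_half_pi ht
  simp only [e] at h2
  simp only [genSqExp, genExp, e]
  exact h.oneAddInv_mul_calculus_id_mul
    (memHInftyZero_mul_exp h.omega_pos h.lt_half_pi ht) h2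

lemma MemHInftyZero.mul_genExp {φ : ℂ → ℂ} (hφ : MemHInftyZero ω φ) (h0 : 0 < ω)
    (hω : ω < Real.pi / 2) {t : ℝ} (ht : 0 < t) :
    MemHInftyZero ω (fun z => z * Complex.exp (-(t * z)) * φ z) :=
  (memHInftyZero_mul_exp h0 hω ht).mul hφ

/-- A case of multiplicativity obtained without a double contour integral: after applying (1 + A)⁻¹
it reduces to the formula for T(t)φ(A), and (1 + A)⁻¹ is then cancelled. -/
lemma SemigroupData.genExp_mul_calculus (hT : SemigroupData A T N) (h : CalcSetup A θ M ν ω)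
    {t : ℝ} (ht : 0 < t) {φ : ℂ → ℂ} (hφ : MemHInftyZero ω φ) :
    genExp A ν t * calculus A ν φ = calculus A ν (fun z => z * (φ z * Complex.exp (-(t * z)))) := by
  have h1 : MemHInftyZero ω (fun z => φ z * Complex.exp (-(t * z))) :=
    hφ.mul_bounded (by fun_prop) fun z hz => norm_exp_neg_mul_le_one h.lt_half_pi ht.le hz
  have h2 : MemHInftyZero ω (fun z => z * (φ z * Complex.exp (-(t * z)))) := by
    convert hφ.mul_genExp h.omega_pos h.lt_half_pi ht using 2 with z
    ring
  apply h.mul_left_cancel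
  rw [← mul_assoc, hT.oneAddInv_mul_genExp h ht, sub_mul, mul_assoc, hT.mul_calculus h ht hφ,
    h.oneAddInv_mul_calculus_id_mul h1 h2]

lemma SemigroupData.genSqExp_mul_calculus (hT : SemigroupData A T N) (h : CalcSetup A θ M ν ω)
    {t : ℝ} (ht : 0 < t) {φ : ℂ → ℂ} (hφ : MemHInftyZero ω φ) :
    genSqExp A ν t * calculus A ν φ
      = calculus A ν (fun z => z ^ 2 * Complex.exp (-(t * z)) * φ z) := by
  have h2 : MemHInftyZero ω (fun z => z * (φ z * Complex.exp (-(t * z)))) := by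
    convert hφ.mul_genExp h.omega_pos h.lt_half_pi ht using 2 with z
    ring
  have h3 : MemHInftyZero ω (fun z => z * (z * (φ z * Complex.exp (-(t * z))))) := by
    convert (memHInftyZero_sq_mul_exp h.omega_pos h.lt_half_pi ht).mul hφ using 2 with z
    ring
  apply h.mul_left_cancel
  rw [← mul_assoc, h.oneAddInv_mul_genSqExp ht, sub_mul, mul_assoc, hT.genExp_mul_calculus h ht hφ,
    ← h.oneAddInv_mul_calculus_id_mul h2 h3]
  congr 2
  funext z
  ring

/-! ### Continuity in parameters -/

/-- Dominated convergence on the two rays, with an H₀^∞ bound uniform near the given parameter. It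
serves for measurability and for norm continuity of A T(t). -/
lemma CalcSetup.continuousAt_calculus (h : CalcSetup A θ M ν ω) {Φ : ℝ → ℂ → ℂ} {p₀ : ℝ}
    {C a : ℝ} (ha : 0 < a) (hd : ∀ᶠ p in 𝓝 p₀, DifferentiableOn ℂ (Φ p) (sector ω))
    (hb : ∀ᶠ p in 𝓝 p₀, ∀ z ∈ sector ω, ‖Φ p z‖ ≤ C * min (‖z‖ ^ a) (‖z‖ ^ (-a)))
    (hc : ∀ z ∈ sector ω, ContinuousAt (fun p => Φ p z) p₀) :
    ContinuousAt (fun p => calculus A ν (Φ p)) p₀ := by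
  have key : ∀ β : ℝ, |β| = ν →
      ContinuousAt (fun p => rayInt (fun z => Φ p z • resolvent A z) β) p₀ := by
    intro β hβ
    refine continuousAt_of_dominated
      (bound := fun r => C * M * (r⁻¹ * min (r ^ a) (r ^ (-a)))) ?_ ?_
      ((integrableOn_min_rpow ha).const_mul _) ?_
    · filter_upwards [hd] with p hp
      exact (((h.continuousOn_ray hp hβ).smul (h.continuousOn_resolvent_ray hβ)).fun_const_smul
        (Complex.exp (β * Complex.I))).aestronglyMeasurable measurableSet_Ioi
    · filter_upwards [hb] with p hp
      filter_upwards [ae_restrict_mem measurableSet_Ioi] with r hr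
      have hr' : 0 < r := hr
      have h1 := hp _ (h.ray_mem hr hβ)
      rw [norm_ray_point hr] at h1
      have h3 : 0 ≤ min (r ^ a) (r ^ (-a)) := min_rpow_nonneg hr'.le
      have h4 : ‖resolvent A (r * Complex.exp (β * Complex.I))‖ ≤ r⁻¹ * M := by
        rw [← div_eq_inv_mul, le_div_iff₀ hr', mul_comm]
        exact h.norm_resolvent_ray hr hβ
      rw [norm_smul, Complex.norm_exp_ofReal_mul_I, one_mul, norm_smul]
      calc _ ≤ (C * min (r ^ a) (r ^ (-a))) * (r⁻¹ * M) := by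
            gcongr
            exact (norm_nonneg _).trans h1
        _ = _ := by ring
    · filter_upwards [ae_restrict_mem measurableSet_Ioi] with r hr
      exact ((hc _ (h.ray_mem hr hβ)).fun_smul continuousAt_const).fun_const_smul _
  simp only [calculus_eq_contour, contour]
  exact ((key _ (by rw [abs_neg, h.abs_nu])).fun_sub (key _ h.abs_nu)).fun_const_smul _

lemma norm_exp_neg_mul_anti (hω : ω < Real.pi / 2) {s t : ℝ} (hst : s ≤ t) {z : ℂ}
    (hz : z ∈ sector ω) : ‖Complex.exp (-(t * z))‖ ≤ ‖Complex.exp (-(s * z))‖ := by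
  have h0 : 0 < ω := lt_of_le_of_lt (abs_nonneg _) hz.2
  have h1 := re_ge_of_mem_sector (by linarith [Real.pi_pos]) hz
  have h2 := (Real.cos_pos_of_mem_Ioo ⟨by linarith, hω⟩).le
  have h3 : 0 ≤ z.re := le_trans (by positivity) h1
  rw [Complex.norm_exp, Complex.norm_exp, Complex.neg_re, Complex.neg_re, Complex.re_ofReal_mul,
    Complex.re_ofReal_mul]
  gcongr

lemma CalcSetup.continuousOn_mul_exp (h : CalcSetup A θ M ν ω) {p : ℂ → ℂ}
    (hp : ∀ t : ℝ, 0 < t → MemHInftyZero ω (fun z => p z * Complex.exp (-(t * z)))) :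
    ContinuousOn (fun t : ℝ => calculus A ν (fun z => p z * Complex.exp (-(t * z)))) (Ioi 0) := by
  intro t₀ ht₀
  have ht₀' : 0 < t₀ := ht₀
  -- On the sector |e^{-tz}| decreases in t, so the bound at t₀/2 dominates for all t > t₀/2.
  obtain ⟨_, C, a, hC, ha, hb⟩ := hp (t₀ / 2) (half_pos ht₀')
  refine (h.continuousAt_calculus (C := C) ha ?_ ?_ ?_).continuousWithinAt
  · filter_upwards [Ioi_mem_nhds ht₀'] with t ht
    exact (hp t ht).1
  · filter_upwards [Ioi_mem_nhds (half_lt_self ht₀')] with t ht z hz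
    refine le_trans ?_ (hb z hz)
    rw [norm_mul, norm_mul]
    gcongr
    exact norm_exp_neg_mul_anti h.lt_half_pi (le_of_lt ht) hz
  · intro z _
    fun_prop

lemma CalcSetup.continuousOn_genExp (h : CalcSetup A θ M ν ω) :
    ContinuousOn (genExp A ν) (Ioi 0) :=
  h.continuousOn_mul_exp fun _ ht => memHInftyZero_mul_exp h.omega_pos h.lt_half_pi ht

lemma CalcSetup.continuousOn_genSqExp (h : CalcSetup A θ M ν ω) :
    ContinuousOn (genSqExp A ν) (Ioi 0) :=
  h.continuousOn_mul_exp fun _ ht => memHInftyZero_sq_mul_exp h.omega_pos h.lt_half_pi ht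

lemma CalcSetup.continuousOn_scale (h : CalcSetup A θ M ν ω) {ψ : ℂ → ℂ}
    (hψ : MemHInftyZero ω ψ) :
    ContinuousOn (fun r : ℝ => calculus A ν (fun z => ψ (r * z))) (Ioi 0) := by
  intro r₀ hr₀
  have hr₀' : 0 < r₀ := hr₀
  have hψ' := hψ
  obtain ⟨hd, C, a, hC, ha, hb⟩ := hψ
  have hm : ∀ᶠ r in 𝓝 r₀, max (r ^ a) (r ^ (-a)) < max (r₀ ^ a) (r₀ ^ (-a)) + 1 := by
    have hc : ContinuousAt (fun r : ℝ => max (r ^ a) (r ^ (-a))) r₀ :=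
      (Real.continuousAt_rpow_const _ _ (Or.inl hr₀'.ne')).max
        (Real.continuousAt_rpow_const _ _ (Or.inl hr₀'.ne'))
    exact hc.eventually (gt_mem_nhds (by simp))
  refine (h.continuousAt_calculus (C := C * (max (r₀ ^ a) (r₀ ^ (-a)) + 1)) ha
    ?_ ?_ ?_).continuousWithinAt
  · filter_upwards [Ioi_mem_nhds hr₀'] with r hr
    exact (hψ'.scale hr).1
  · filter_upwards [Ioi_mem_nhds hr₀', hm] with r hr hr2 z hz
    have h1 := hb _ (smul_mem_sector hr hz)
    have hr' : 0 < r := hr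
    rw [norm_mul, Complex.norm_of_nonneg hr'.le] at h1
    refine h1.trans ?_
    have h3 : 0 ≤ min (‖z‖ ^ a) (‖z‖ ^ (-a)) := min_rpow_nonneg (norm_nonneg _)
    rw [mul_assoc]
    gcongr
    refine (min_rpow_mul_le hr (norm_pos_iff.2 hz.1)).trans ?_
    gcongr
  · intro z hz
    have h1 : ContinuousAt ψ ((r₀ : ℂ) * z) :=
      (hd.differentiableAt ((isOpen_sector ω h.omega_le_pi).mem_nhds
        (smul_mem_sector hr₀' hz))).continuousAt
    exact ContinuousAt.comp (f := fun r : ℝ => (r : ℂ) * z) h1 (by fun_prop)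

/-! ### Norm estimates -/

omit [CompleteSpace E] in
-- On each of the two rays ‖R(z, A)‖ ≤ M/r, and |2πi|⁻¹ ≤ 1; hence 2M and the measure dr/r.
lemma CalcSetup.enorm_calculus_le (h : CalcSetup A θ M ν ω) {φ : ℂ → ℂ} {F : ℝ → ℝ}
    (hF : ∀ r : ℝ, 0 < r → ∀ β : ℝ, |β| = ν → ‖φ (r * Complex.exp (β * Complex.I))‖ ≤ F r) :
    ‖calculus A ν φ‖ₑ ≤ ENNReal.ofReal (2 * M) * ∫⁻ r in Ioi (0 : ℝ), ENNReal.ofReal (F r * r⁻¹) := by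
  have hM := h.bound_nonneg
  have key : ∀ β : ℝ, |β| = ν → ‖rayInt (fun z => φ z • resolvent A z) β‖ₑ
      ≤ ENNReal.ofReal M * ∫⁻ r in Ioi (0 : ℝ), ENNReal.ofReal (F r * r⁻¹) := by
    intro β hβ
    rw [← lintegral_const_mul' _ _ ENNReal.ofReal_ne_top]
    refine (enorm_integral_le_lintegral_enorm _).trans
      (setLIntegral_mono' measurableSet_Ioi fun r hr => ?_)
    have hr' : 0 < r := hr
    rw [← ENNReal.ofReal_mul hM, ← ofReal_norm]
    refine ENNReal.ofReal_le_ofReal ?_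
    rw [norm_smul, Complex.norm_exp_ofReal_mul_I, one_mul, norm_smul]
    have h4 : ‖resolvent A (r * Complex.exp (β * Complex.I))‖ ≤ r⁻¹ * M := by
      rw [← div_eq_inv_mul, le_div_iff₀ hr', mul_comm]
      exact h.norm_resolvent_ray hr hβ
    calc _ ≤ F r * (r⁻¹ * M) := by
          gcongr
          · exact (norm_nonneg _).trans (hF r hr β hβ)
          · exact hF r hr β hβ
      _ = _ := by ring
  rw [calculus_eq_contour, enorm_smul, contour]
  have h1 : ‖(2 * Real.pi * Complex.I : ℂ)⁻¹‖ₑ ≤ 1 := by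
    rw [← ofReal_norm]
    refine ENNReal.ofReal_le_one.2 ?_
    rw [norm_inv]
    refine inv_le_one_of_one_le₀ ?_
    simp only [norm_mul, Complex.norm_ofNat, Complex.norm_real, Complex.norm_I, mul_one,
      Real.norm_of_nonneg Real.pi_pos.le]
    linarith [Real.pi_gt_three]
  calc _ ≤ 1 * (ENNReal.ofReal M * (∫⁻ r in Ioi (0 : ℝ), ENNReal.ofReal (F r * r⁻¹))
        + ENNReal.ofReal M * ∫⁻ r in Ioi (0 : ℝ), ENNReal.ofReal (F r * r⁻¹)) := by
        gcongr
        refine (enorm_sub_le).trans ?_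
        gcongr
        · exact key _ (by rw [abs_neg, h.abs_nu])
        · exact key _ h.abs_nu
    _ = _ := by rw [ENNReal.ofReal_mul two_pos.le, ENNReal.ofReal_ofNat]; ring

lemma integrableOn_mul_exp_neg {b : ℝ} (hb : 0 < b) :
    IntegrableOn (fun r : ℝ => r * Real.exp (-(b * r))) (Ioi 0) := by
  have h2 := integrableOn_rpow_mul_exp_neg_mul_rpow (s := 1) (p := 1) (b := b) (by norm_num)
    one_pos hb
  have e2 : ∀ r : ℝ, r ^ (1 : ℝ) * Real.exp (-b * r ^ (1 : ℝ)) = r * Real.exp (-(b * r)) := by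
    intro r
    rw [Real.rpow_one, neg_mul]
  simpa only [e2] using h2

lemma lintegral_mul_exp_neg {b : ℝ} (hb : 0 < b) :
    ∫⁻ r in Ioi (0 : ℝ), ENNReal.ofReal (r * Real.exp (-(b * r))) = ENNReal.ofReal ((b ^ 2)⁻¹) := by
  have h1 := Real.integral_rpow_mul_exp_neg_mul_Ioi (a := 2) (r := b) two_pos hb
  have h2 := integrableOn_mul_exp_neg hb
  have e : ∀ r : ℝ, r ^ (2 - 1 : ℝ) * Real.exp (-(b * r)) = r * Real.exp (-(b * r)) := by
    intro r
    norm_num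
  simp only [e] at h1
  rw [← ofReal_integral_eq_lintegral_ofReal h2, h1]
  · congr 1
    simp
  · filter_upwards [ae_restrict_mem measurableSet_Ioi] with r hr
    have : 0 < r := hr
    positivity

omit [CompleteSpace E] in
/-- The bound of `z² e^{-tz}` on the rays of angle `±ν`. -/
lemma CalcSetup.norm_sq_mul_exp_le (h : CalcSetup A θ M ν ω) {t : ℝ} (ht : 0 < t) {r β : ℝ}
    (hr : 0 < r) (hβ : |β| = ν) :
    ‖((r : ℂ) * Complex.exp (β * Complex.I)) ^ 2
        * Complex.exp (-(t * ((r : ℂ) * Complex.exp (β * Complex.I))))‖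
      ≤ r ^ 2 * Real.exp (-(t * Real.cos ω * r)) := by
  have h1 := norm_exp_neg_mul_le h.omega_le_pi ht.le (h.ray_mem hr hβ)
  rw [norm_mul, norm_pow, norm_ray_point hr]
  rw [norm_ray_point hr] at h1
  gcongr

omit [CompleteSpace E] in
lemma CalcSetup.cos_pos (h : CalcSetup A θ M ν ω) : 0 < Real.cos ω :=
  Real.cos_pos_of_mem_Ioo ⟨by linarith [h.omega_pos, Real.pi_pos], h.lt_half_pi⟩

lemma lintegral_sq_mul_exp {k t : ℝ} (hk : 0 < k) (ht : 0 < t) :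
    ∫⁻ r in Ioi (0 : ℝ), ENNReal.ofReal (r ^ 2 * Real.exp (-(t * k * r)) * r⁻¹)
      = ENNReal.ofReal ((k ^ 2)⁻¹) * ENNReal.ofReal ((t ^ 2)⁻¹) := by
  rw [← ENNReal.ofReal_mul (by positivity), ← mul_inv, ← mul_pow, mul_comm k t,
    ← lintegral_mul_exp_neg (mul_pos ht hk)]
  refine setLIntegral_congr_fun measurableSet_Ioi fun r hr => ?_
  have : (r : ℝ) ≠ 0 := ne_of_gt hr
  congr 1
  field_simp

omit [CompleteSpace E] in
lemma CalcSetup.enorm_genSqExp_le (h : CalcSetup A θ M ν ω) :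
    ∃ K : ℝ, 0 ≤ K ∧ ∀ t, 0 < t →
      ‖genSqExp A ν t‖ₑ ≤ ENNReal.ofReal K * ENNReal.ofReal ((t ^ 2)⁻¹) := by
  have hM := h.bound_nonneg
  have hc := h.cos_pos
  refine ⟨2 * M * ((Real.cos ω) ^ 2)⁻¹, by positivity, fun t ht => ?_⟩
  refine (h.enorm_calculus_le fun r hr β hβ => h.norm_sq_mul_exp_le ht hr hβ).trans ?_
  rw [lintegral_sq_mul_exp hc ht, ← mul_assoc, ← ENNReal.ofReal_mul (by positivity)]

omit [CompleteSpace E] in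
/-- The embedding estimate: `∫₀^∞ ‖(φ ψ_ρ)(A)‖ dρ/ρ ≤ K ∫₀^∞ |φ| dr/r`. -/
lemma CalcSetup.lintegral_enorm_calculus_scale_le (h : CalcSetup A θ M ν ω) {ψ : ℂ → ℂ}
    (hψ : MemHInftyZero ω ψ) : ∃ K : ℝ, 0 ≤ K ∧ ∀ (φ : ℂ → ℂ) (F : ℝ → ℝ), Measurable F →
      (∀ r : ℝ, 0 < r → ∀ β : ℝ, |β| = ν → ‖φ (r * Complex.exp (β * Complex.I))‖ ≤ F r) →
      ∫⁻ ρ in Ioi (0 : ℝ), ENNReal.ofReal ρ⁻¹ * ‖calculus A ν (fun z => φ z * ψ (ρ * z))‖ₑ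
        ≤ ENNReal.ofReal K * ∫⁻ r in Ioi (0 : ℝ), ENNReal.ofReal (F r * r⁻¹) := by
  obtain ⟨hd, C, a, hC, ha, hb⟩ := hψ
  have hM := h.bound_nonneg
  set m : ℝ → ℝ := fun r => min (r ^ a) (r ^ (-a)) with hm
  have hm0 : ∀ r, 0 < r → 0 ≤ m r := fun r hr => min_rpow_nonneg hr.le
  have hmm : Measurable m := by fun_prop
  set J := ∫ r in Ioi (0 : ℝ), r⁻¹ * m r with hJ
  have hJ0 : 0 ≤ J := setIntegral_nonneg measurableSet_Ioi fun r hr =>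
    mul_nonneg (inv_nonneg.2 (le_of_lt hr)) (hm0 r hr)
  refine ⟨2 * M * C * J, by positivity, fun φ F hF hφ => ?_⟩
  -- The measure dρ/ρ is invariant under dilations, so after Tonelli the inner integral does not
  -- depend on r.
  have hscale : ∀ r : ℝ, 0 < r →
      ∫⁻ ρ in Ioi (0 : ℝ), ENNReal.ofReal (ρ⁻¹ * m (ρ * r)) = ENNReal.ofReal J := by
    intro r hr
    have h1 := integral_comp_mul_left_Ioi (fun ρ => ρ⁻¹ * m ρ) 0 hr
    have h2 := (integrableOn_Ioi_comp_mul_left_iff (fun ρ => ρ⁻¹ * m ρ) 0 hr).2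
      (by rw [mul_zero]; exact integrableOn_min_rpow ha)
    rw [mul_zero, eq_inv_smul_iff₀ hr.ne', ← integral_smul] at h1
    rw [hJ, ← h1, ofReal_integral_eq_lintegral_ofReal]
    · refine setLIntegral_congr_fun measurableSet_Ioi fun ρ hρ => ?_
      simp only [smul_eq_mul]
      congr 1
      rw [mul_comm ρ r]
      field_simp
    · exact Integrable.smul r h2
    · filter_upwards [ae_restrict_mem measurableSet_Ioi] with ρ hρ
      have h3 : 0 < r * ρ := mul_pos hr hρ
      exact mul_nonneg hr.le (mul_nonneg (inv_nonneg.2 h3.le) (hm0 _ h3))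
  have hb' : ∀ ρ : ℝ, 0 < ρ → ‖calculus A ν (fun z => φ z * ψ (ρ * z))‖ₑ
      ≤ ENNReal.ofReal (2 * M)
        * ∫⁻ r in Ioi (0 : ℝ), ENNReal.ofReal (F r * (C * m (ρ * r)) * r⁻¹) := by
    intro ρ hρ
    refine h.enorm_calculus_le fun r hr β hβ => ?_
    have h1 := hb _ (smul_mem_sector hρ (h.ray_mem hr hβ))
    rw [norm_mul, norm_ray_point hr, Complex.norm_of_nonneg hρ.le] at h1
    rw [norm_mul]
    gcongr
    · exact (norm_nonneg _).trans (hφ r hr β hβ)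
    · exact hφ r hr β hβ
  calc ∫⁻ ρ in Ioi (0 : ℝ), ENNReal.ofReal ρ⁻¹ * ‖calculus A ν (fun z => φ z * ψ (ρ * z))‖ₑ
      ≤ ∫⁻ ρ in Ioi (0 : ℝ), ∫⁻ r in Ioi (0 : ℝ), ENNReal.ofReal (2 * M * C)
          * (ENNReal.ofReal (F r * r⁻¹) * ENNReal.ofReal (ρ⁻¹ * m (ρ * r))) := by
        refine setLIntegral_mono' measurableSet_Ioi fun ρ hρ => ?_
        have hρ' : 0 < ρ := hρ
        refine (mul_le_mul_right (hb' ρ hρ) _).trans (le_of_eq ?_)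
        rw [← lintegral_const_mul' _ _ ENNReal.ofReal_ne_top,
          ← lintegral_const_mul' _ _ ENNReal.ofReal_ne_top]
        refine setLIntegral_congr_fun measurableSet_Ioi fun r hr => ?_
        have hr' : 0 < r := hr
        have hmr := hm0 _ (mul_pos hρ' hr')
        rw [← ENNReal.ofReal_mul (by positivity), ← ENNReal.ofReal_mul (by positivity),
          ← ENNReal.ofReal_mul' (by positivity), ← ENNReal.ofReal_mul (by positivity)]
        congr 1
        ring
    _ = ∫⁻ r in Ioi (0 : ℝ), ∫⁻ ρ in Ioi (0 : ℝ), ENNReal.ofReal (2 * M * C)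
          * (ENNReal.ofReal (F r * r⁻¹) * ENNReal.ofReal (ρ⁻¹ * m (ρ * r))) := by
        refine lintegral_lintegral_swap (Measurable.aemeasurable ?_)
        have e1 : Measurable fun p : ℝ × ℝ => F p.2 := hF.comp measurable_snd
        have e2 : Measurable fun p : ℝ × ℝ => m (p.1 * p.2) := hmm.comp (by fun_prop)
        unfold Function.uncurry
        fun_prop
    _ = ∫⁻ r in Ioi (0 : ℝ), ENNReal.ofReal (2 * M * C)
          * (ENNReal.ofReal (F r * r⁻¹) * ENNReal.ofReal J) := by
        refine setLIntegral_congr_fun measurableSet_Ioi fun r hr => ?_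
        rw [lintegral_const_mul' _ _ ENNReal.ofReal_ne_top,
          lintegral_const_mul' _ _ ENNReal.ofReal_ne_top, hscale r hr]
    _ = _ := by
        rw [lintegral_const_mul' _ _ ENNReal.ofReal_ne_top,
          lintegral_mul_const' _ _ ENNReal.ofReal_ne_top, ENNReal.ofReal_mul (p := 2 * M * C)
          (by positivity)]
        ring

end Operators

end

section

/-! ### Injectivity of the Laplace transform -/

open Filter Topology ENNReal FourierTransform

lemma isPreconnected_sector {ω : ℝ} (hω : ω ≤ Real.pi) : IsPreconnected (sector ω) := by
  have h1 : Convex ℝ {ζ : ℂ | |ζ.im| < ω} := by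
    have : {ζ : ℂ | |ζ.im| < ω} = Complex.imLm ⁻¹' (Metric.ball 0 ω) := by
      ext ζ; simp
    rw [this]
    exact (convex_ball 0 ω).linear_preimage Complex.imLm
  have h2 : sector ω = Complex.exp '' {ζ : ℂ | |ζ.im| < ω} := by
    ext z
    constructor
    · rintro ⟨hz, hz'⟩
      exact ⟨Complex.log z, by simpa [Complex.log_im] using hz', Complex.exp_log hz⟩
    · rintro ⟨ζ, hζ, rfl⟩
      have hζ' : |ζ.im| < ω := hζ
      have h3 := abs_lt.1 hζ'
      refine ⟨Complex.exp_ne_zero _, ?_⟩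
      have := arg_exp_line (x := ζ.re) (b := ζ.im) (by linarith) (by linarith)
      rw [Complex.re_add_im] at this
      rwa [this]
  rw [h2]
  exact h1.isPreconnected.image _ Complex.continuous_exp.continuousOn

/-- A function vanishing on `(0, ∞)` vanishes frequently near `1`. -/
lemma frequently_eq_zero_of_pos {f : ℂ → ℂ} (h : ∀ c : ℝ, 0 < c → f c = 0) :
    ∃ᶠ z in 𝓝[≠] (1 : ℂ), f z = 0 := by
  have h1 : Tendsto (fun c : ℝ => (c : ℂ)) (𝓝[>] 1) (𝓝[≠] (1 : ℂ)) := by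
    refine tendsto_nhdsWithin_iff.2 ⟨?_, ?_⟩
    · have := (Complex.continuous_ofReal.tendsto 1)
      rw [Complex.ofReal_one] at this
      exact this.mono_left nhdsWithin_le_nhds
    · filter_upwards [self_mem_nhdsWithin] with c hc
      have hc' : (1 : ℝ) < c := hc
      simp only [mem_compl_iff, mem_singleton_iff]
      exact_mod_cast hc'.ne'
  refine h1.frequently (Eventually.frequently ?_)
  filter_upwards [self_mem_nhdsWithin] with c hc
  exact h c (one_pos.trans hc)

lemma differentiableOn_laplace {g : ℝ → ℂ} {C : ℝ} (hc : ContinuousOn g (Ioi 0))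
    (hb : ∀ s, 0 < s → ‖g s‖ ≤ C) :
    DifferentiableOn ℂ (fun w : ℂ => ∫ s in Ioi (0 : ℝ), g s * Complex.exp (-(w * s)))
      {w | 0 < w.re} := by
  intro w₀ hw₀
  have hw₀' : 0 < w₀.re := hw₀
  have hcont : ∀ w : ℂ, ContinuousOn (fun s : ℝ => g s * Complex.exp (-(w * s))) (Ioi 0) :=
    fun w => hc.mul (by fun_prop)
  have hC : 0 ≤ C := (norm_nonneg _).trans (hb 1 one_pos)
  have hnorm : ∀ (w : ℂ) (s : ℝ), ‖Complex.exp (-(w * s))‖ = Real.exp (-(w.re * s)) := by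
    intro w s
    rw [Complex.norm_exp, Complex.neg_re, Complex.re_mul_ofReal]
  refine (hasDerivAt_integral_of_dominated_loc_of_deriv_le
    (μ := volume.restrict (Ioi (0 : ℝ))) (𝕜 := ℂ) (x₀ := w₀) (s := Metric.ball w₀ (w₀.re / 2))
    (F := fun (w : ℂ) (s : ℝ) => g s * Complex.exp (-(w * s)))
    (F' := fun (w : ℂ) (s : ℝ) => g s * (Complex.exp (-(w * s)) * (-s)))
    (bound := fun s => C * (s * Real.exp (-(w₀.re / 2 * s))))
    (Metric.ball_mem_nhds w₀ (half_pos hw₀')) ?_ ?_ ?_ ?_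
    ((integrableOn_mul_exp_neg (half_pos hw₀')).const_mul C) ?_).2.differentiableAt.differentiableWithinAt
  · exact Eventually.of_forall fun w => (hcont w).aestronglyMeasurable measurableSet_Ioi
  · have hi : IntegrableOn (fun s : ℝ => C * Real.exp (-(w₀.re * s))) (Ioi 0) := by
      have := integrableOn_exp_mul_Ioi (neg_lt_zero.2 hw₀') 0
      simp only [neg_mul] at this
      exact this.const_mul C
    refine hi.mono' ((hcont w₀).aestronglyMeasurable measurableSet_Ioi) ?_
    filter_upwards [ae_restrict_mem measurableSet_Ioi] with s hs
    rw [norm_mul, hnorm]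
    gcongr
    exact hb s hs
  · exact (hc.mul (by fun_prop : Continuous fun s : ℝ =>
      Complex.exp (-(w₀ * s)) * (-s)).continuousOn).aestronglyMeasurable measurableSet_Ioi
  · filter_upwards [ae_restrict_mem measurableSet_Ioi] with s hs w hw
    have hs' : 0 < s := hs
    rw [norm_mul, norm_mul, hnorm, norm_neg, Complex.norm_of_nonneg hs'.le, mul_comm s]
    have : w₀.re / 2 ≤ w.re := by
      rw [Metric.mem_ball, dist_eq_norm] at hw
      have h1 := (Complex.abs_re_le_norm (w - w₀)).trans hw.le
      rw [Complex.sub_re] at h1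
      linarith [(abs_le.1 h1).1]
    gcongr
    exact hb s hs
  · filter_upwards with s w _
    have d : HasDerivAt (fun w : ℂ => -(w * s)) (-s) w := by
      simpa using ((hasDerivAt_id w).mul_const (s : ℂ)).fun_neg
    exact d.cexp.const_mul (g s)

/-- Injectivity of the Laplace transform on bounded continuous functions. -/
lemma eq_zero_of_laplace_eq_zero {g : ℝ → ℂ} {C : ℝ} (hc : ContinuousOn g (Ioi 0))
    (hb : ∀ s, 0 < s → ‖g s‖ ≤ C)
    (h0 : ∀ c : ℝ, 0 < c → ∫ s in Ioi (0 : ℝ), g s * Complex.exp (-(c * s)) = 0) :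
    ∀ s, 0 < s → g s = 0 := by
  have hopen : IsOpen {w : ℂ | 0 < w.re} := isOpen_lt continuous_const Complex.continuous_re
  -- The Laplace transform is holomorphic on Re w > 0 and vanishes on the positive axis, hence
  -- everywhere by the identity theorem.
  have han := (differentiableOn_laplace hc hb).analyticOnNhd hopen
  have hz := han.eqOn_zero_of_preconnected_of_frequently_eq_zero
    (convex_halfSpace_re_gt 0).isPreconnected (z₀ := 1) (by simp)
    (frequently_eq_zero_of_pos h0)
  set G : ℝ → ℂ := (Ioi (0 : ℝ)).indicator (fun s => g s * Complex.exp (-s)) with hG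
  have hcont : ContinuousOn (fun s : ℝ => g s * Complex.exp (-s)) (Ioi 0) :=
    hc.mul (by fun_prop)
  have hGi : Integrable G := by
    rw [hG, integrable_indicator_iff measurableSet_Ioi]
    have hi : IntegrableOn (fun s : ℝ => C * Real.exp (-s)) (Ioi 0) := by
      have := integrableOn_exp_mul_Ioi (a := -1) (by norm_num) 0
      simp only [neg_one_mul] at this
      exact this.const_mul C
    refine hi.mono' (hcont.aestronglyMeasurable measurableSet_Ioi) ?_
    filter_upwards [ae_restrict_mem measurableSet_Ioi] with s hs
    rw [norm_mul, Complex.norm_exp, Complex.neg_re, Complex.ofReal_re]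
    gcongr
    exact hb s hs
  -- On the line Re w = 1 the Laplace transform of g is the Fourier transform of e^{-s} g(s), so
  -- Fourier inversion applies at each point of continuity.
  have hF : 𝓕 G = 0 := by
    funext ξ
    rw [Real.fourier_real_eq_integral_exp_smul, Pi.zero_apply]
    have := hz (show (1 + 2 * Real.pi * ξ * Complex.I : ℂ) ∈ {w : ℂ | 0 < w.re} by simp)
    simp only [Pi.zero_apply] at this
    rw [← this, ← integral_indicator measurableSet_Ioi]
    congr 1
    funext s
    by_cases hs : s ∈ Ioi (0 : ℝ)
    · rw [hG, indicator_of_mem hs, indicator_of_mem hs, smul_eq_mul, mul_left_comm,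
        ← Complex.exp_add]
      congr 2
      push_cast
      ring
    · rw [hG, indicator_of_notMem hs, indicator_of_notMem hs, smul_zero]
  intro s hs
  have hGc : ContinuousAt G s := by
    refine (hcont.continuousAt (Ioi_mem_nhds hs)).congr ?_
    filter_upwards [Ioi_mem_nhds hs] with t ht
    rw [hG, indicator_of_mem ht]
  have h1 := hGi.fourierInv_fourier_eq (by rw [hF]; exact integrable_zero _ _ _) hGc
  rw [hF] at h1
  have h2 : 𝓕⁻ (0 : ℝ → ℂ) s = 0 := by
    rw [Real.fourierInv_eq]
    simp
  rw [h2, hG, indicator_of_mem (mem_Ioi.2 hs)] at h1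
  exact (mul_eq_zero.1 h1.symm).resolve_right (Complex.exp_ne_zero _)

/-- Otherwise ψ vanishes on (0, ∞), hence on the connected sector. The integral is the constant κ of
the reproducing formula, by which one has to divide. -/
lemma MemHInftyZero.exists_laplace_ne_zero {ω : ℝ} (h0 : 0 < ω) (hω : ω ≤ Real.pi) {ψ : ℂ → ℂ}
    (hψ : MemHInftyZero ω ψ) (hψ0 : ∃ z ∈ sector ω, ψ z ≠ 0) :
    ∃ c : ℝ, 0 < c ∧ ∫ s in Ioi (0 : ℝ), ψ s * Complex.exp (-(c * s)) ≠ 0 := by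
  by_contra! hcon
  obtain ⟨z, hz, hne⟩ := hψ0
  obtain ⟨C, _, hC⟩ := hψ.bounded
  have hzero := eq_zero_of_laplace_eq_zero (g := fun s : ℝ => ψ s)
    (hψ.1.continuousOn.comp Complex.continuous_ofReal.continuousOn
      fun s hs => mem_sector_of_pos h0 hs)
    (fun s hs => hC _ (mem_sector_of_pos h0 hs)) hcon
  have hone : (1 : ℂ) ∈ sector ω := by
    simpa using mem_sector_of_pos h0 one_pos
  have := (hψ.1.analyticOnNhd (isOpen_sector ω hω)).eqOn_zero_of_preconnected_of_frequently_eq_zero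
    (isPreconnected_sector hω) hone (frequently_eq_zero_of_pos hzero)
  exact hne (this hz)

end

section

/-! ### The reproducing formula -/

open Filter Topology ENNReal

section Reproducing

variable {E : Type*} [NormedAddCommGroup E] [NormedSpace ℂ E] [CompleteSpace E]
  {A : E →ₗ.[ℂ] E} {θ M ν ω : ℝ} {T : ℝ → E →L[ℂ] E} {N : ℝ} {ψ : ℂ → ℂ}

omit [CompleteSpace E] in
-- The scalar core of the reproducing formula. The dilation σ = rs gives the integral of ψ(z)e^{-cz}
-- along the ray of angle β, which is rotated to the positive axis; no dependence on r or β remains.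
lemma CalcSetup.integral_ray_eq_laplace (h : CalcSetup A θ M ν ω) (hψ : MemHInftyZero ω ψ)
    {c : ℝ} (hc : 0 < c) {r β : ℝ} (hr : 0 < r) (hβ : |β| = ν) :
    ∫ s in Ioi (0 : ℝ), ((r : ℂ) * Complex.exp (β * Complex.I)) *
        (ψ (s * (r * Complex.exp (β * Complex.I)))
          * Complex.exp (-(c * (s * (r * Complex.exp (β * Complex.I))))))
      = ∫ s in Ioi (0 : ℝ), ψ s * Complex.exp (-(c * s)) := by
  obtain ⟨K, _, hK⟩ := (memHInftyZero_mul_exp h.omega_pos h.lt_half_pi hc).bounded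
  have hdec : SectorDecay ω (fun z => ψ z • Complex.exp (-(c * z))) :=
    hψ.sectorDecay (by fun_prop) fun z hz => by rw [← norm_mul]; exact hK z hz
  have h1 := hdec.rayInt_eq h.omega_le_pi (β₁ := β) (β₂ := 0) (hβ.trans_lt h.nu_lt)
    (by rw [abs_zero]; exact h.omega_pos)
  simp only [rayInt, Complex.ofReal_zero, zero_mul, Complex.exp_zero, mul_one, one_mul,
    smul_eq_mul] at h1
  have h2 := integral_comp_mul_left_Ioi (fun σ : ℝ => Complex.exp (β * Complex.I) *
    (ψ (σ * Complex.exp (β * Complex.I)) * Complex.exp (-(c * (σ * Complex.exp (β * Complex.I))))))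
    0 hr
  rw [mul_zero, h1, eq_inv_smul_iff₀ hr.ne', ← integral_smul] at h2
  rw [← h2]
  refine setIntegral_congr_fun measurableSet_Ioi fun s _ => ?_
  simp only [Complex.real_smul, Complex.ofReal_mul]
  have e : (r : ℂ) * s * Complex.exp (β * Complex.I) = s * (r * Complex.exp (β * Complex.I)) := by
    ring
  rw [e]
  ring

/-- The integrand of the reproducing formula on the ray of angle `β`. -/
def reproKernel (A : E →ₗ.[ℂ] E) (ψ : ℂ → ℂ) (t c β : ℝ) (p : ℝ × ℝ) : E →L[ℂ] E :=
  Complex.exp (β * Complex.I) •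
    ((((p.2 : ℂ) * Complex.exp (β * Complex.I)) ^ 2
      * Complex.exp (-(((t + c * p.1 : ℝ) : ℂ) * ((p.2 : ℂ) * Complex.exp (β * Complex.I))))
      * ψ (p.1 * ((p.2 : ℂ) * Complex.exp (β * Complex.I))))
    • resolvent A ((p.2 : ℂ) * Complex.exp (β * Complex.I)))

omit [CompleteSpace E] in
lemma integrable_reproBound {a b : ℝ} (ha : 0 < a) (hb : 0 < b) :
    Integrable (fun p : ℝ × ℝ => p.2 * Real.exp (-(a * p.2)) * Real.exp (-(b * p.2) * p.1))
      ((volume.restrict (Ioi (0 : ℝ))).prod (volume.restrict (Ioi (0 : ℝ)))) := by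
  rw [integrable_prod_iff' (Continuous.aestronglyMeasurable (by fun_prop))]
  constructor
  · filter_upwards [ae_restrict_mem measurableSet_Ioi] with r hr
    exact (integrableOn_exp_mul_Ioi (neg_lt_zero.2 (mul_pos hb hr)) 0).const_mul _
  · have h1 : IntegrableOn (fun r : ℝ => Real.exp (-a * r) * b⁻¹) (Ioi 0) :=
      (integrableOn_exp_mul_Ioi (neg_lt_zero.2 ha) 0).mul_const _
    refine h1.congr_fun (fun r hr => ?_) measurableSet_Ioi
    have hr' : 0 < r := hr
    have h2 : ∀ s : ℝ, ‖r * Real.exp (-(a * r)) * Real.exp (-(b * r) * s)‖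
        = r * Real.exp (-(a * r)) * Real.exp (-(b * r) * s) := fun s =>
      Real.norm_of_nonneg (by positivity)
    simp only [h2]
    rw [integral_const_mul, integral_exp_mul_Ioi (neg_lt_zero.2 (mul_pos hb hr'))]
    simp only [mul_zero, Real.exp_zero, neg_mul]
    field_simp

/-- Only boundedness of ψ is used. With Re z ≥ r cos ω the exponential supplies the decay:
integrating in s yields a multiple of 1/r, which cancels the remaining power of r, and e^{-tr cos ω}
is integrable. -/
lemma CalcSetup.integrable_reproKernel (h : CalcSetup A θ M ν ω) (hψ : MemHInftyZero ω ψ)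
    {t c : ℝ} (ht : 0 < t) (hc : 0 < c) {β : ℝ} (hβ : |β| = ν) :
    Integrable (reproKernel A ψ t c β)
      ((volume.restrict (Ioi (0 : ℝ))).prod (volume.restrict (Ioi (0 : ℝ)))) := by
  obtain ⟨C, hC, hb⟩ := hψ.bounded
  have hk := h.cos_pos
  have hM := h.bound_nonneg
  refine ((integrable_reproBound (a := t * Real.cos ω) (b := c * Real.cos ω) (by positivity)
    (by positivity)).const_mul (C * M)).mono' ?_ ?_
  · rw [Measure.prod_restrict]
    refine ContinuousOn.aestronglyMeasurable ?_ (measurableSet_Ioi.prod measurableSet_Ioi)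
    have hpt : Continuous fun p : ℝ × ℝ => (p.2 : ℂ) * Complex.exp (β * Complex.I) := by fun_prop
    have c1 : ContinuousOn (fun p : ℝ × ℝ => ψ (p.1 * ((p.2 : ℂ) * Complex.exp (β * Complex.I))))
        (Ioi 0 ×ˢ Ioi 0) :=
      hψ.1.continuousOn.comp (by fun_prop) fun p hp =>
        smul_mem_sector hp.1 (h.ray_mem hp.2 hβ)
    have c2 : ContinuousOn
        (fun p : ℝ × ℝ => resolvent A ((p.2 : ℂ) * Complex.exp (β * Complex.I)))
        (Ioi 0 ×ˢ Ioi 0) :=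
      (h.continuousOn_resolvent_ray hβ).comp continuous_snd.continuousOn fun p hp => hp.2
    have c0 : ContinuousOn (fun p : ℝ × ℝ => ((p.2 : ℂ) * Complex.exp (β * Complex.I)) ^ 2
        * Complex.exp (-(((t + c * p.1 : ℝ) : ℂ) * ((p.2 : ℂ) * Complex.exp (β * Complex.I)))))
        (Ioi 0 ×ˢ Ioi 0) := by fun_prop
    exact (continuousOn_const (c := Complex.exp (β * Complex.I))).smul ((c0.mul c1).smul c2)
  · rw [Measure.prod_restrict]
    filter_upwards [ae_restrict_mem (measurableSet_Ioi.prod measurableSet_Ioi)] with p hp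
    obtain ⟨s, r⟩ := p
    obtain ⟨hs, hr⟩ := hp
    have hs' : 0 < s := hs
    have hr' : 0 < r := hr
    have h1 := h.norm_sq_mul_exp_le (t := t + c * s) (by positivity) hr' hβ
    have h2 := hb _ (smul_mem_sector hs' (h.ray_mem hr' hβ))
    have h4 : ‖resolvent A (r * Complex.exp (β * Complex.I))‖ ≤ r⁻¹ * M := by
      rw [← div_eq_inv_mul, le_div_iff₀ hr', mul_comm]
      exact h.norm_resolvent_ray hr' hβ
    simp only [reproKernel]
    rw [norm_smul, Complex.norm_exp_ofReal_mul_I, one_mul, norm_smul, norm_mul]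
    calc _ ≤ (r ^ 2 * Real.exp (-((t + c * s) * Real.cos ω * r))) * C * (r⁻¹ * M) := by gcongr
      _ = _ := by
        have : -((t + c * s) * Real.cos ω * r)
            = -(t * Real.cos ω * r) + -(c * Real.cos ω * r) * s := by ring
        rw [this, Real.exp_add]
        field_simp

lemma CalcSetup.integral_reproKernel (h : CalcSetup A θ M ν ω) (hψ : MemHInftyZero ω ψ)
    {t c : ℝ} (ht : 0 < t) (hc : 0 < c) {β : ℝ} (hβ : |β| = ν) :
    ∫ s in Ioi (0 : ℝ), ∫ r in Ioi (0 : ℝ), reproKernel A ψ t c β (s, r)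
      = (∫ s in Ioi (0 : ℝ), ψ s * Complex.exp (-(c * s)))
        • rayInt (fun z => (z * Complex.exp (-(t * z))) • resolvent A z) β := by
  rw [integral_integral_swap (f := fun s r => reproKernel A ψ t c β (s, r))
    (h.integrable_reproKernel hψ ht hc hβ), rayInt, ← integral_smul]
  refine setIntegral_congr_fun measurableSet_Ioi fun r hr => ?_
  have h1 := h.integral_ray_eq_laplace hψ hc hr hβ
  rw [← h1, smul_comm _ (Complex.exp (β * Complex.I)), smul_smul _ (_ * _), ← integral_mul_const]
  have h2 := integral_smul_const (μ := volume.restrict (Ioi (0 : ℝ))) (fun a : ℝ =>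
    (r : ℂ) * Complex.exp (β * Complex.I) * (ψ (a * (r * Complex.exp (β * Complex.I)))
      * Complex.exp (-(c * (a * (r * Complex.exp (β * Complex.I)))))) *
      (r * Complex.exp (β * Complex.I) * Complex.exp (-(t * (r * Complex.exp (β * Complex.I))))))
    (resolvent A (r * Complex.exp (β * Complex.I)))
  refine Eq.trans ?_ (congrArg _ h2)
  rw [← integral_smul]
  refine setIntegral_congr_fun measurableSet_Ioi fun s _ => ?_
  simp only [reproKernel]
  congr 2
  have : (-(((t + c * s : ℝ) : ℂ) * ((r : ℂ) * Complex.exp (β * Complex.I))))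
      = -(c * (s * (r * Complex.exp (β * Complex.I))))
        + -(t * ((r : ℂ) * Complex.exp (β * Complex.I))) := by push_cast; ring
  rw [this, Complex.exp_add]
  ring

/-- The reproducing formula: `∫₀^∞ A² e^{-(t+cs)A} ψ(sA) ds = κ A e^{-tA}` where
`κ = ∫₀^∞ ψ(s) e^{-cs} ds`. -/
lemma SemigroupData.reproducing (hT : SemigroupData A T N) (h : CalcSetup A θ M ν ω)
    (hψ : MemHInftyZero ω ψ) {t c : ℝ} (ht : 0 < t) (hc : 0 < c) :
    IntegrableOn (fun s : ℝ => genSqExp A ν (t + c * s) * calculus A ν (fun z => ψ (s * z))) (Ioi 0) ∧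
    ∫ s in Ioi (0 : ℝ), genSqExp A ν (t + c * s) * calculus A ν (fun z => ψ (s * z))
      = (∫ s in Ioi (0 : ℝ), ψ s * Complex.exp (-(c * s))) • genExp A ν t := by
  have e : ∀ s ∈ Ioi (0 : ℝ), genSqExp A ν (t + c * s) * calculus A ν (fun z => ψ (s * z))
      = (2 * Real.pi * Complex.I)⁻¹ • ((∫ r in Ioi (0 : ℝ), reproKernel A ψ t c (-ν) (s, r))
        - ∫ r in Ioi (0 : ℝ), reproKernel A ψ t c ν (s, r)) := by
    intro s hs
    have hs' : 0 < s := hs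
    rw [hT.genSqExp_mul_calculus h (by positivity) (hψ.scale hs'), calculus_eq_contour]
    rfl
  have hν' : |(-ν)| = ν := by rw [abs_neg, h.abs_nu]
  have i1 := (h.integrable_reproKernel hψ ht hc hν').integral_prod_left
  have i2 := (h.integrable_reproKernel hψ ht hc h.abs_nu).integral_prod_left
  constructor
  · exact IntegrableOn.congr_fun ((i1.sub i2).smul (2 * Real.pi * Complex.I : ℂ)⁻¹)
      (fun s hs => (e s hs).symm) measurableSet_Ioi
  · rw [setIntegral_congr_fun measurableSet_Ioi e, integral_smul, integral_sub i1 i2,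
      h.integral_reproKernel hψ ht hc hν', h.integral_reproKernel hψ ht hc h.abs_nu, genExp,
      calculus_eq_contour, contour, ← smul_sub, smul_comm]

/-! ### The norm of `X` -/

/-- `∫₀^∞ ‖t⁻¹ ψ(tA) x‖ dt` as an extended nonnegative number. -/
def orbitNorm (A : E →ₗ.[ℂ] E) (ν : ℝ) (ψ : ℂ → ℂ) (x : E) : ℝ≥0∞ :=
  ∫⁻ r in Ioi (0 : ℝ), ‖orbit A ν ψ x r‖ₑ

omit [CompleteSpace E] in
lemma CalcSetup.orbit_eq (h : CalcSetup A θ M ν ω) {r : ℝ} (hr : 0 < r) (x : E) :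
    orbit A ν ψ x r = r⁻¹ • calculus A ν (fun z => ψ (r * z)) x := by
  rw [orbit, h.calculus_smul ψ hr]

omit [CompleteSpace E] in
lemma CalcSetup.enorm_orbit (h : CalcSetup A θ M ν ω) {r : ℝ} (hr : 0 < r) (x : E) :
    ‖orbit A ν ψ x r‖ₑ = ENNReal.ofReal r⁻¹ * ‖calculus A ν (fun z => ψ (r * z)) x‖ₑ := by
  rw [h.orbit_eq hr, enorm_smul, Real.enorm_of_nonneg (inv_nonneg.2 hr.le)]

lemma CalcSetup.continuousOn_scale_apply (h : CalcSetup A θ M ν ω) (hψ : MemHInftyZero ω ψ)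
    (x : E) : ContinuousOn (fun r : ℝ => calculus A ν (fun z => ψ (r * z)) x) (Ioi 0) :=
  (h.continuousOn_scale hψ).clm_apply continuousOn_const

lemma CalcSetup.aestronglyMeasurable_orbit (h : CalcSetup A θ M ν ω) (hψ : MemHInftyZero ω ψ)
    (x : E) : AEStronglyMeasurable (orbit A ν ψ x) (volume.restrict (Ioi 0)) := by
  have h1 : ContinuousOn (orbit A ν ψ x) (Ioi 0) := by
    refine ContinuousOn.congr (f := fun r : ℝ => r⁻¹ • calculus A ν (fun z => ψ (r * z)) x) ?_
      fun r hr => h.orbit_eq hr x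
    exact (continuousOn_inv₀.mono fun r hr => ne_of_gt hr).smul (h.continuousOn_scale_apply hψ x)
  exact h1.aestronglyMeasurable measurableSet_Ioi

lemma CalcSetup.mem_optSubmodule_iff (h : CalcSetup A θ M ν ω) (hψ : MemHInftyZero ω ψ) (x : E) :
    x ∈ optSubmodule A ν ψ ↔ orbitNorm A ν ψ x < ∞ :=
  ⟨fun hx => hx.2, fun hx => ⟨h.aestronglyMeasurable_orbit hψ x, hx⟩⟩

omit [CompleteSpace E] in
lemma enorm_optSpace (x : OptSpace A ν ψ) : ‖x‖ₑ = ‖x.1‖ₑ + orbitNorm A ν ψ x.1 := by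
  have hx : IntegrableOn (orbit A ν ψ x.1) (Ioi 0) := x.2
  rw [← ofReal_norm]
  change ENNReal.ofReal (‖x.1‖ + ∫ t in Ioi (0 : ℝ), ‖orbit A ν ψ x.1 t‖) = _
  rw [ENNReal.ofReal_add (norm_nonneg _) (integral_nonneg fun _ => norm_nonneg _), ofReal_norm,
    ofReal_integral_norm_eq_lintegral_enorm hx]
  rfl

lemma lintegral_inv_add_sq {a : ℝ} (ha : 0 < a) :
    ∫⁻ t in Ioi (0 : ℝ), ENNReal.ofReal (((t + a) ^ 2)⁻¹) = ENNReal.ofReal a⁻¹ := by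
  have hd : ∀ t ∈ Ici (0 : ℝ), HasDerivAt (fun t : ℝ => -(t + a)⁻¹) (((t + a) ^ 2)⁻¹) t := by
    intro t ht
    have ht' : 0 ≤ t := ht
    have h1 := (((hasDerivAt_id t).add_const a).fun_inv (by simp only [id]; positivity)).fun_neg
    refine h1.congr_deriv ?_
    simp only [id]
    rw [neg_div, neg_neg, one_div]
  have hlim : Tendsto (fun t : ℝ => -(t + a)⁻¹) atTop (𝓝 0) := by
    have := (tendsto_inv_atTop_zero.comp (tendsto_atTop_add_const_right atTop a tendsto_id)).neg
    simpa using this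
  have hpos : ∀ t ∈ Ioi (0 : ℝ), 0 ≤ ((t + a) ^ 2)⁻¹ := fun t _ => by positivity
  have h1 := integral_Ioi_of_hasDerivAt_of_nonneg' hd hpos hlim
  have h2 := integrableOn_Ioi_deriv_of_nonneg' hd hpos hlim
  rw [← ofReal_integral_eq_lintegral_ofReal h2 (by
    filter_upwards [ae_restrict_mem measurableSet_Ioi] with t ht
    exact hpos t ht), h1]
  simp

lemma CalcSetup.calculus_scale_apply_genSqExp (h : CalcSetup A θ M ν ω)
    (hψ : MemHInftyZero ω ψ) {r τ : ℝ} (hr : 0 < r) (hτ : 0 < τ) :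
    calculus A ν (fun z => ψ (r * z)) * genSqExp A ν τ
      = genSqExp A ν τ * calculus A ν (fun z => ψ (r * z)) :=
  h.calculus_comm (hψ.scale hr) (memHInftyZero_sq_mul_exp h.omega_pos h.lt_half_pi hτ)

/-- The smoothing of A² e^{-τA} from the ambient space into X: the embedding estimate for φ = z²
e^{-τz}, whose integral against dr/r scales like τ⁻². -/
lemma SemigroupData.lintegral_genSqExp_scale_le (hT : SemigroupData A T N)
    (h : CalcSetup A θ M ν ω) (hψ : MemHInftyZero ω ψ) :
    ∃ K : ℝ, 0 ≤ K ∧ ∀ τ, 0 < τ →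
      ∫⁻ r in Ioi (0 : ℝ), ENNReal.ofReal r⁻¹ *
        ‖calculus A ν (fun z => ψ (r * z)) * genSqExp A ν τ‖ₑ
        ≤ ENNReal.ofReal K * ENNReal.ofReal ((τ ^ 2)⁻¹) := by
  obtain ⟨K, hK, hb⟩ := h.lintegral_enorm_calculus_scale_le hψ
  have hc := h.cos_pos
  refine ⟨K * ((Real.cos ω) ^ 2)⁻¹, by positivity, fun τ hτ => ?_⟩
  have h1 := hb (fun z => z ^ 2 * Complex.exp (-(τ * z)))
    (fun r => r ^ 2 * Real.exp (-(τ * Real.cos ω * r))) (by fun_prop)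
    (fun r hr β hβ => h.norm_sq_mul_exp_le hτ hr hβ)
  rw [lintegral_sq_mul_exp hc hτ, ← mul_assoc, ← ENNReal.ofReal_mul hK] at h1
  refine le_trans (le_of_eq ?_) h1
  refine setLIntegral_congr_fun measurableSet_Ioi fun r hr => ?_
  have hr' : 0 < r := hr
  rw [h.calculus_scale_apply_genSqExp hψ hr' hτ, hT.genSqExp_mul_calculus h hτ (hψ.scale hr')]

/-- Pointwise control of `A T(t) x` in the norm of `X`. -/
lemma SemigroupData.genExp_pointwise (hT : SemigroupData A T N) (h : CalcSetup A θ M ν ω)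
    (hψ : MemHInftyZero ω ψ) (hψ0 : ∃ z ∈ sector ω, ψ z ≠ 0) :
    ∃ K c : ℝ, 0 ≤ K ∧ 0 < c ∧ ∀ (x : E) (t : ℝ), 0 < t →
      ‖genExp A ν t x‖ₑ + orbitNorm A ν ψ (genExp A ν t x)
        ≤ ENNReal.ofReal K * ∫⁻ s in Ioi (0 : ℝ), ENNReal.ofReal (((t + c * s) ^ 2)⁻¹)
          * ‖calculus A ν (fun z => ψ (s * z)) x‖ₑ := by
  obtain ⟨c, hc, hκ⟩ := hψ.exists_laplace_ne_zero h.omega_pos h.omega_le_pi hψ0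
  obtain ⟨K₁, hK₁, hb₁⟩ := h.enorm_genSqExp_le
  obtain ⟨K₂, hK₂, hb₂⟩ := hT.lintegral_genSqExp_scale_le h hψ
  set κ := ∫ s in Ioi (0 : ℝ), ψ s * Complex.exp (-(c * s)) with hκdef
  refine ⟨‖κ⁻¹‖ * (K₁ + K₂), c, by positivity, hc, fun x t ht => ?_⟩
  obtain ⟨hi, hrep⟩ := hT.reproducing h hψ ht hc
  -- The operator B is left free so that one formula serves twice: B = 1 for the ambient norm, B =
  -- ψ(rA) for the integral part of the norm of X.
  have hgen : ∀ B : E →L[ℂ] E, B (genExp A ν t x)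
      = κ⁻¹ • ∫ s in Ioi (0 : ℝ), (B * genSqExp A ν (t + c * s))
          (calculus A ν (fun z => ψ (s * z)) x) := by
    intro B
    have h1 : genExp A ν t = κ⁻¹ • ∫ s in Ioi (0 : ℝ), genSqExp A ν (t + c * s) *
        calculus A ν (fun z => ψ (s * z)) := by
      rw [hrep, inv_smul_smul₀ hκ]
    have h2 := (B ∘L ContinuousLinearMap.apply ℂ E x).integral_comp_comm hi
    rw [h1, smul_apply, map_smul]
    congr 1
    exact h2.symm
  have hgen' : ∀ B : E →L[ℂ] E, ‖B (genExp A ν t x)‖ₑ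
      ≤ ‖κ⁻¹‖ₑ * ∫⁻ s in Ioi (0 : ℝ), ‖B * genSqExp A ν (t + c * s)‖ₑ
          * ‖calculus A ν (fun z => ψ (s * z)) x‖ₑ := by
    intro B
    rw [hgen B, enorm_smul]
    gcongr
    refine (enorm_integral_le_lintegral_enorm _).trans (lintegral_mono fun s => ?_)
    exact ContinuousLinearMap.le_opENorm _ _
  have e1 : ‖genExp A ν t x‖ₑ ≤ ‖κ⁻¹‖ₑ * (ENNReal.ofReal K₁ *
      ∫⁻ s in Ioi (0 : ℝ), ENNReal.ofReal (((t + c * s) ^ 2)⁻¹)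
          * ‖calculus A ν (fun z => ψ (s * z)) x‖ₑ) := by
    have := hgen' 1
    rw [one_apply_eq_self] at this
    refine this.trans ?_
    rw [← lintegral_const_mul' _ _ ENNReal.ofReal_ne_top]
    refine mul_le_mul' le_rfl (setLIntegral_mono' (measurableSet_Ioi (a := (0 : ℝ)))
      fun s hs => ?_)
    have hs' : 0 < s := hs
    rw [one_mul, ← mul_assoc]
    gcongr
    exact hb₁ _ (by positivity)
  have e2 : orbitNorm A ν ψ (genExp A ν t x) ≤ ‖κ⁻¹‖ₑ * (ENNReal.ofReal K₂ *
      ∫⁻ s in Ioi (0 : ℝ), ENNReal.ofReal (((t + c * s) ^ 2)⁻¹)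
          * ‖calculus A ν (fun z => ψ (s * z)) x‖ₑ) := by
    have hmeas : AEMeasurable (fun p : ℝ × ℝ => ENNReal.ofReal p.1⁻¹ *
        (‖calculus A ν (fun z => ψ (p.1 * z)) * genSqExp A ν (t + c * p.2)‖ₑ
          * ‖calculus A ν (fun z => ψ (p.2 * z)) x‖ₑ))
        ((volume.restrict (Ioi (0 : ℝ))).prod (volume.restrict (Ioi (0 : ℝ)))) := by
      rw [Measure.prod_restrict]
      have hm := measurableSet_Ioi (a := (0 : ℝ)).prod (measurableSet_Ioi (a := (0 : ℝ)))
      have c1 : ContinuousOn (fun p : ℝ × ℝ => calculus A ν (fun z => ψ (p.1 * z)) *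
          genSqExp A ν (t + c * p.2)) (Ioi 0 ×ˢ Ioi 0) :=
        ((h.continuousOn_scale hψ).comp continuous_fst.continuousOn fun p hp => hp.1).mul
          (h.continuousOn_genSqExp.comp (by fun_prop) fun p hp => by
            have h1 : (0 : ℝ) < p.2 := hp.2
            exact mem_Ioi.2 (by positivity))
      have c2 : ContinuousOn (fun p : ℝ × ℝ => calculus A ν (fun z => ψ (p.2 * z)) x)
          (Ioi 0 ×ˢ Ioi 0) :=
        (h.continuousOn_scale_apply hψ x).comp continuous_snd.continuousOn fun p hp => hp.2
      have m1 : Measurable fun p : ℝ × ℝ => ENNReal.ofReal p.1⁻¹ := by fun_prop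
      exact m1.aemeasurable.mul ((c1.aestronglyMeasurable hm).enorm.mul
        (c2.aestronglyMeasurable hm).enorm)
    calc orbitNorm A ν ψ (genExp A ν t x)
        ≤ ∫⁻ r in Ioi (0 : ℝ), ∫⁻ s in Ioi (0 : ℝ), ‖κ⁻¹‖ₑ * (ENNReal.ofReal r⁻¹ *
          (‖calculus A ν (fun z => ψ (r * z)) * genSqExp A ν (t + c * s)‖ₑ
            * ‖calculus A ν (fun z => ψ (s * z)) x‖ₑ)) := by
          refine setLIntegral_mono' measurableSet_Ioi fun r hr => ?_
          rw [h.enorm_orbit hr, lintegral_const_mul' _ _ enorm_ne_top,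
            lintegral_const_mul' _ _ ENNReal.ofReal_ne_top, mul_left_comm]
          gcongr
          exact hgen' _
      _ = ‖κ⁻¹‖ₑ * ∫⁻ s in Ioi (0 : ℝ), ∫⁻ r in Ioi (0 : ℝ), (ENNReal.ofReal r⁻¹ *
          (‖calculus A ν (fun z => ψ (r * z)) * genSqExp A ν (t + c * s)‖ₑ
            * ‖calculus A ν (fun z => ψ (s * z)) x‖ₑ)) := by
          rw [← lintegral_lintegral_swap (f := fun r s => ENNReal.ofReal r⁻¹ *
            (‖calculus A ν (fun z => ψ (r * z)) * genSqExp A ν (t + c * s)‖ₑ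
              * ‖calculus A ν (fun z => ψ (s * z)) x‖ₑ)) hmeas,
            ← lintegral_const_mul' _ _ enorm_ne_top]
          refine lintegral_congr fun r => ?_
          rw [lintegral_const_mul' _ _ enorm_ne_top]
      _ ≤ _ := by
          rw [← lintegral_const_mul' _ _ ENNReal.ofReal_ne_top]
          refine mul_le_mul' le_rfl (setLIntegral_mono' (measurableSet_Ioi (a := (0 : ℝ)))
            fun s hs => ?_)
          have hs' : 0 < s := hs
          simp only [← mul_assoc]
          rw [lintegral_mul_const' _ _ enorm_ne_top]
          gcongr
          exact hb₂ _ (by positivity)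
  rw [ENNReal.ofReal_mul (norm_nonneg _), ENNReal.ofReal_add hK₁ hK₂, ofReal_norm]
  refine (add_le_add e1 e2).trans (le_of_eq ?_)
  ring

/-- `∫₀^∞ ‖A T(t) x‖_X dt ≤ K ∫₀^∞ ‖t⁻¹ ψ(tA) x‖ dt`. -/
lemma SemigroupData.lintegral_genExp_le (hT : SemigroupData A T N) (h : CalcSetup A θ M ν ω)
    (hψ : MemHInftyZero ω ψ) (hψ0 : ∃ z ∈ sector ω, ψ z ≠ 0) :
    ∃ K : ℝ, 0 ≤ K ∧ ∀ x : E, ∫⁻ t in Ioi (0 : ℝ),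
      (‖genExp A ν t x‖ₑ + orbitNorm A ν ψ (genExp A ν t x))
        ≤ ENNReal.ofReal K * orbitNorm A ν ψ x := by
  obtain ⟨K, c, hK, hc, hb⟩ := hT.genExp_pointwise h hψ hψ0
  refine ⟨K * c⁻¹, by positivity, fun x => ?_⟩
  have hmeas : AEMeasurable (fun p : ℝ × ℝ => ENNReal.ofReal (((p.1 + c * p.2) ^ 2)⁻¹)
        * ‖calculus A ν (fun z => ψ (p.2 * z)) x‖ₑ)
      ((volume.restrict (Ioi (0 : ℝ))).prod (volume.restrict (Ioi (0 : ℝ)))) := by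
    rw [Measure.prod_restrict]
    have c2 : ContinuousOn (fun p : ℝ × ℝ => calculus A ν (fun z => ψ (p.2 * z)) x)
        (Ioi 0 ×ˢ Ioi 0) :=
      (h.continuousOn_scale_apply hψ x).comp continuous_snd.continuousOn fun p hp => hp.2
    have m1 : Measurable fun p : ℝ × ℝ => ENNReal.ofReal (((p.1 + c * p.2) ^ 2)⁻¹) := by fun_prop
    exact m1.aemeasurable.mul
      (c2.aestronglyMeasurable (measurableSet_Ioi.prod measurableSet_Ioi)).enorm
  calc _ ≤ ∫⁻ t in Ioi (0 : ℝ), ENNReal.ofReal K * ∫⁻ s in Ioi (0 : ℝ),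
        ENNReal.ofReal (((t + c * s) ^ 2)⁻¹) * ‖calculus A ν (fun z => ψ (s * z)) x‖ₑ :=
        setLIntegral_mono' measurableSet_Ioi fun t ht => hb x t ht
    _ = ENNReal.ofReal K * ∫⁻ s in Ioi (0 : ℝ), ∫⁻ t in Ioi (0 : ℝ),
        ENNReal.ofReal (((t + c * s) ^ 2)⁻¹) * ‖calculus A ν (fun z => ψ (s * z)) x‖ₑ := by
        rw [lintegral_const_mul' _ _ ENNReal.ofReal_ne_top, lintegral_lintegral_swap hmeas]
    _ = _ := by
        rw [ENNReal.ofReal_mul hK, mul_assoc, orbitNorm]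
        congr 1
        rw [← lintegral_const_mul' _ _ ENNReal.ofReal_ne_top]
        refine setLIntegral_congr_fun (measurableSet_Ioi (a := (0 : ℝ))) fun s hs => ?_
        have hs' : 0 < s := hs
        -- Integrating (t + cs)⁻² in t gives (cs)⁻¹, and s⁻¹‖ψ(sA)x‖ is the integrand of the norm of
        -- X.
        rw [lintegral_mul_const' _ _ enorm_ne_top, lintegral_inv_add_sq (by positivity),
          h.enorm_orbit hs', ← mul_assoc, ← ENNReal.ofReal_mul (by positivity), mul_inv]

end Reproducing

end

section

/-! ### Completeness of `X`, closedness of its operator, density -/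

open Filter Topology ENNReal

section Complete

variable {E : Type*} [NormedAddCommGroup E] [NormedSpace ℂ E]
  {A : E →ₗ.[ℂ] E} {θ M ν ω : ℝ} {ψ : ℂ → ℂ}

/-- The inclusion of `X` into the ambient space. -/
def optIncl (A : E →ₗ.[ℂ] E) (ν : ℝ) (ψ : ℂ → ℂ) : OptSpace A ν ψ →L[ℂ] E :=
  LinearMap.mkContinuous (optSubmodule A ν ψ).subtype 1 fun x => by
    rw [one_mul]
    exact le_add_of_nonneg_right (integral_nonneg fun _ => norm_nonneg _)

lemma optIncl_injective : Function.Injective (optIncl A ν ψ) := Subtype.val_injective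

lemma CalcSetup.mem_graph_optPart_iff (h : CalcSetup A θ M ν ω) (x y : OptSpace A ν ψ) :
    (∃ hx : x ∈ (optPart A ν ψ).domain, optPart A ν ψ ⟨x, hx⟩ = y) ↔
      oneAddInv A (optIncl A ν ψ x + optIncl A ν ψ y) = optIncl A ν ψ x := by
  rw [← h.mem_graph_iff]
  constructor
  · rintro ⟨hx, rfl⟩
    exact ⟨hx.choose, rfl⟩
  · rintro ⟨hx, hxy⟩
    have hx' : x ∈ (optPart A ν ψ).domain := by
      refine ⟨hx, ?_⟩
      have h1 : optIncl A ν ψ y ∈ optSubmodule A ν ψ := y.2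
      rw [← hxy] at h1
      exact h1
    exact ⟨hx', Subtype.ext hxy⟩

/-- The graph is the equalizer of two continuous maps into the ambient space, by the graph criterion
and continuity of the inclusion of X. -/
lemma CalcSetup.isClosed_optPart (h : CalcSetup A θ M ν ω) : (optPart A ν ψ).IsClosed := by
  have e : ((optPart A ν ψ).graph : Set (OptSpace A ν ψ × OptSpace A ν ψ))
      = {p | oneAddInv A (optIncl A ν ψ p.1 + optIncl A ν ψ p.2) = optIncl A ν ψ p.1} := by
    ext ⟨x, y⟩
    rw [SetLike.mem_coe, LinearPMap.mem_graph_iff, mem_ofPred_eq, ← h.mem_graph_optPart_iff]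
    constructor
    · rintro ⟨x', h1, h2⟩
      obtain ⟨x', hx'⟩ := x'
      obtain rfl : x' = x := h1
      exact ⟨hx', h2⟩
    · rintro ⟨hx, hy⟩
      exact ⟨⟨x, hx⟩, rfl, hy⟩
  rw [LinearPMap.IsClosed, e]
  exact isClosed_eq (by fun_prop) (by fun_prop)

variable [CompleteSpace E]

/-- Fatou's lemma: each ψ(tA) is bounded, so the integrands converge pointwise. The integral part of
the norm of X is thus lower semicontinuous for the ambient norm. -/
lemma CalcSetup.orbitNorm_le_of_tendsto (h : CalcSetup A θ M ν ω) (hψ : MemHInftyZero ω ψ)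
    {y : ℕ → E} {x : E} (hy : Tendsto y atTop (𝓝 x)) {C : ℝ≥0∞}
    (hC : ∀ᶠ m in atTop, orbitNorm A ν ψ (y m) ≤ C) : orbitNorm A ν ψ x ≤ C := by
  have h1 : ∀ t, liminf (fun m => ‖orbit A ν ψ (y m) t‖ₑ) atTop = ‖orbit A ν ψ x t‖ₑ := by
    intro t
    refine Tendsto.liminf_eq ?_
    exact (((calculus ((t : ℂ) • A) ν ψ).continuous.tendsto x).comp hy).const_smul _ |>.enorm
  calc orbitNorm A ν ψ x
      = ∫⁻ t in Ioi (0 : ℝ), liminf (fun m => ‖orbit A ν ψ (y m) t‖ₑ) atTop := by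
        simp only [h1, orbitNorm]
    _ ≤ liminf (fun m => ∫⁻ t in Ioi (0 : ℝ), ‖orbit A ν ψ (y m) t‖ₑ) atTop :=
        lintegral_liminf_le' fun m => (h.aestronglyMeasurable_orbit hψ (y m)).enorm
    _ ≤ C := by
        refine liminf_le_of_frequently_le' (Eventually.frequently ?_)
        exact hC

/-- A Cauchy sequence in X converges in the ambient space. Lower semicontinuity applied to u n - u m
as m → ∞ puts the limit in X and gives convergence there. -/
lemma CalcSetup.completeSpace_optSpace (h : CalcSetup A θ M ν ω) (hψ : MemHInftyZero ω ψ) :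
    CompleteSpace (OptSpace A ν ψ) := by
  refine Metric.complete_of_cauchySeq_tendsto fun u hu => ?_
  obtain ⟨x, hx⟩ := cauchySeq_tendsto_of_complete
    ((optIncl A ν ψ).uniformContinuous.comp_cauchySeq hu)
  have key : ∀ ε : ℝ, 0 < ε → ∃ n₀, ∀ n ≥ n₀,
      orbitNorm A ν ψ (optIncl A ν ψ (u n) - x) ≤ ENNReal.ofReal ε := by
    intro ε hε
    obtain ⟨n₀, hn₀⟩ := Metric.cauchySeq_iff.1 hu ε hε
    refine ⟨n₀, fun n hn => ?_⟩
    refine h.orbitNorm_le_of_tendsto hψ (hx.const_sub _) ?_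
    filter_upwards [eventually_ge_atTop n₀] with m hm
    have h1 := hn₀ n hn m hm
    rw [dist_eq_norm] at h1
    have h2 := enorm_optSpace (u n - u m)
    calc orbitNorm A ν ψ (optIncl A ν ψ (u n) - optIncl A ν ψ (u m)) ≤ ‖u n - u m‖ₑ := by
          rw [h2]; exact le_add_self
      _ ≤ ENNReal.ofReal ε := by
          rw [← ofReal_norm]; exact ENNReal.ofReal_le_ofReal h1.le
  have hmem : x ∈ optSubmodule A ν ψ := by
    obtain ⟨n₀, hn₀⟩ := key 1 one_pos
    have h1 : optIncl A ν ψ (u n₀) - x ∈ optSubmodule A ν ψ :=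
      (h.mem_optSubmodule_iff hψ _).2 ((hn₀ n₀ le_rfl).trans_lt ENNReal.ofReal_lt_top)
    have h2 : optIncl A ν ψ (u n₀) ∈ optSubmodule A ν ψ := (u n₀).2
    have h3 := Submodule.sub_mem _ h2 h1
    have h4 := sub_sub_cancel (optIncl A ν ψ (u n₀)) x
    exact h4 ▸ h3
  let x' : OptSpace A ν ψ := ⟨x, hmem⟩
  refine ⟨x', Metric.tendsto_atTop.2 fun ε hε => ?_⟩
  obtain ⟨n₀, hn₀⟩ := key (ε / 3) (by positivity)
  obtain ⟨n₁, hn₁⟩ := Metric.tendsto_atTop.1 hx (ε / 3) (by positivity)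
  refine ⟨max n₀ n₁, fun n hn => ?_⟩
  have h1 := hn₀ n (le_of_max_le_left hn)
  have h2 := hn₁ n (le_of_max_le_right hn)
  have h3 := enorm_optSpace (u n - x')
  rw [dist_eq_norm] at h2 ⊢
  have h4 : ‖u n - x'‖ₑ ≤ ENNReal.ofReal (ε / 3 + ε / 3) := by
    rw [h3, ENNReal.ofReal_add (by positivity) (by positivity)]
    refine add_le_add ?_ h1
    change ‖optIncl A ν ψ (u n) - x‖ₑ ≤ _
    rw [← ofReal_norm]
    exact ENNReal.ofReal_le_ofReal h2.le
  rw [← ofReal_norm, ENNReal.ofReal_le_ofReal_iff (by positivity)] at h4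
  linarith

/-- `A (1 + A)⁻² φ(A) = (z (1 + z)⁻² φ)(A)`. -/
lemma CalcSetup.sub_sq_mul_calculus (h : CalcSetup A θ M ν ω) {φ : ℂ → ℂ}
    (hφ : MemHInftyZero ω φ) :
    (oneAddInv A - oneAddInv A * oneAddInv A) * calculus A ν φ
      = calculus A ν (fun z => (z * (1 + z)⁻¹ * (1 + z)⁻¹) * φ z) := by
  have h1 := hφ.mul_inv_one_add h.lt_half_pi
  have h2 := h1.mul_inv_one_add h.lt_half_pi
  have h3 := (memHInftyZero_id_mul_inv_sq h.lt_half_pi).mul hφ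
  rw [sub_mul, mul_assoc, h.oneAddInv_mul_calculus hφ, h.oneAddInv_mul_calculus h1, sub_eq_iff_eq_add,
    ← h.calculus_add h3 h2]
  refine h.calculus_congr fun z hz => ?_
  have h4 : 1 + z ≠ 0 := by
    rw [← norm_pos_iff]; exact one_pos.trans_le (one_add_norm_bounds h.lt_half_pi hz).1
  field_simp
  ring

/-- The operator is A(1 + A)⁻², with symbol z(1 + z)⁻². On the rays the symbol is at most min(r,
1/r), integrable for dr/r, so the embedding estimate applies. -/
lemma CalcSetup.apply_sub_sq_mem (h : CalcSetup A θ M ν ω) (hψ : MemHInftyZero ω ψ) (v : E) :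
    (oneAddInv A - oneAddInv A * oneAddInv A) v ∈ optSubmodule A ν ψ := by
  rw [h.mem_optSubmodule_iff hψ]
  obtain ⟨K, hK, hb⟩ := h.lintegral_enorm_calculus_scale_le hψ
  have h1 := hb (fun z => z * (1 + z)⁻¹ * (1 + z)⁻¹) (fun r => min r r⁻¹) (by fun_prop)
    fun r hr β hβ => by
      obtain ⟨b1, b2⟩ := one_add_norm_bounds h.lt_half_pi (h.ray_mem hr hβ)
      have b3 := norm_ray_point hr β
      rw [b3] at b2
      rw [norm_mul, norm_mul, norm_inv, b3]
      set p := ‖1 + (r : ℂ) * Complex.exp (β * Complex.I)‖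
      have hp : 0 < p := by linarith
      have b4 : p⁻¹ ≤ 1 := inv_le_one_of_one_le₀ b1
      have b5 : p⁻¹ ≤ r⁻¹ := inv_anti₀ hr b2
      have b6 : 0 ≤ p⁻¹ := by positivity
      refine le_min ?_ ?_
      · calc r * p⁻¹ * p⁻¹ ≤ r * 1 * 1 := by gcongr
          _ = r := by ring
      · calc r * p⁻¹ * p⁻¹ ≤ r * r⁻¹ * r⁻¹ := by gcongr
          _ = r⁻¹ := by field_simp
  have hfin : ∫⁻ r in Ioi (0 : ℝ), ENNReal.ofReal (min r r⁻¹ * r⁻¹) < ∞ := by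
    have h2 := (integrableOn_min_rpow one_pos).congr_fun
      (g := fun r : ℝ => min r r⁻¹ * r⁻¹)
      (fun r hr => by simp only [Real.rpow_one, Real.rpow_neg_one, mul_comm]) measurableSet_Ioi
    have h3 := h2.2
    refine lt_of_le_of_lt (lintegral_mono fun r => ?_) h3
    rw [← ofReal_norm]
    exact ENNReal.ofReal_le_ofReal (le_abs_self _)
  refine lt_of_le_of_lt ?_ (ENNReal.mul_lt_top (h1.trans_lt
    (ENNReal.mul_lt_top ENNReal.ofReal_lt_top hfin)) (enorm_lt_top (x := v)))
  rw [orbitNorm, ← lintegral_mul_const' _ _ enorm_ne_top]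
  refine setLIntegral_mono' measurableSet_Ioi fun r hr => ?_
  have hr' : 0 < r := hr
  have hc := h.oneAddInv_comm (hψ.scale hr')
  have h2 : calculus A ν (fun z => ψ (r * z)) ((oneAddInv A - oneAddInv A * oneAddInv A) v)
      = calculus A ν (fun z => z * (1 + z)⁻¹ * (1 + z)⁻¹ * ψ (r * z)) v := by
    rw [← h.sub_sq_mul_calculus (hψ.scale hr')]
    have h3 : calculus A ν (fun z => ψ (r * z)) * (oneAddInv A - oneAddInv A * oneAddInv A)
        = (oneAddInv A - oneAddInv A * oneAddInv A) * calculus A ν (fun z => ψ (r * z)) := by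
      rw [mul_sub, sub_mul, ← mul_assoc, ← hc, mul_assoc, ← hc, mul_assoc]
    rw [← h3]
    rfl
  rw [h.enorm_orbit hr', h2, mul_assoc]
  gcongr
  exact ContinuousLinearMap.le_opENorm _ _

/-- If x = Ay lies in D(A), then x = A(1 + A)⁻² v with v = (1 + A)² y. -/
lemma CalcSetup.domain_inf_range_le (h : CalcSetup A θ M ν ω) (hψ : MemHInftyZero ω ψ) :
    A.domain ⊓ LinearMap.range A.toFun ≤ optSubmodule A ν ψ := by
  rintro x ⟨hx, ⟨y, rfl⟩⟩
  have h1 := h.oneAddInv_apply y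
  have h2 := h.oneAddInv_apply ⟨A.toFun y, hx⟩
  convert h.apply_sub_sq_mem hψ ((y + A y) + (A.toFun y + A ⟨A.toFun y, hx⟩)) using 1
  simp only [sub_apply, mul_apply_eq_comp]
  rw [map_add, h1, h2]
  change A.toFun y = (y + A.toFun y) - oneAddInv A (y + A y)
  rw [h1, add_sub_cancel_left]

/-- The bounded operator A(1 + A)⁻¹ = 1 - (1 + A)⁻¹ has range containing R(A), so it sends the dense
set D(A) to a dense set; that image consists of vectors A(1 + A)⁻² v. -/
lemma CalcSetup.dense_optSubmodule (h : CalcSetup A θ M ν ω) (hψ : MemHInftyZero ω ψ)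
    (hD : Dense (A.domain : Set E)) (hR : Dense (LinearMap.range A.toFun : Set E)) :
    Dense (optSubmodule A ν ψ : Set E) := by
  have hdr : DenseRange fun x : E => x - oneAddInv A x := by
    refine hR.mono ?_
    rintro _ ⟨y, rfl⟩
    refine ⟨y + A y, ?_⟩
    simp only [h.oneAddInv_apply y]
    exact add_sub_cancel_left _ _
  refine (hdr.dense_image (by fun_prop) hD).mono ?_
  rintro _ ⟨y, hy, rfl⟩
  have h1 := h.oneAddInv_apply ⟨y, hy⟩
  change y - oneAddInv A y ∈ optSubmodule A ν ψ
  convert h.apply_sub_sq_mem hψ (y + A ⟨y, hy⟩) using 1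
  simp only [sub_apply, mul_apply_eq_comp, h1]

end Complete

end

section

/-! ### Uniqueness and convolutions -/

open Filter Topology ENNReal

section Uniqueness

variable {E : Type*} [NormedAddCommGroup E] [NormedSpace ℂ E] [CompleteSpace E]
  {A : E →ₗ.[ℂ] E} {T : ℝ → E →L[ℂ] E} {N : ℝ}

omit [CompleteSpace E] in
lemma hasDerivAt_clm_apply {U : ℝ → E →L[ℂ] E} {U' : E →L[ℂ] E} {w : ℝ → E} {w' : E} {s : ℝ}
    (hU : HasDerivAt U U' s) (hw : HasDerivAt w w' s) :
    HasDerivAt (fun s => U s (w s)) (U' (w s) + U s w') s := by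
  have h1 := (ContinuousLinearMap.restrictScalarsL ℂ E E ℝ ℝ).hasFDerivAt.comp_hasDerivAt s hU
  exact h1.clm_apply hw

/-- A mild form of uniqueness for `D' + A D = 0`, `D(0) = 0`. -/
lemma SemigroupData.eq_zero_of_integral_eq (hT : SemigroupData A T N)
    (hinj : Function.Injective (oneAddInv A)) {D : ℝ → E} (hD : ContinuousOn D (Ici 0))
    (hint : ∀ t, 0 ≤ t → oneAddInv A (D t) = ∫ s in (0 : ℝ)..t, (oneAddInv A (D s) - D s))
    {t : ℝ} (ht : 0 ≤ t) : D t = 0 := by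
  set Q := oneAddInv A
  -- Applying Q makes the equation classical: w is differentiable for t > 0 with w' = w - D, which
  -- is -Aw.
  set w : ℝ → E := fun t => Q (D t) with hw
  have hwc : ContinuousOn w (Ici 0) := Q.continuous.comp_continuousOn hD
  have hw0 : w 0 = 0 := by
    have := hint 0 le_rfl
    rwa [intervalIntegral.integral_same] at this
  have hdc : ContinuousOn (fun s => w s - D s) (Ici 0) := hwc.sub hD
  have hwd : ∀ s, 0 < s → HasDerivAt w (w s - D s) s := by
    intro s hs
    have h1 : HasDerivAt (fun t => ∫ s in (0 : ℝ)..t, (w s - D s)) (w s - D s) s := by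
      refine intervalIntegral.integral_hasDerivAt_right ?_ ?_ ?_
      · refine (hdc.mono ?_).intervalIntegrable
        rw [uIcc_of_le hs.le]
        exact Icc_subset_Ici_self
      · exact (hdc.mono Ioi_subset_Ici_self).stronglyMeasurableAtFilter isOpen_Ioi s hs
      · exact hdc.continuousAt (Ici_mem_nhds hs)
    refine h1.congr_of_eventuallyEq ?_
    filter_upwards [Ioi_mem_nhds hs] with r hr
    exact hint r (le_of_lt hr)
  have hTd : ∀ σ, 0 < σ → ∀ x, deriv T σ (Q x) = T σ (Q x) - T σ x := by
    intro σ hσ x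
    have h1 := hasDerivAt_clm_apply (hT.differentiableAt σ hσ).hasDerivAt (hasDerivAt_const σ (Q x))
    rw [map_zero, add_zero] at h1
    exact h1.unique (hT.hasDerivAt_apply_oneAddInv hσ x)
  have hzero : ∀ h s, 0 < h → 0 < s → T h (w s) = 0 := by
    intro h s hh hs
    set τ := h + s with hτ
    -- The two terms of the product rule cancel, so φ is constant on (0, τ). It tends to 0 at 0
    -- because T is bounded and w(0) = 0.
    set φ : ℝ → E := fun s => T (τ - s) (w s) with hφ
    have hφd : ∀ r ∈ Ioo 0 τ, HasDerivAt φ 0 r := by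
      intro r hr
      have h1 := (hT.differentiableAt (τ - r) (sub_pos.2 hr.2)).hasDerivAt.comp_const_sub τ r
      have h2 := hasDerivAt_clm_apply h1 (hwd r hr.1)
      refine h2.congr_deriv ?_
      rw [neg_apply, hTd _ (sub_pos.2 hr.2), map_sub]
      abel
    have hsI : s ∈ Ioo 0 τ := ⟨hs, by linarith⟩
    have hconst : ∀ r ∈ Ioo 0 τ, φ r = φ s := fun r hr =>
      isOpen_Ioo.is_const_of_deriv_eq_zero isPreconnected_Ioo
        (fun x hx => (hφd x hx).differentiableAt.differentiableWithinAt)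
        (fun x hx => (hφd x hx).deriv) hr hsI
    have hev : ∀ᶠ r in 𝓝[>] (0 : ℝ), r ∈ Ioo 0 τ := Ioo_mem_nhdsGT (by linarith)
    have hlim : Tendsto φ (𝓝[>] 0) (𝓝 0) := by
      have h1 : Tendsto (fun r => N * ‖w r‖) (𝓝[>] 0) (𝓝 0) := by
        have h2 : Tendsto w (𝓝[>] 0) (𝓝 (w 0)) :=
          (hwc 0 self_mem_Ici).mono_left (nhdsWithin_mono _ Ioi_subset_Ici_self)
        have h3 := h2.norm.const_mul N
        rwa [hw0, norm_zero, mul_zero] at h3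
      refine squeeze_zero_norm' ?_ h1
      filter_upwards [hev] with r hr
      exact hT.norm_apply_le (sub_pos.2 hr.2) _
    have h4 : Tendsto φ (𝓝[>] 0) (𝓝 (φ s)) := by
      refine tendsto_const_nhds.congr' ?_
      filter_upwards [hev] with r hr
      exact (hconst r hr).symm
    have h5 := tendsto_nhds_unique h4 hlim
    rw [hφ] at h5
    simp only [hτ, add_sub_cancel_right] at h5
    exact h5
  have hDpos : ∀ s, 0 < s → D s = 0 := by
    intro s hs
    refine hinj ?_
    rw [map_zero]
    exact hT.nondegenerate _ fun h hh => hzero h s hh hs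
  rcases ht.eq_or_lt with rfl | ht
  · exact hinj (by rw [map_zero]; exact hw0)
  · exact hDpos t ht

end Uniqueness

/-! ### Convolution with a kernel whose orbits are integrable -/

section Convolution

variable {Y : Type*} [NormedAddCommGroup Y] [NormedSpace ℂ Y]

/-- The kernel `(t, s) ↦ S(t - s) f(s)` on `0 < s < t`. -/
def convKernel (S : ℝ → Y →L[ℂ] Y) (f : ℝ → Y) : ℝ × ℝ → Y :=
  {p : ℝ × ℝ | 0 < p.2 ∧ p.2 < p.1}.indicator fun p => S (p.1 - p.2) (f p.2)

variable {S : ℝ → Y →L[ℂ] Y} {f : ℝ → Y} {K : ℝ}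

lemma convKernel_of_nonpos {t s : ℝ} (hs : s ≤ 0) : convKernel S f (t, s) = 0 :=
  indicator_of_notMem (fun h => hs.not_gt h.1) _

lemma convKernel_of_pos {t s : ℝ} (hs : 0 < s) :
    convKernel S f (t, s) = (Ioi (0 : ℝ)).indicator (fun σ => S σ (f s)) (t - s) := by
  by_cases h : s < t
  · rw [indicator_of_mem (mem_Ioi.2 (sub_pos.2 h)), convKernel, indicator_of_mem]
    exact ⟨hs, h⟩
  · have hn : t - s ∉ Ioi (0 : ℝ) := fun h' => h (sub_pos.1 h')
    rw [indicator_of_notMem hn, convKernel, indicator_of_notMem]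
    exact fun h' => h h'.2

lemma convKernel_eq_indicator (t s : ℝ) :
    convKernel S f (t, s) = (Ioo 0 t).indicator (fun s => S (t - s) (f s)) s := by
  by_cases h : s ∈ Ioo 0 t
  · rw [indicator_of_mem h, convKernel, indicator_of_mem]
    exact h
  · rw [indicator_of_notMem h, convKernel, indicator_of_notMem]
    exact h

lemma aestronglyMeasurable_convKernel (hS : ContinuousOn S (Ioi 0))
    (hf : AEStronglyMeasurable f (volume.restrict (Ioi 0))) :
    AEStronglyMeasurable (convKernel S f) (volume.prod volume) := by
  have hm : MeasurableSet {p : ℝ × ℝ | 0 < p.2 ∧ p.2 < p.1} :=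
    (measurableSet_lt measurable_const measurable_snd).inter
      (measurableSet_lt measurable_snd measurable_fst)
  rw [convKernel, aestronglyMeasurable_indicator_iff hm]
  have h1 : AEStronglyMeasurable ((Ioi (0 : ℝ)).indicator f) volume :=
    (aestronglyMeasurable_indicator_iff measurableSet_Ioi).2 hf
  have h2 : AEStronglyMeasurable (fun p : ℝ × ℝ => (Ioi (0 : ℝ)).indicator f p.2)
      ((volume.prod volume).restrict {p : ℝ × ℝ | 0 < p.2 ∧ p.2 < p.1}) := h1.comp_snd.restrict
  have h3 : AEStronglyMeasurable (fun p : ℝ × ℝ => S (p.1 - p.2))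
      ((volume.prod volume).restrict {p : ℝ × ℝ | 0 < p.2 ∧ p.2 < p.1}) :=
    (hS.comp (by fun_prop) fun p hp => mem_Ioi.2 (sub_pos.2 hp.2)).aestronglyMeasurable hm
  refine ((ContinuousLinearMap.id ℂ (Y →L[ℂ] Y)).aestronglyMeasurable_comp₂ h3 h2).congr ?_
  filter_upwards [ae_restrict_mem hm] with p hp
  simp only [ContinuousLinearMap.id_apply]
  rw [indicator_of_mem (mem_Ioi.2 hp.1)]

/-- Tonelli with s outermost: for fixed s the shift t ↦ t - s reduces the inner integral to the
orbit of the single vector f(s). Integrability of ‖S(t)‖ in operator norm is not required. -/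
lemma lintegral_convKernel_le (hS : ContinuousOn S (Ioi 0))
    (hf : AEStronglyMeasurable f (volume.restrict (Ioi 0)))
    (hK : ∀ y, ∫⁻ t in Ioi (0 : ℝ), ‖S t y‖ₑ ≤ ENNReal.ofReal K * ‖y‖ₑ) :
    ∫⁻ p, ‖convKernel S f p‖ₑ ∂(volume.prod volume)
      ≤ ENNReal.ofReal K * ∫⁻ s in Ioi (0 : ℝ), ‖f s‖ₑ := by
  rw [lintegral_prod_symm _ (aestronglyMeasurable_convKernel hS hf).enorm,
    ← lintegral_const_mul' _ _ ENNReal.ofReal_ne_top, ← lintegral_indicator measurableSet_Ioi]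
  refine lintegral_mono fun s => ?_
  by_cases hs : 0 < s
  · rw [indicator_of_mem (mem_Ioi.2 hs)]
    simp only [convKernel_of_pos hs]
    rw [lintegral_sub_right_eq_self
      (fun σ => ‖(Ioi (0 : ℝ)).indicator (fun σ => S σ (f s)) σ‖ₑ) s]
    simp only [enorm_indicator_eq_indicator_enorm]
    rw [lintegral_indicator measurableSet_Ioi]
    exact hK (f s)
  · simp only [convKernel_of_nonpos (not_lt.1 hs), enorm_zero, lintegral_zero, zero_le]

lemma integrable_convKernel (hS : ContinuousOn S (Ioi 0)) (hf : IntegrableOn f (Ioi 0))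
    (hK : ∀ y, ∫⁻ t in Ioi (0 : ℝ), ‖S t y‖ₑ ≤ ENNReal.ofReal K * ‖y‖ₑ) :
    Integrable (convKernel S f) (volume.prod volume) :=
  ⟨aestronglyMeasurable_convKernel hS hf.1, (lintegral_convKernel_le hS hf.1 hK).trans_lt
    (ENNReal.mul_lt_top ENNReal.ofReal_lt_top hf.2)⟩

/-- The convolution `t ↦ ∫₀^t S(t - s) f(s) ds`. -/
def conv (S : ℝ → Y →L[ℂ] Y) (f : ℝ → Y) (t : ℝ) : Y := ∫ s, convKernel S f (t, s)

lemma integrable_conv (hS : ContinuousOn S (Ioi 0)) (hf : IntegrableOn f (Ioi 0))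
    (hK : ∀ y, ∫⁻ t in Ioi (0 : ℝ), ‖S t y‖ₑ ≤ ENNReal.ofReal K * ‖y‖ₑ) :
    Integrable (conv S f) :=
  (integrable_convKernel hS hf hK).integral_prod_left

lemma integral_norm_conv_le (hK0 : 0 ≤ K) (hS : ContinuousOn S (Ioi 0))
    (hf : IntegrableOn f (Ioi 0))
    (hK : ∀ y, ∫⁻ t in Ioi (0 : ℝ), ‖S t y‖ₑ ≤ ENNReal.ofReal K * ‖y‖ₑ) :
    ∫ t in Ioi (0 : ℝ), ‖conv S f t‖ ≤ K * ∫ t in Ioi (0 : ℝ), ‖f t‖ := by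
  have h0 : 0 ≤ K * ∫ t in Ioi (0 : ℝ), ‖f t‖ :=
    mul_nonneg hK0 (integral_nonneg fun _ => norm_nonneg _)
  rw [← ENNReal.ofReal_le_ofReal_iff h0, ENNReal.ofReal_mul hK0,
    ofReal_integral_norm_eq_lintegral_enorm hf,
    ofReal_integral_norm_eq_lintegral_enorm (integrable_conv hS hf hK).integrableOn]
  refine le_trans ?_ (lintegral_convKernel_le hS hf.1 hK)
  rw [lintegral_prod _ (aestronglyMeasurable_convKernel hS hf.1).enorm]
  refine (setLIntegral_le_lintegral _ _).trans (lintegral_mono fun t => ?_)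
  exact enorm_integral_le_lintegral_enorm _

lemma setIntegral_convKernel (t r : ℝ) :
    ∫ s in Ioc 0 t, convKernel S f (s, r)
      = (Ioo 0 t).indicator (fun r => ∫ σ in Ioc 0 (t - r), S σ (f r)) r := by
  rw [← integral_indicator measurableSet_Ioc]
  by_cases hr : 0 < r
  · have h1 : ∀ s, (Ioc 0 t).indicator (fun s => convKernel S f (s, r)) s
        = (Ioc 0 (t - r)).indicator (fun σ => S σ (f r)) (s - r) := by
      intro s
      simp only [indicator, convKernel_of_pos hr, mem_Ioc, mem_Ioi, sub_pos, sub_le_sub_iff_right]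
      by_cases h2 : r < s
      · simp only [h2, true_and, if_true, hr.trans h2]
      · simp only [h2, false_and, if_false, ite_self]
    simp only [h1]
    rw [integral_sub_right_eq_self (fun σ => (Ioc 0 (t - r)).indicator (fun σ => S σ (f r)) σ) r,
      integral_indicator measurableSet_Ioc]
    by_cases hrt : r < t
    · rw [indicator_of_mem (show r ∈ Ioo 0 t from ⟨hr, hrt⟩)]
    · rw [indicator_of_notMem (show r ∉ Ioo 0 t from fun h => hrt h.2),
        Ioc_eq_empty (fun h => hrt (sub_pos.1 h)), Measure.restrict_empty, integral_zero_measure]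
  · rw [indicator_of_notMem (show r ∉ Ioo 0 t from fun h => hr h.1)]
    simp only [convKernel_of_nonpos (not_lt.1 hr), indicator_zero, integral_zero]

/-- Fubini and a translation. The inner integral over (0, t - r] is where ∫₀^τ A T(σ) dσ = 1 - T(τ)
will enter. -/
lemma setIntegral_conv (hS : ContinuousOn S (Ioi 0)) (hf : IntegrableOn f (Ioi 0))
    (hK : ∀ y, ∫⁻ t in Ioi (0 : ℝ), ‖S t y‖ₑ ≤ ENNReal.ofReal K * ‖y‖ₑ) (t : ℝ) :
    IntegrableOn (fun r => ∫ σ in Ioc 0 (t - r), S σ (f r)) (Ioo 0 t) ∧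
    ∫ s in Ioc 0 t, conv S f s = ∫ r in Ioo 0 t, ∫ σ in Ioc 0 (t - r), S σ (f r) := by
  have hi : Integrable (convKernel S f) ((volume.restrict (Ioc 0 t)).prod volume) := by
    have := (integrable_convKernel hS hf hK).integrableOn (s := Ioc 0 t ×ˢ univ)
    rwa [IntegrableOn, ← Measure.prod_restrict, Measure.restrict_univ] at this
  constructor
  · rw [← integrable_indicator_iff measurableSet_Ioo]
    exact hi.integral_prod_right.congr (Eventually.of_forall fun r => setIntegral_convKernel t r)
  · simp only [conv]
    rw [integral_integral_swap (f := fun s r => convKernel S f (s, r)) hi,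
      ← integral_indicator measurableSet_Ioo]
    exact integral_congr_ae (Eventually.of_forall fun r => setIntegral_convKernel t r)

end Convolution

end

section

/-! ### Maximal regularity -/

open Filter Topology ENNReal

section MaximalRegularity

variable {E : Type*} [NormedAddCommGroup E] [NormedSpace ℂ E]
  {A : E →ₗ.[ℂ] E} {θ M ν ω : ℝ} {T : ℝ → E →L[ℂ] E} {N : ℝ} {ψ : ℂ → ℂ}

/-- An operator that commutes with all `ψ(tA)` restricts to `X` without increasing its norm. -/
lemma exists_optSpace_restrict (B : E →L[ℂ] E)
    (hB : ∀ t, 0 < t → ∀ x, orbit A ν ψ (B x) t = B (orbit A ν ψ x t)) :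
    ∃ B' : OptSpace A ν ψ →L[ℂ] OptSpace A ν ψ,
      (∀ x, optIncl A ν ψ (B' x) = B (optIncl A ν ψ x)) ∧ ‖B'‖ ≤ ‖B‖ := by
  have hint : ∀ x : E, IntegrableOn (orbit A ν ψ x) (Ioi 0) →
      IntegrableOn (orbit A ν ψ (B x)) (Ioi 0) := fun x hx =>
    IntegrableOn.congr_fun (B.integrable_comp hx) (fun t ht => (hB t ht x).symm) measurableSet_Ioi
  let B₀ : OptSpace A ν ψ →ₗ[ℂ] OptSpace A ν ψ :=
    { toFun := fun x => ⟨B x.1, hint x.1 x.2⟩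
      map_add' := fun x y => Subtype.ext (map_add B x.1 y.1)
      map_smul' := fun c x => Subtype.ext (map_smul B c x.1) }
  have hb : ∀ x, ‖B₀ x‖ ≤ ‖B‖ * ‖x‖ := by
    intro x
    change ‖B x.1‖ + ∫ t in Ioi (0 : ℝ), ‖orbit A ν ψ (B x.1) t‖
      ≤ ‖B‖ * (‖x.1‖ + ∫ t in Ioi (0 : ℝ), ‖orbit A ν ψ x.1 t‖)
    have hx : IntegrableOn (orbit A ν ψ x.1) (Ioi 0) := x.2
    rw [mul_add, ← integral_const_mul]
    refine add_le_add (B.le_opNorm _) (setIntegral_mono_on (hint _ hx).norm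
      (hx.norm.const_mul _) measurableSet_Ioi fun t ht => ?_)
    rw [hB t ht]
    exact B.le_opNorm _
  exact ⟨B₀.mkContinuous ‖B‖ hb, fun x => rfl, B₀.mkContinuous_norm_le (norm_nonneg _) hb⟩

variable [CompleteSpace E]

lemma CalcSetup.orbit_genExp (h : CalcSetup A θ M ν ω) (hψ : MemHInftyZero ω ψ) {t r : ℝ}
    (ht : 0 < t) (hr : 0 < r) (x : E) :
    orbit A ν ψ (genExp A ν t x) r = genExp A ν t (orbit A ν ψ x r) := by
  have h1 := h.calculus_comm (hψ.scale hr) (memHInftyZero_mul_exp h.omega_pos h.lt_half_pi ht)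
  rw [h.orbit_eq hr, h.orbit_eq hr, ContinuousLinearMap.map_smul_of_tower]
  congr 1
  exact DFunLike.congr_fun h1 x

/-- The operators `A T(t)` on `X`. -/
lemma SemigroupData.exists_optSpace_genExp (hT : SemigroupData A T N) (h : CalcSetup A θ M ν ω)
    (hψ : MemHInftyZero ω ψ) (hψ0 : ∃ z ∈ sector ω, ψ z ≠ 0) :
    ∃ (S : ℝ → OptSpace A ν ψ →L[ℂ] OptSpace A ν ψ) (K : ℝ), 0 ≤ K ∧
      (∀ t, 0 < t → ∀ x, optIncl A ν ψ (S t x) = genExp A ν t (optIncl A ν ψ x)) ∧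
      ContinuousOn S (Ioi 0) ∧
      ∀ x, ∫⁻ t in Ioi (0 : ℝ), ‖S t x‖ₑ ≤ ENNReal.ofReal K * ‖x‖ₑ := by
  have hex : ∀ t : ℝ, ∃ B' : OptSpace A ν ψ →L[ℂ] OptSpace A ν ψ, 0 < t →
      ∀ x, optIncl A ν ψ (B' x) = genExp A ν t (optIncl A ν ψ x) := by
    intro t
    by_cases ht : 0 < t
    · obtain ⟨B', hB', _⟩ := exists_optSpace_restrict (genExp A ν t)
        fun r hr x => h.orbit_genExp hψ ht hr x
      exact ⟨B', fun _ => hB'⟩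
    · exact ⟨0, fun ht' => absurd ht' ht⟩
  choose S hS using hex
  obtain ⟨K, hK, hb⟩ := hT.lintegral_genExp_le h hψ hψ0
  refine ⟨S, K, hK, hS, fun t ht => ?_, fun x => ?_⟩
  · have h1 := h.continuousOn_genExp t ht
    rw [ContinuousWithinAt, tendsto_iff_norm_sub_tendsto_zero] at h1 ⊢
    refine squeeze_zero' (Eventually.of_forall fun _ => norm_nonneg _) ?_ h1
    filter_upwards [self_mem_nhdsWithin] with s hs
    -- The difference A T(s) - A T(t) also commutes with every ψ(rA), so its norm on X is at most
    -- its ambient norm and continuity is inherited.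
    obtain ⟨B', hB', hn⟩ := exists_optSpace_restrict (A := A) (ν := ν) (ψ := ψ)
      (genExp A ν s - genExp A ν t) fun r hr x => by
        rw [sub_apply, sub_eq_add_neg, orbit_add, Pi.add_apply, ← neg_one_smul ℂ, orbit_smul,
          Pi.smul_apply, h.orbit_genExp hψ hs hr, h.orbit_genExp hψ ht hr, sub_apply,
          neg_one_smul, sub_eq_add_neg]
    have he : S s - S t = B' := by
      ext1 x
      refine optIncl_injective ?_
      rw [hB', sub_apply, map_sub, hS s hs, hS t ht, sub_apply]
    rw [he]
    exact hn
  · calc ∫⁻ t in Ioi (0 : ℝ), ‖S t x‖ₑ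
        = ∫⁻ t in Ioi (0 : ℝ), (‖genExp A ν t x.1‖ₑ + orbitNorm A ν ψ (genExp A ν t x.1)) := by
          refine setLIntegral_congr_fun measurableSet_Ioi fun t ht => ?_
          rw [enorm_optSpace]
          have h1 : (S t x).1 = genExp A ν t x.1 := hS t ht x
          rw [h1]
      _ ≤ ENNReal.ofReal K * orbitNorm A ν ψ x.1 := hb x.1
      _ ≤ ENNReal.ofReal K * ‖x‖ₑ := by
          rw [enorm_optSpace]
          gcongr
          exact le_add_self

/-- `∫₀^τ A T(σ) x dσ = x - T(τ) x` if the integral converges. -/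
lemma SemigroupData.integral_genExp (hT : SemigroupData A T N) (h : CalcSetup A θ M ν ω)
    {τ : ℝ} (hτ : 0 < τ) {x : E} (hi : IntegrableOn (fun σ => genExp A ν σ x) (Ioc 0 τ)) :
    ∫ σ in Ioc 0 τ, genExp A ν σ x = x - T τ x := by
  -- Integrability alone does not give T(σ)x → x as σ → 0, whereas T(σ)(1 + A)⁻¹x does converge;
  -- hence the fundamental theorem is applied after (1 + A)⁻¹.
  refine h.oneAddInv_injective ?_
  have hc : ∀ σ, 0 < σ → ∀ y, T σ (oneAddInv A y) = oneAddInv A (T σ y) := fun σ hσ y =>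
    DFunLike.congr_fun (hT.comm_oneAddInv hσ) y
  have hd : ∀ σ, 0 < σ →
      HasDerivAt (fun σ => -T σ (oneAddInv A x)) (oneAddInv A (genExp A ν σ x)) σ := by
    intro σ hσ
    refine (hT.hasDerivAt_apply_oneAddInv hσ x).fun_neg.congr_deriv ?_
    have h1 := DFunLike.congr_fun (hT.oneAddInv_mul_genExp h hσ) x
    simp only [mul_apply_eq_comp, sub_apply] at h1
    rw [h1, hc σ hσ, neg_sub]
  have h1 := (oneAddInv A).integral_comp_comm hi
  rw [← h1, ← intervalIntegral.integral_of_le hτ.le,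
    intervalIntegral.integral_eq_sub_of_hasDerivAt_of_tendsto hτ (fun σ hσ => hd σ hσ.1)
      ((intervalIntegrable_iff_integrableOn_Ioc_of_le hτ.le).2 ((oneAddInv A).integrable_comp hi))
      (hT.tendsto_apply_oneAddInv x).neg
      ((hd τ hτ).continuousAt.tendsto.mono_left nhdsWithin_le_nhds),
    hc τ hτ, map_sub]
  abel

omit [CompleteSpace E] in
lemma SemigroupData.integrableOn_apply_sub (hT : SemigroupData A T N) {F : ℝ → E} {t : ℝ}
    (hF : IntegrableOn F (Ioo 0 t)) : IntegrableOn (fun r => T (t - r) (F r)) (Ioo 0 t) := by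
  refine (hF.norm.const_mul N).mono' ?_ ?_
  · have h1 : ContinuousOn (fun r => T (t - r)) (Ioo 0 t) :=
      hT.continuousOn.comp (by fun_prop) fun r hr => mem_Ioi.2 (sub_pos.2 hr.2)
    exact (ContinuousLinearMap.id ℂ (E →L[ℂ] E)).aestronglyMeasurable_comp₂
      (h1.aestronglyMeasurable measurableSet_Ioo) hF.1
  · filter_upwards [ae_restrict_mem measurableSet_Ioo] with r hr
    exact hT.norm_apply_le (sub_pos.2 hr.2) _

lemma SemigroupData.strongSolution_unique (hT : SemigroupData A T N) (h : CalcSetup A θ M ν ω)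
    [CompleteSpace (OptSpace A ν ψ)] {f u v g u' v' g' : ℝ → OptSpace A ν ψ}
    (hu' : IsStrongSolution (optPart A ν ψ) f 0 u' v' g')
    (hu : IsStrongSolution (optPart A ν ψ) f 0 u v g) {t : ℝ} (ht : 0 ≤ t) : u' t = u t := by
  set ι := optIncl A ν ψ
  have hloc : ∀ t, 0 ≤ t → IntervalIntegrable (fun s => ι (v' s - v s)) volume 0 t := by
    intro t ht
    rw [intervalIntegrable_iff_integrableOn_Ioc_of_le ht]
    rcases ht.eq_or_lt with rfl | ht
    · rw [Ioc_self]; exact integrableOn_empty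
    · exact ι.integrable_comp
        (Integrable.sub (hu'.locallyIntegrable t ht) (hu.locallyIntegrable t ht))
  have hDeq : ∀ t, 0 ≤ t → ι (u' t - u t) = ∫ s in (0 : ℝ)..t, ι (v' s - v s) := by
    intro t ht
    have hli : ∀ {u v g : ℝ → OptSpace A ν ψ}, IsStrongSolution (optPart A ν ψ) f 0 u v g →
        IntervalIntegrable v volume 0 t := by
      intro u v g hu
      rw [intervalIntegrable_iff_integrableOn_Ioc_of_le ht]
      rcases ht.eq_or_lt with rfl | ht
      · rw [Ioc_self]; exact integrableOn_empty
      · exact hu.locallyIntegrable t ht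
    rw [hu.eq_integral t ht, hu'.eq_integral t ht, zero_add, zero_add,
      ← intervalIntegral.integral_sub (hli hu') (hli hu),
      ContinuousLinearMap.intervalIntegral_comp_comm _ ((hli hu').sub (hli hu))]
  have hDc : ContinuousOn (fun t => ι (u' t - u t)) (Ici 0) := by
    refine ContinuousOn.congr (f := fun t => ∫ s in (0 : ℝ)..t, ι (v' s - v s)) ?_ hDeq
    intro t ht
    have ht' : (0 : ℝ) ≤ t + 1 := add_nonneg ht zero_le_one
    have h1 := intervalIntegral.continuousOn_primitive_interval'
      (hloc (t + 1) ht') left_mem_uIcc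
    rw [uIcc_of_le ht'] at h1
    refine (h1 t ⟨ht, by linarith⟩).mono_of_mem_nhdsWithin ?_
    rw [← Ici_inter_Iic]
    exact inter_mem_nhdsWithin _ (Iic_mem_nhds (by linarith))
  refine sub_eq_zero.1 (optIncl_injective ?_)
  rw [map_zero]
  refine hT.eq_zero_of_integral_eq h.oneAddInv_injective hDc (fun t ht => ?_) ht
  rw [hDeq t ht, ← ContinuousLinearMap.intervalIntegral_comp_comm _ (hloc t ht)]
  refine intervalIntegral.integral_congr_ae ?_
  -- Subtracting the equations gives v' - v = g - g', and the graph criterion Q(u + g) = u gives Qg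
  -- = u - Qu for each solution. Together they yield the integrand (Q - 1)(u' - u).
  have hae := (ae_restrict_iff' measurableSet_Ioi).1 (hu'.equation.and hu.equation)
  filter_upwards [hae] with s hs hst
  rw [uIoc_of_le ht] at hst
  obtain ⟨⟨e1, e2⟩, e3, e4⟩ := hs hst.1
  have e5 := (h.mem_graph_optPart_iff _ _).1 e1
  have e6 := (h.mem_graph_optPart_iff _ _).1 e3
  have e7 : v' s - v s = g s - g' s := by
    rw [sub_eq_sub_iff_add_eq_add, e2, add_comm, e4]
  rw [e7]
  rw [map_add] at e5 e6
  simp only [map_sub]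
  rw [← eq_sub_iff_add_eq'] at e5 e6
  rw [e5, e6]
  abel

/-- The candidate for Au is g, the convolution of A T with f, bounded in L¹ by the key estimate; u
is defined as the primitive of f - g. What needs proof is that u(t) lies in the domain with Au = g
almost everywhere. -/
lemma SemigroupData.hasL1MaximalRegularity (hT : SemigroupData A T N) (h : CalcSetup A θ M ν ω)
    (hψ : MemHInftyZero ω ψ) (hψ0 : ∃ z ∈ sector ω, ψ z ≠ 0) :
    HasL1MaximalRegularity (optPart A ν ψ) := by
  have := h.completeSpace_optSpace hψ
  obtain ⟨S, K, hK0, hS, hSc, hK⟩ := hT.exists_optSpace_genExp h hψ hψ0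
  set ι := optIncl A ν ψ
  -- One K bounds Au, and u' = f - Au contributes 1 + K.
  refine ⟨1 + 2 * K, fun f hf => ?_⟩
  set g := conv S f with hg
  have hgi : IntegrableOn g (Ioi 0) := (integrable_conv hSc hf hK).integrableOn
  have hvi : IntegrableOn (fun t => f t - g t) (Ioi 0) := Integrable.sub hf hgi
  have hsol : IsStrongSolution (optPart A ν ψ) f 0
      (fun t => ∫ s in (0 : ℝ)..t, (f s - g s)) (fun t => f t - g t) g := by
    refine ⟨fun τ hτ => hvi.mono_set Ioc_subset_Ioi_self, fun t _ => (zero_add _).symm, ?_⟩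
    filter_upwards [ae_restrict_mem measurableSet_Ioi,
      ae_restrict_of_ae (integrable_convKernel hSc hf hK).prod_right_ae] with t ht hkt
    refine ⟨(h.mem_graph_optPart_iff _ _).2 ?_, sub_add_cancel _ _⟩
    have ht' : 0 < t := ht
    have hft : IntegrableOn f (Ioo 0 t) := hf.mono_set Ioo_subset_Ioi_self
    have hιf : IntegrableOn (fun r => ι (f r)) (Ioo 0 t) := ι.integrable_comp hft
    have hTf := hT.integrableOn_apply_sub hιf
    have hSi : ∀ y τ, IntegrableOn (fun σ => S σ y) (Ioc 0 τ) := by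
      intro y τ
      have h1 : IntegrableOn (fun σ => S σ y) (Ioi 0) :=
        ⟨(hSc.clm_apply continuousOn_const).aestronglyMeasurable measurableSet_Ioi,
          (hK y).trans_lt (ENNReal.mul_lt_top ENNReal.ofReal_lt_top enorm_lt_top)⟩
      exact h1.mono_set Ioc_subset_Ioi_self
    have hinner : ∀ r ∈ Ioo 0 t, ι (∫ σ in Ioc 0 (t - r), S σ (f r))
        = ι (f r) - T (t - r) (ι (f r)) := by
      intro r hr
      have hSr := ι.integrable_comp (hSi (f r) (t - r))
      have e1 : EqOn (fun σ => ι (S σ (f r))) (fun σ => genExp A ν σ (ι (f r)))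
          (Ioc 0 (t - r)) := fun σ hσ => hS σ hσ.1 _
      rw [← ι.integral_comp_comm (hSi _ _), setIntegral_congr_fun measurableSet_Ioc e1]
      exact hT.integral_genExp h (sub_pos.2 hr.2)
        (IntegrableOn.congr_fun hSr e1 measurableSet_Ioc)
    -- Identifies u with the mild solution: the primitive of g at t is the integral of f(r) - T(t -
    -- r)f(r) over (0, t).
    have hu : ι (∫ s in (0 : ℝ)..t, (f s - g s)) = ∫ r in Ioo 0 t, T (t - r) (ι (f r)) := by
      obtain ⟨c1, c2⟩ := setIntegral_conv hSc hf hK t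
      rw [intervalIntegral.integral_of_le ht'.le,
        integral_sub (hf.mono_set Ioc_subset_Ioi_self) (hgi.mono_set Ioc_subset_Ioi_self), c2,
        integral_Ioc_eq_integral_Ioo, map_sub, ← ι.integral_comp_comm hft,
        ← ι.integral_comp_comm c1, setIntegral_congr_fun measurableSet_Ioo hinner,
        integral_sub hιf hTf]
      exact sub_sub_cancel _ _
    have hk : ∀ r, ι (convKernel S f (t, r))
        = (Ioo 0 t).indicator (fun r => genExp A ν (t - r) (ι (f r))) r := by
      intro r
      rw [convKernel_eq_indicator]
      by_cases hr : r ∈ Ioo 0 t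
      · rw [indicator_of_mem hr, indicator_of_mem hr, hS _ (sub_pos.2 hr.2)]
      · rw [indicator_of_notMem hr, indicator_of_notMem hr, map_zero]
    have hgen : IntegrableOn (fun r => genExp A ν (t - r) (ι (f r))) (Ioo 0 t) := by
      rw [← integrable_indicator_iff measurableSet_Ioo]
      exact (ι.integrable_comp hkt).congr (Eventually.of_forall hk)
    have hgt : ι (g t) = ∫ r in Ioo 0 t, genExp A ν (t - r) (ι (f r)) := by
      rw [hg, conv, ← ι.integral_comp_comm hkt, ← integral_indicator measurableSet_Ioo]
      exact integral_congr_ae (Eventually.of_forall hk)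
    have hgenr : ∀ r ∈ Ioo 0 t, oneAddInv A (genExp A ν (t - r) (ι (f r)))
        = T (t - r) (ι (f r)) - oneAddInv A (T (t - r) (ι (f r))) := fun r hr =>
      DFunLike.congr_fun (hT.oneAddInv_mul_genExp h (sub_pos.2 hr.2)) (ι (f r))
    -- Under the integral (1 + A)⁻¹ A T = T - (1 + A)⁻¹ T, which yields (1 + A)⁻¹(u + g) = u, the
    -- graph criterion for Au = g.
    rw [map_add, hu, hgt, ← (oneAddInv A).integral_comp_comm hgen,
      setIntegral_congr_fun measurableSet_Ioo hgenr,
      integral_sub hTf ((oneAddInv A).integrable_comp hTf), (oneAddInv A).integral_comp_comm hTf]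
    abel
  refine ⟨_, _, _, hsol, hvi, hgi, ?_, ?_⟩
  · have h1 := integral_norm_conv_le hK0 hSc hf hK
    have h2 : ∫ t in Ioi (0 : ℝ), ‖f t - g t‖
        ≤ (∫ t in Ioi (0 : ℝ), ‖f t‖) + ∫ t in Ioi (0 : ℝ), ‖g t‖ := by
      rw [← integral_add hf.norm hgi.norm]
      exact integral_mono hvi.norm (hf.norm.add hgi.norm) fun t => norm_sub_le _ _
    linarith
  · exact fun u₁ v₁ g₁ h₁ t ht => hT.strongSolution_unique h h₁ hsol ht

end MaximalRegularity

end

end L1MR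

end

theorem theorem2p22 {E : Type*} [NormedAddCommGroup E] [NormedSpace ℂ E] [CompleteSpace E]
    (A : E →ₗ.[ℂ] E) (hA : L1MR.NegGeneratesBoundedAnalyticSemigroup A)
    (ω : ℝ) (hω : L1MR.sectorialityAngle A < ω) (hω' : ω < Real.pi / 2)
    (ψ : ℂ → ℂ) (hψ : L1MR.MemHInftyZero ω ψ) (hψ0 : ∃ z ∈ L1MR.sector ω, ψ z ≠ 0)
    (ν : ℝ) (hν : L1MR.sectorialityAngle A < ν) (hν' : ν < ω) :
    CompleteSpace (L1MR.OptSpace A ν ψ) ∧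
      (L1MR.optPart A ν ψ).IsClosed ∧
      L1MR.HasL1MaximalRegularity (L1MR.optPart A ν ψ) ∧
      A.domain ⊓ LinearMap.range A.toFun ≤ L1MR.optSubmodule A ν ψ ∧
      (Dense (A.domain : Set E) → Dense (LinearMap.range A.toFun : Set E) →
        Dense (L1MR.optSubmodule A ν ψ : Set E)) := by
  obtain ⟨⟨T, N, hT⟩, hsec⟩ := L1MR.exists_semigroupData hA
  obtain ⟨θ, M, hθ, hb⟩ := L1MR.exists_sectorBound hsec hν
    (by linarith [Real.pi_pos])
  have h : L1MR.CalcSetup A θ M ν ω := ⟨hb, hθ, hν', hω'⟩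
  exact ⟨h.completeSpace_optSpace hψ, h.isClosed_optPart, hT.hasL1MaximalRegularity h hψ hψ0,
    h.domain_inf_range_le hψ, h.dense_optSubmodule hψ⟩
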